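/- **Setting.** Let $A,\Sigma_x,\Sigma_y,\Sigma\in\mathbb R^{d\times d}$ with $A$ nonsingular and $\Sigma_x,\Sigma_y,\Sigma$ symmetric positive definite, $\sigma\in\mathbb R$, $\mu_*\in\mathbb R^d$. At each time $t=1,2,\dots$ each arm $i\in\{1,\dots,N\}$ has an unobserved context $x_i(t)\sim N(0_d,\Sigma_x)$, an output $y_i(t)=Ax_i(t)+\varepsilon_{y_i}(t)$ with $\varepsilon_{y_i}(t)\sim N(0_d,\Sigma_y)$, and a reward $r_i(t)=x_i(t)^\top\mu_*+\varepsilon_{r_i}(t)$ with $\varepsilon_{r_i}(t)\sim N(0,\sigma^2)$; all contexts and noises are independent. Put $D=(A^\top\Sigma_y^{-1}A+\Sigma_x^{-1})^{-1}A^\top\Sigma_y^{-1}$ and $\widehat x_i(t)=Dy_i(t)$. **Thompson sampling.** At time $t$ the learner draws $\widetilde\mu(t)$, given the past and independently of the contexts and noises of time $t$, from $N(\widehat\mu(t),B(t)^{-1})$, where $$B(t)=\Sigma^{-1}+\sum_{\tau=1}^{t-1}\widehat x_{a(\tau)}(\tau)\widehat x_{a(\tau)}(\tau)^\top,\qquad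 \widehat\mu(t)=B(t)^{-1}\sum_{\tau=1}^{t-1}\widehat x_{a(\tau)}(\tau)\,r_{a(\tau)}(\tau),$$ selects $a(t)=\arg\max_{1\le i\le N}\widehat x_i(t)^\top\widetilde\mu(t)$ and receives $r_{a(t)}(t)$. The optimal arm is $a^*(t)=\arg\max_{1\le i\le N}\widehat x_i(t)^\top\mu_*$; ties are broken by any fixed measurable rule. The regret is $$\mathrm{Regret}(T)=\mathbb E\Big[\sum_{t=1}^T \big(r_{a^*(t)}(t)-r_{a(t)}(t)\big)\Big].$$ **Theorem.** For every $\kappa>0$ there is a constant $C=C(\kappa)$ such that the following holds for all $d$, all $N$ and all $A,\Sigma_x,\Sigma_y,\Sigma,\sigma,\mu_*$ as above for which the eigenvalues of $\Sigma_x,\Sigma_y,\Sigma$ and the singular values of $A$ lie in $[\kappa^{-1},\kappa]$, $\sigma^2\le\kappa$, and either $\mu_*=0$ or $\kappa^{-1}\le\|\mu_*\|\le\kappa$: for all $T\ge2$ the sum in the definition of $\mathrm{Regret}(T)$ is integrable and $$|\mathrm{Regret}(T)|\le C\,d\,\sqrt{\log N}\,\log T .$$ That is, $\mathrm{Regret}(T)=O(d\sqrt{\log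 N}\,\log T)$, with an implied constant that does not depend on $d$, $N$ or $T$. -/

import Mathlib

open MeasureTheory ProbabilityTheory

noncomputable section

/-- Parameters of a partially observable linear contextual bandit in dimension `d`, together with
the covariance parameter `S0` which initializes the posterior of the learner. -/
structure Params (d : ℕ) where
  /-- the known output matrix -/
  A : Matrix (Fin d) (Fin d) ℝ
  /-- covariance of the contexts -/
  Sx : Matrix (Fin d) (Fin d) ℝ
  /-- covariance of the output noise -/
  Sy : Matrix (Fin d) (Fin d) ℝ
  /-- the symmetric positive definite matrix whose inverse initializes the posterior precision -/
  S0 : Matrix (Fin d) (Fin d) ℝ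
  /-- standard deviation of the reward noise -/
  sigma : ℝ
  /-- the true (unknown) parameter -/
  mu : EuclideanSpace ℝ (Fin d)

namespace Params

variable {d : ℕ}

/-- `A` is nonsingular and the covariance matrices are (symmetric) positive definite. -/
structure Admissible (p : Params d) : Prop where
  isUnit_det : IsUnit p.A.det
  posDef_x : p.Sx.PosDef
  posDef_y : p.Sy.PosDef
  posDef_0 : p.S0.PosDef

/-- All eigenvalues of the covariance matrices and all singular values of `A` lie in `[κ⁻¹, κ]`,
the variance of the reward noise is at most `κ`, and the true parameter is zero or has norm in
`[κ⁻¹, κ]`. -/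
structure BoundedBy (p : Params d) (κ : ℝ) : Prop where
  bound_A : ∀ v, κ⁻¹ * ‖v‖ ≤ ‖p.A.toEuclideanLin v‖ ∧ ‖p.A.toEuclideanLin v‖ ≤ κ * ‖v‖
  bound_x : ∀ v, κ⁻¹ * ‖v‖ ^ 2 ≤ inner ℝ v (p.Sx.toEuclideanLin v) ∧
    inner ℝ v (p.Sx.toEuclideanLin v) ≤ κ * ‖v‖ ^ 2
  bound_y : ∀ v, κ⁻¹ * ‖v‖ ^ 2 ≤ inner ℝ v (p.Sy.toEuclideanLin v) ∧
    inner ℝ v (p.Sy.toEuclideanLin v) ≤ κ * ‖v‖ ^ 2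
  bound_0 : ∀ v, κ⁻¹ * ‖v‖ ^ 2 ≤ inner ℝ v (p.S0.toEuclideanLin v) ∧
    inner ℝ v (p.S0.toEuclideanLin v) ≤ κ * ‖v‖ ^ 2
  bound_sigma : p.sigma ^ 2 ≤ κ
  bound_mu : p.mu = 0 ∨ (κ⁻¹ ≤ ‖p.mu‖ ∧ ‖p.mu‖ ≤ κ)

/-- The matrix `D = (Aᵀ Σy⁻¹ A + Σx⁻¹)⁻¹ Aᵀ Σy⁻¹` that turns an output into a context estimate. -/
def D (p : Params d) : Matrix (Fin d) (Fin d) ℝ :=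
  (p.A.transpose * p.Sy⁻¹ * p.A + p.Sx⁻¹)⁻¹ * p.A.transpose * p.Sy⁻¹

end Params

/-- A rule that selects a maximizer of `i ↦ ⟨xs i, m⟩` (with an arbitrary measurable
tie-breaking). -/
structure IsArgmaxRule {d N : ℕ}
    (sel : (Fin N → EuclideanSpace ℝ (Fin d)) → EuclideanSpace ℝ (Fin d) → Fin N) : Prop where
  measurable : Measurable (Function.uncurry sel)
  le : ∀ (xs : Fin N → EuclideanSpace ℝ (Fin d)) (m : EuclideanSpace ℝ (Fin d)) (i : Fin N),
    inner ℝ (xs i) m ≤ inner ℝ (xs (sel xs m)) m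

/-- The random quantities of an interaction of the learner with the environment. Rounds are
numbered `0, 1, 2, …`, so that round `t` is the time step `t + 1` in the usual numbering. -/
structure Interaction (d N : ℕ) (Ω : Type*) where
  /-- `x t i`: unobserved context of arm `i` in round `t` -/
  x : ℕ → Fin N → Ω → EuclideanSpace ℝ (Fin d)
  /-- `ey t i`: noise of the output of arm `i` in round `t` -/
  ey : ℕ → Fin N → Ω → EuclideanSpace ℝ (Fin d)
  /-- `er t i`: noise of the reward of arm `i` in round `t` -/
  er : ℕ → Fin N → Ω → ℝ
  /-- `muTilde t`: the parameter sampled by the learner in round `t` -/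
  muTilde : ℕ → Ω → EuclideanSpace ℝ (Fin d)

namespace Interaction

variable {d N : ℕ} {Ω : Type*}

/-- Contexts and noises of arm `i` in round `t`. -/
def armEnv (I : Interaction d N Ω) (t : ℕ) (i : Fin N) (ω : Ω) :
    EuclideanSpace ℝ (Fin d) × EuclideanSpace ℝ (Fin d) × ℝ :=
  (I.x t i ω, I.ey t i ω, I.er t i ω)

/-- Contexts and noises of all arms in round `t`. -/
def env (I : Interaction d N Ω) (t : ℕ) (ω : Ω) :
    Fin N → EuclideanSpace ℝ (Fin d) × EuclideanSpace ℝ (Fin d) × ℝ :=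
  fun i => I.armEnv t i ω

/-- The σ-algebra generated by everything that happened before round `t`. -/
abbrev past (I : Interaction d N Ω) (t : ℕ) : MeasurableSpace Ω :=
  ⨆ τ : Fin t, (MeasurableSpace.comap (I.env τ) inferInstance ⊔
    MeasurableSpace.comap (I.muTilde τ) inferInstance)

/-- The output `y_i(t) = A x_i(t) + ε_{y_i}(t)`. -/
def output (I : Interaction d N Ω) (p : Params d) (t : ℕ) (i : Fin N) (ω : Ω) :
    EuclideanSpace ℝ (Fin d) :=
  p.A.toEuclideanLin (I.x t i ω) + I.ey t i ω

/-- The context estimate `D y_i(t)`. -/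
def xHat (I : Interaction d N Ω) (p : Params d) (t : ℕ) (i : Fin N) (ω : Ω) :
    EuclideanSpace ℝ (Fin d) :=
  p.D.toEuclideanLin (I.output p t i ω)

/-- The reward `r_i(t) = x_i(t)ᵀ μ + ε_{r_i}(t)` of arm `i` in round `t`. -/
def reward (I : Interaction d N Ω) (p : Params d) (t : ℕ) (i : Fin N) (ω : Ω) : ℝ :=
  inner ℝ (I.x t i ω) p.mu + I.er t i ω

variable (sel : (Fin N → EuclideanSpace ℝ (Fin d)) → EuclideanSpace ℝ (Fin d) → Fin N)

/-- The optimal arm: it maximizes the estimated context times the true parameter. -/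
def optArm (I : Interaction d N Ω) (p : Params d) (t : ℕ) (ω : Ω) : Fin N :=
  sel (fun i => I.xHat p t i ω) p.mu

/-- The arm selected by the learner: it maximizes the estimated context times the sampled
parameter. -/
def arm (I : Interaction d N Ω) (p : Params d) (t : ℕ) (ω : Ω) : Fin N :=
  sel (fun i => I.xHat p t i ω) (I.muTilde t ω)

/-- The posterior precision matrix at the beginning of round `t`. -/
def B (I : Interaction d N Ω) (p : Params d) (t : ℕ) (ω : Ω) : Matrix (Fin d) (Fin d) ℝ :=
  p.S0⁻¹ + ∑ τ ∈ Finset.range t,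
    Matrix.vecMulVec (I.xHat p τ (I.arm sel p τ ω) ω).ofLp (I.xHat p τ (I.arm sel p τ ω) ω).ofLp

/-- The posterior mean at the beginning of round `t`. -/
def muHat (I : Interaction d N Ω) (p : Params d) (t : ℕ) (ω : Ω) : EuclideanSpace ℝ (Fin d) :=
  (I.B sel p t ω)⁻¹.toEuclideanLin
    (∑ τ ∈ Finset.range t,
      I.reward p τ (I.arm sel p τ ω) ω • I.xHat p τ (I.arm sel p τ ω) ω)

/-- `I` is an interaction of Thompson sampling with the bandit environment with parameters `p`:
contexts and noises are centered Gaussian with the given covariances and are independent (of each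
other, over the arms, and of everything that happened in earlier rounds), and in each round the
learner samples a parameter from the Gaussian posterior by fresh randomization. -/
structure IsThompson [MeasurableSpace Ω] (P : Measure Ω) (p : Params d)
    (I : Interaction d N Ω) : Prop where
  measurable_x : ∀ t i, Measurable (I.x t i)
  measurable_ey : ∀ t i, Measurable (I.ey t i)
  measurable_er : ∀ t i, Measurable (I.er t i)
  measurable_muTilde : ∀ t, Measurable (I.muTilde t)
  /-- law of the context, output noise and reward noise of an arm -/
  law_armEnv : ∀ t i, HasLaw (I.armEnv t i)
    ((multivariateGaussian 0 p.Sx).prod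
      ((multivariateGaussian 0 p.Sy).prod (gaussianReal 0 ⟨p.sigma ^ 2, sq_nonneg _⟩))) P
  /-- independence over the arms -/
  indep_arms : ∀ t, iIndepFun (fun i => I.armEnv t i) P
  /-- independence of the earlier rounds -/
  indep_past : ∀ t, Indep (MeasurableSpace.comap (I.env t) inferInstance) (I.past t) P
  /-- the sampled parameter has law `N(μ̂(t), B(t)⁻¹)` given the past and the current round's
  contexts and noises -/
  sample : ∀ t, ∀ s : Set (EuclideanSpace ℝ (Fin d)), MeasurableSet s →
    P⟦I.muTilde t ⁻¹' s | I.past t ⊔ MeasurableSpace.comap (I.env t) inferInstance⟧ =ᵐ[P]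
      fun ω => (multivariateGaussian (I.muHat sel p t ω) (I.B sel p t ω)⁻¹).real s

/-- The cumulative decrease in rewards over the first `T` rounds. -/
def rewardGap (I : Interaction d N Ω) (p : Params d) (T : ℕ) (ω : Ω) : ℝ :=
  ∑ t ∈ Finset.range T,
    (I.reward p t (I.optArm sel p t ω) ω - I.reward p t (I.arm sel p t ω) ω)

/-- The regret of the first `T` rounds. -/
def regret [MeasurableSpace Ω] (P : Measure Ω) (I : Interaction d N Ω) (p : Params d) (T : ℕ) :
    ℝ :=
  ∫ ω, I.rewardGap sel p T ω ∂P

end Interaction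

end

/-! Write the reward of an arm as ⟨x̂, μ⟩ + η. The matrix D is the regression matrix of the context
on the output and everything is jointly Gaussian, so η is centred, independent of x̂ and of bounded
variance (`Params.Admissible.law_armObs`). Both the optimal and the selected arm are chosen without
looking at the residuals of the round, so these cancel in expectation and the regret is Σ E⟨x̂_{a*}
− x̂_a, μ⟩.

If the arm is selected by a direction m, its context in direction v is distributed as cov(u,v)·M
plus an independent normal variable, where u is m scaled to unit variance and M is a maximum of N
standard normals (`measurePreserving_selected_inner`). Playing m instead of μ therefore costs (U −
p)·E M with E M = O(√log N), and U − p is quadratic in the error, of order min(1, ‖m − μ‖²)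
(`integral_regret_le`). Averaging over the posterior gives the spread S = min(1, tr B⁻¹ + ‖e‖²),
where e is the error of the posterior mean. What remains is Σ E S = O(d log T).

The same representation bounds the truncated second moment of the selected context x from below in
every direction, uniformly in d, N and m. Hence S is at most a constant times the conditional
expectation of log(1+h) + ⟨x,e⟩²/(1+h), where h = xᵀB⁻¹x (`min_one_le_lintegral`). The logarithms
sum to a ratio of determinants. The other terms are what the weighted error eᵀBe loses in a round,
while noise adds on average Var(η)·h/(1+h), at most Var(η)·log(1+h); so they sum to the same order.
This budget is of order d log(T log N), which suffices unless log N exceeds a fixed power of T.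

For such huge N (`min_one_le_lintegral_of_many_arms`), either B is at least T², or ‖e‖² > T³, or
some direction v has vᵀBv < T²‖v‖². In the last case the sampled parameter is correlated with v with
probability at least 1/2, the selected context is then of size √log N along v up to powers of T, and
log(1+h) is at least half of log log N with constant probability. The budget is now O(d log log N),
so these rounds contribute O(d). The first two cases contribute O(1), since the weighted error grows
at most linearly. All this needs d ≤ T; for d > T the trivial bound S ≤ 1 is enough. -/

noncomputable section

/-! ### One-dimensional Gaussian estimates, uniform in the number of arms. -/

/-- The law of the maximum of `N` independent standard normal variables. -/
def gaussianMax (N : ℕ) : Measure ℝ :=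
  (Measure.pi fun _ : Fin N => gaussianReal 0 1).map fun s => ⨆ i, s i

theorem le_iSup_fin {N : ℕ} (s : Fin N → ℝ) (i : Fin N) : s i ≤ ⨆ j, s j :=
  le_ciSup (Set.finite_range s).bddAbove i

theorem exists_eq_iSup_fin {N : ℕ} [NeZero N] (s : Fin N → ℝ) : ∃ i, s i = ⨆ j, s j :=
  exists_eq_ciSup_of_finite

theorem measurable_iSup_fin (N : ℕ) : Measurable fun s : Fin N → ℝ => ⨆ i, s i :=
  Measurable.iSup fun i => measurable_pi_apply i

instance (N : ℕ) : IsProbabilityMeasure (gaussianMax N) :=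
  Measure.isProbabilityMeasure_map (measurable_iSup_fin N).aemeasurable

theorem integral_eval_pi {N : ℕ} {X : Type*} [MeasurableSpace X] (γ : Measure X)
    [IsProbabilityMeasure γ] (f : X → ℝ) (hf : AEStronglyMeasurable f γ) (i : Fin N) :
    ∫ s, f (s i) ∂(Measure.pi fun _ : Fin N => γ) = ∫ x, f x ∂γ := by
  have h := measurePreserving_eval (fun _ : Fin N => γ) i
  have h2 : (Measure.pi fun _ : Fin N => γ).map (Function.eval i) = γ := h.map_eq
  conv_rhs => rw [← h2]
  rw [integral_map h.measurable.aemeasurable (by rw [h2]; exact hf)]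

theorem integrable_eval_pi {N : ℕ} {X : Type*} [MeasurableSpace X] (γ : Measure X)
    [IsProbabilityMeasure γ] (f : X → ℝ) (hf : Integrable f γ) (i : Fin N) :
    Integrable (fun s => f (s i)) (Measure.pi fun _ : Fin N => γ) :=
  (measurePreserving_eval (fun _ : Fin N => γ) i).integrable_comp_of_integrable hf

/-- Jensen's inequality for the maximum, in exponential form. -/
theorem integral_le_log_of_exp_le {N : ℕ} [NeZero N] (f : ℝ → ℝ) {K : ℝ} (hK : 0 < K)
    (hf : Integrable (fun x => Real.exp (f x)) (gaussianReal 0 1))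
    (hfK : ∫ x, Real.exp (f x) ∂(gaussianReal 0 1) ≤ K)
    (Y : (Fin N → ℝ) → ℝ) (hY : Integrable Y (Measure.pi fun _ : Fin N => gaussianReal 0 1))
    (hYf : ∀ s, ∃ i, Y s ≤ f (s i)) :
    ∫ s, Y s ∂(Measure.pi fun _ : Fin N => gaussianReal 0 1) ≤ Real.log N + Real.log K := by
  have hN : (0 : ℝ) < N := by exact_mod_cast Nat.pos_of_ne_zero (NeZero.ne N)
  -- The tangent of exp at 0 plays the role of Jensen: f − log a + 1 ≤ exp(f)/a. With a = N·K the
  -- sum of the exponentials over a integrates to at most 1, which cancels the −1.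
  set a : ℝ := N * K with ha
  have ha0 : 0 < a := mul_pos hN hK
  have hint : Integrable (fun s : Fin N → ℝ => ∑ i, Real.exp (f (s i)))
      (Measure.pi fun _ : Fin N => gaussianReal 0 1) :=
    integrable_finsetSum _ fun i _ => integrable_eval_pi _ (fun x => Real.exp (f x)) hf i
  have hpt : ∀ s, Y s ≤ (∑ i, Real.exp (f (s i))) / a + (Real.log a - 1) := by
    intro s
    obtain ⟨i, hi⟩ := hYf s
    have h1 := Real.add_one_le_exp (f (s i) - Real.log a)
    rw [Real.exp_sub, Real.exp_log ha0] at h1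
    have h2 : Real.exp (f (s i)) / a ≤ (∑ i, Real.exp (f (s i))) / a := by
      gcongr
      exact Finset.single_le_sum (f := fun i => Real.exp (f (s i)))
        (fun j _ => (Real.exp_pos _).le) (Finset.mem_univ i)
    linarith
  have h3 := integral_mono hY ((hint.div_const a).add (integrable_const _)) hpt
  simp only [Pi.add_apply] at h3
  rw [integral_add (hint.div_const a) (integrable_const _), integral_div,
    integral_finsetSum _ fun i _ => integrable_eval_pi _ (fun x => Real.exp (f x)) hf i] at h3
  simp only [integral_eval_pi _ (fun x => Real.exp (f x)) hf.1] at h3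
  simp only [integral_const, probReal_univ, smul_eq_mul, one_mul, Finset.sum_const,
    Finset.card_univ, Fintype.card_fin, nsmul_eq_mul] at h3
  have h4 : (N * ∫ x, Real.exp (f x) ∂(gaussianReal 0 1)) / a ≤ 1 := by
    rw [div_le_one ha0, ha]; gcongr
  rw [← Real.log_mul hN.ne' hK.ne', ← ha]
  linarith

theorem abs_iSup_fin_le {N : ℕ} [NeZero N] (s : Fin N → ℝ) : |⨆ i, s i| ≤ ∑ i, |s i| := by
  obtain ⟨i, hi⟩ := exists_eq_iSup_fin s
  rw [← hi]
  exact Finset.single_le_sum (f := fun i => |s i|) (fun j _ => abs_nonneg _) (Finset.mem_univ i)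

theorem iSup_fin_sq_le {N : ℕ} [NeZero N] (s : Fin N → ℝ) : (⨆ i, s i) ^ 2 ≤ ∑ i, s i ^ 2 := by
  obtain ⟨i, hi⟩ := exists_eq_iSup_fin s
  rw [← hi]
  exact Finset.single_le_sum (f := fun i => s i ^ 2) (fun j _ => sq_nonneg _) (Finset.mem_univ i)

theorem memLp_two_gaussianReal (v : NNReal) : MemLp (fun x : ℝ => x) 2 (gaussianReal 0 v) :=
  memLp_id_gaussianReal 2

theorem integrable_id_gaussianReal (v : NNReal) : Integrable (fun x : ℝ => x) (gaussianReal 0 v) :=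
  (memLp_two_gaussianReal v).integrable (by norm_num)

theorem integrable_sq_gaussianReal (v : NNReal) :
    Integrable (fun x : ℝ => x ^ 2) (gaussianReal 0 v) :=
  (memLp_two_gaussianReal v).integrable_sq

theorem integral_sq_gaussianReal (v : NNReal) : ∫ x, x ^ 2 ∂(gaussianReal 0 v) = v := by
  have h := variance_fun_id_gaussianReal (μ := 0) (v := v)
  rwa [variance_of_integral_eq_zero (by fun_prop) (by simp)] at h

theorem integrable_iSup_pi (N : ℕ) [NeZero N] : Integrable (fun s : Fin N → ℝ => ⨆ i, s i)
    (Measure.pi fun _ : Fin N => gaussianReal 0 1) := by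
  refine Integrable.mono' (g := fun s : Fin N → ℝ => ∑ i, |s i|)
    (integrable_finsetSum _ fun i _ =>
      integrable_eval_pi _ (fun x => |x|) (integrable_id_gaussianReal 1).abs i)
    (measurable_iSup_fin N).aestronglyMeasurable (ae_of_all _ fun s => ?_)
  exact abs_iSup_fin_le s

theorem integrable_iSup_sq_pi (N : ℕ) [NeZero N] : Integrable (fun s : Fin N → ℝ => (⨆ i, s i) ^ 2)
    (Measure.pi fun _ : Fin N => gaussianReal 0 1) := by
  refine Integrable.mono' (g := fun s : Fin N → ℝ => ∑ i, s i ^ 2)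
    (integrable_finsetSum _ fun i _ =>
      integrable_eval_pi _ (fun x => x ^ 2) (integrable_sq_gaussianReal 1) i)
    ((measurable_iSup_fin N).pow_const 2).aestronglyMeasurable (ae_of_all _ fun s => ?_)
  rw [Real.norm_of_nonneg (sq_nonneg _)]
  exact iSup_fin_sq_le s

theorem integrable_id_gaussianMax (N : ℕ) [NeZero N] :
    Integrable (fun y => y) (gaussianMax N) :=
  (integrable_map_measure (by fun_prop) (measurable_iSup_fin N).aemeasurable).2
    (integrable_iSup_pi N)

theorem integrable_sq_gaussianMax (N : ℕ) [NeZero N] :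
    Integrable (fun y => y ^ 2) (gaussianMax N) :=
  (integrable_map_measure (by fun_prop) (measurable_iSup_fin N).aemeasurable).2
    (integrable_iSup_sq_pi N)

theorem integral_gaussianMax {N : ℕ} (f : ℝ → ℝ) (hf : Measurable f) :
    ∫ y, f y ∂(gaussianMax N) =
      ∫ s, f (⨆ i, s i) ∂(Measure.pi fun _ : Fin N => gaussianReal 0 1) :=
  integral_map (measurable_iSup_fin N).aemeasurable hf.aestronglyMeasurable

theorem integral_id_gaussianMax_nonneg (N : ℕ) [NeZero N] : 0 ≤ ∫ y, y ∂(gaussianMax N) := by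
  rw [integral_gaussianMax (fun y => y) measurable_id]
  have h := integral_mono (integrable_eval_pi _ (fun x => x) (integrable_id_gaussianReal 1) 0)
    (integrable_iSup_pi N) fun s => le_iSup_fin s 0
  rw [integral_eval_pi _ (fun x => x) (by fun_prop)] at h
  simpa using h

theorem integral_id_gaussianMax_le (N : ℕ) (hN : 2 ≤ N) :
    ∫ y, y ∂(gaussianMax N) ≤ 2 * √(Real.log N) := by
  have : NeZero N := ⟨by omega⟩
  have hL : 0 < Real.log N := Real.log_pos (by exact_mod_cast hN)
  -- At exponent l = √(log N) the moment bound reads l·E max ≤ l² + l²/2, which is rounded up to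
  -- 2l².
  set l := √(Real.log N) with hl
  have hl0 : 0 < l := Real.sqrt_pos.2 hL
  have hll : l ^ 2 = Real.log N := Real.sq_sqrt hL.le
  rw [integral_gaussianMax (fun y => y) measurable_id]
  have h := integral_le_log_of_exp_le (N := N) (fun x => l * x) (K := Real.exp (l ^ 2 / 2))
    (Real.exp_pos _) (integrable_exp_mul_gaussianReal l)
    (le_of_eq (by
      have := congrFun (mgf_fun_id_gaussianReal (μ := 0) (v := 1)) l
      simpa [mgf] using this)) (fun s => l * ⨆ i, s i) ((integrable_iSup_pi N).const_mul l)
    (fun s => by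
      obtain ⟨i, hi⟩ := exists_eq_iSup_fin s
      exact ⟨i, by simp only [hi]; exact le_rfl⟩)
  rw [integral_const_mul, Real.log_exp, ← hll] at h
  have : l * ∫ s, (⨆ i, s i) ∂(Measure.pi fun _ : Fin N => gaussianReal 0 1) ≤ l * (2 * l) := by
    nlinarith
  exact le_of_mul_le_mul_left this hl0

/-- The exponent 1/4 is below the critical 1/2, so the square of the maximum can be treated by the
same exponential argument as the maximum itself. -/
theorem exp_sq_div_four_gaussianReal :
    Integrable (fun x : ℝ => Real.exp (x ^ 2 / 4)) (gaussianReal 0 1) ∧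
      ∫ x, Real.exp (x ^ 2 / 4) ∂(gaussianReal 0 1) = √2 := by
  have hpt : ∀ x : ℝ, gaussianPDFReal 0 1 x * Real.exp (x ^ 2 / 4)
      = (√(2 * Real.pi))⁻¹ * Real.exp (-(1 / 4) * x ^ 2) := by
    intro x
    rw [gaussianPDFReal_def]
    simp only [NNReal.coe_one, mul_one, sub_zero]
    rw [mul_assoc, ← Real.exp_add]
    congr 2; ring
  constructor
  · rw [gaussianReal_of_var_ne_zero 0 one_ne_zero]
    rw [integrable_withDensity_iff (measurable_gaussianPDF 0 1)
      (ae_of_all _ fun x => gaussianPDF_lt_top)]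
    simp only [toReal_gaussianPDF]
    simp_rw [mul_comm (Real.exp _), hpt]
    exact (integrable_exp_neg_mul_sq (by norm_num : (0 : ℝ) < 1 / 4)).const_mul _
  · rw [integral_gaussianReal_eq_integral_smul one_ne_zero]
    simp only [smul_eq_mul, hpt]
    rw [integral_const_mul, integral_gaussian, ← Real.sqrt_inv, ← Real.sqrt_mul (by positivity)]
    congr 1
    field_simp
    norm_num

theorem integral_sq_gaussianMax_le (N : ℕ) [NeZero N] :
    ∫ y, y ^ 2 ∂(gaussianMax N) ≤ 4 * (Real.log N + 1) := by
  rw [integral_gaussianMax (fun y => y ^ 2) (by fun_prop)]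
  have h := integral_le_log_of_exp_le (N := N) (fun x => x ^ 2 / 4) (K := √2)
    (by positivity) exp_sq_div_four_gaussianReal.1 exp_sq_div_four_gaussianReal.2.le
    (fun s => (⨆ i, s i) ^ 2 / 4) ((integrable_iSup_sq_pi N).div_const 4)
    (fun s => by
      obtain ⟨i, hi⟩ := exists_eq_iSup_fin s
      exact ⟨i, by simp only [hi]; exact le_rfl⟩)
  rw [integral_div] at h
  have h2 : Real.log √2 ≤ 1 := by
    rw [Real.log_sqrt (by norm_num)]
    have := Real.log_two_lt_d9
    linarith
  linarith

theorem integrable_min_one_sq {X : Type*} [MeasurableSpace X] (P : Measure X) [IsFiniteMeasure P]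
    {f : X → ℝ} (hf : AEStronglyMeasurable f P) : Integrable (fun x => min 1 (f x ^ 2)) P := by
  refine Integrable.mono' (integrable_const (1 : ℝ)) ?_ (ae_of_all _ fun x => ?_)
  · exact (aestronglyMeasurable_const).inf (hf.pow 2)
  · rw [Real.norm_of_nonneg (le_min zero_le_one (sq_nonneg _))]
    exact min_le_left _ _

/-- The maximum over s and the maximum over −s have the same law, and one of the two dominates |s 0|
in absolute value. The resulting factor 1/2 does not depend on N. -/
theorem integral_min_one_sq_gaussianMax (N : ℕ) [NeZero N] (a : ℝ) :
    (∫ z, min 1 ((a * z) ^ 2) ∂(gaussianReal 0 1)) / 2 ≤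
      ∫ y, min 1 ((a * y) ^ 2) ∂(gaussianMax N) := by
  set G := Measure.pi fun _ : Fin N => gaussianReal 0 1
  rw [integral_gaussianMax (fun y => min 1 ((a * y) ^ 2)) (by fun_prop)]
  have hneg : MeasurePreserving (fun s : Fin N → ℝ => fun i => -s i) G G := by
    refine measurePreserving_pi (fun _ => gaussianReal 0 1) (fun _ => gaussianReal 0 1)
      (f := fun _ x => -x) fun i => ⟨by fun_prop, ?_⟩
    rw [gaussianReal_map_neg]; simp
  have hm := measurable_iSup_fin N
  have hi1 : Integrable (fun s : Fin N → ℝ => min 1 ((a * ⨆ i, s i) ^ 2)) G :=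
    integrable_min_one_sq G (by fun_prop)
  have hi2 : Integrable (fun s : Fin N → ℝ => min 1 ((a * ⨆ i, -s i) ^ 2)) G :=
    hneg.integrable_comp_of_integrable hi1
  have heq : ∫ s, min 1 ((a * ⨆ i, -s i) ^ 2) ∂G = ∫ s, min 1 ((a * ⨆ i, s i) ^ 2) ∂G := by
    conv_rhs => rw [← hneg.map_eq]
    rw [integral_map hneg.measurable.aemeasurable (by fun_prop)]
  rw [← integral_eval_pi (N := N) _ (fun z => min 1 ((a * z) ^ 2)) (by fun_prop) 0]
  have hmono := integral_mono (integrable_eval_pi _ (fun z => min 1 ((a * z) ^ 2))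
    (integrable_min_one_sq _ (f := fun z => a * z) (by fun_prop)) 0) (hi1.add hi2) (fun s => by
      show min 1 ((a * s 0) ^ 2) ≤ min 1 ((a * ⨆ i, s i) ^ 2) + min 1 ((a * ⨆ i, -s i) ^ 2)
      have hA := le_iSup_fin s 0
      have hB := le_iSup_fin (fun i => -s i) 0
      have hp : 0 ≤ min 1 ((a * ⨆ i, s i) ^ 2) := le_min zero_le_one (sq_nonneg _)
      have hq : 0 ≤ min 1 ((a * ⨆ i, -s i) ^ 2) := le_min zero_le_one (sq_nonneg _)
      rcases le_total 0 (s 0) with h0 | h0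
      · have : (a * s 0) ^ 2 ≤ (a * ⨆ i, s i) ^ 2 := by
          rw [mul_pow, mul_pow]; gcongr
        have := min_le_min (le_refl (1 : ℝ)) this
        linarith
      · have : (a * s 0) ^ 2 ≤ (a * ⨆ i, -s i) ^ 2 := by
          rw [mul_pow, mul_pow, ← neg_sq (s 0)]; gcongr; linarith
        have := min_le_min (le_refl (1 : ℝ)) this
        linarith)
  simp only [Pi.add_apply] at hmono
  rw [integral_add hi1 hi2, heq] at hmono
  linarith

/-- The second moment of a standard normal variable truncated at `1`. -/
def gaussianTrunc : ℝ := ∫ z, min 1 (z ^ 2) ∂(gaussianReal 0 1)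

theorem gaussianTrunc_pos : 0 < gaussianTrunc := by
  refine (integral_pos_iff_support_of_nonneg_ae (ae_of_all _ fun z =>
    le_min zero_le_one (sq_nonneg z)) (integrable_min_one_sq _ (f := fun z => z) (by fun_prop))).2 ?_
  have hs : (Function.support fun z : ℝ => min 1 (z ^ 2)) = {0}ᶜ := by
    ext z
    simp only [Function.mem_support, Set.mem_compl_iff, Set.mem_singleton_iff, ne_eq, not_iff_not]
    constructor
    · intro h
      rcases min_choice (1 : ℝ) (z ^ 2) with h1 | h1 <;> rw [h1] at h
      · norm_num at h
      · exact pow_eq_zero_iff (two_ne_zero) |>.1 h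
    · rintro rfl; norm_num
  have := nullSingletonClass_gaussianReal (μ := 0) (v := 1) one_ne_zero
  rw [hs, measure_compl (measurableSet_singleton 0) (by simp)]
  simp

theorem integral_min_one_sq_gaussianReal (a : ℝ) :
    min 1 (a ^ 2) * gaussianTrunc ≤ ∫ z, min 1 ((a * z) ^ 2) ∂(gaussianReal 0 1) := by
  rw [gaussianTrunc, ← integral_const_mul]
  refine integral_mono ((integrable_min_one_sq _ (f := fun z => z) (by fun_prop)).const_mul _)
    (integrable_min_one_sq _ (f := fun z => a * z) (by fun_prop)) fun z => ?_
  simp only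
  rw [mul_pow]
  refine le_min ?_ ?_
  · exact mul_le_one₀ (min_le_left _ _) (le_min zero_le_one (sq_nonneg z)) (min_le_left _ _)
  · exact mul_le_mul (min_le_right _ _) (min_le_right _ _) (le_min zero_le_one (sq_nonneg z))
      (sq_nonneg a)

/-- The density decreases on [y, y + 1], an interval of length one. -/
theorem gaussianReal_Ici_ge {y : ℝ} (hy : 0 ≤ y) :
    gaussianPDFReal 0 1 (y + 1) ≤ (gaussianReal 0 1).real (Set.Ici y) := by
  have h1 : ENNReal.ofReal (gaussianPDFReal 0 1 (y + 1)) ≤ gaussianReal 0 1 (Set.Ici y) := by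
    rw [gaussianReal_apply 0 one_ne_zero]
    calc ENNReal.ofReal (gaussianPDFReal 0 1 (y + 1))
        = ∫⁻ _ in Set.Icc y (y + 1), ENNReal.ofReal (gaussianPDFReal 0 1 (y + 1)) := by
          rw [setLIntegral_const, Real.volume_Icc]; simp
      _ ≤ ∫⁻ x in Set.Icc y (y + 1), gaussianPDF 0 1 x := by
          refine setLIntegral_mono (measurable_gaussianPDF 0 1) fun x hx => ?_
          rw [gaussianPDF_def]
          refine ENNReal.ofReal_le_ofReal ?_
          simp only [gaussianPDFReal_def, sub_zero]
          gcongr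
          · exact hy.trans hx.1
          · exact hx.2
      _ ≤ _ := lintegral_mono_set Set.Icc_subset_Ici_self
  exact (ENNReal.ofReal_le_iff_le_toReal (measure_ne_top _ _)).1 h1

/-- At the level y = √(log N)/2 a single variable has tail q of order at least exp(−(log N)/2),
because (y + 1)² ≤ log N. Hence N·q ≥ 1, and all N variables stay below y with probability at most
(1 − q)^N ≤ 1/e. -/
theorem gaussianMax_tail {N : ℕ} (hL : 4 ≤ Real.log N) :
    1 / 2 ≤ (gaussianMax N).real (Set.Ici (√(Real.log N) / 2)) := by
  have hN : N ≠ 0 := by rintro rfl; norm_num at hL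
  have : NeZero N := ⟨hN⟩
  have hN0 : (0 : ℝ) < N := by exact_mod_cast Nat.pos_of_ne_zero hN
  set L := Real.log N with hLd
  set y := √L / 2 with hy
  have hl2 : 2 ≤ √L := Real.le_sqrt_of_sq_le (by linarith)
  have hsq : √L ^ 2 = L := Real.sq_sqrt (by linarith)
  set q := (gaussianReal 0 1).real (Set.Ici y) with hq
  have hq1 : (√(2 * Real.pi))⁻¹ * Real.exp (-(L / 2)) ≤ q := by
    refine le_trans ?_ (gaussianReal_Ici_ge (by positivity))
    simp only [gaussianPDFReal_def, NNReal.coe_one, mul_one, sub_zero]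
    gcongr
    have : (y + 1) ^ 2 ≤ L := by rw [← hsq]; gcongr; linarith
    linarith
  have hNq : 1 ≤ N * q := by
    have h1 : (N : ℝ) = Real.exp (L / 2) * Real.exp (L / 2) := by
      rw [← Real.exp_add, add_halves, hLd, Real.exp_log hN0]
    have h2 : 3 ≤ Real.exp (L / 2) := by
      have := Real.add_one_le_exp (L / 2)
      linarith
    have h3 : √(2 * Real.pi) ≤ 3 := by
      rw [Real.sqrt_le_left (by norm_num)]
      have := Real.pi_lt_d2
      linarith
    have h30 : 0 < √(2 * Real.pi) := by positivity
    calc (1 : ℝ) ≤ Real.exp (L / 2) * (√(2 * Real.pi))⁻¹ := by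
          rw [← div_eq_mul_inv, one_le_div h30]; linarith
      _ = N * ((√(2 * Real.pi))⁻¹ * Real.exp (-(L / 2))) := by
          rw [h1, Real.exp_neg]; field_simp
      _ ≤ N * q := by gcongr
  have hIio : (gaussianReal 0 1).real (Set.Iio y) = 1 - q := by
    rw [← Set.compl_Ici, probReal_compl_eq_one_sub measurableSet_Ici]
  have hpre : (fun s : Fin N → ℝ => ⨆ i, s i) ⁻¹' Set.Iio y
      ⊆ Set.pi Set.univ fun _ => Set.Iio y := fun s hs i _ => (le_iSup_fin s i).trans_lt hs
  have hlow : (gaussianMax N).real (Set.Iio y) ≤ (1 - q) ^ N := by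
    rw [gaussianMax, map_measureReal_apply (measurable_iSup_fin N) measurableSet_Iio]
    refine (measureReal_mono hpre).trans ?_
    rw [Measure.real, Measure.pi_pi, ENNReal.toReal_prod]
    simp only [Finset.prod_const, Finset.card_univ, Fintype.card_fin]
    exact (congrArg (· ^ N) hIio).le
  have hexp : (1 - q) ^ N ≤ Real.exp (-1) := by
    have h0 : 0 ≤ 1 - q := by rw [← hIio]; exact measureReal_nonneg
    calc (1 - q) ^ N ≤ Real.exp (-q) ^ N := by
          gcongr
          have := Real.add_one_le_exp (-q)
          linarith
      _ = Real.exp (-(N * q)) := by rw [← Real.exp_nat_mul]; congr 1; ring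
      _ ≤ Real.exp (-1) := by gcongr
  have hhalf : Real.exp (-1) ≤ 1 / 2 := by
    rw [Real.exp_neg, ← one_div]
    gcongr
    have := Real.add_one_le_exp (1 : ℝ)
    linarith
  rw [← Set.compl_Iio, probReal_compl_eq_one_sub measurableSet_Iio]
  linarith

/-- A real Gaussian measure puts little mass near the origin, whatever its mean. -/
theorem gaussianReal_small_ball (a : ℝ) {v : NNReal} (hv : v ≠ 0) :
    (gaussianReal a v).real {y | |y| < √v / 4} ≤ 1 / 4 := by
  have hv0 : (0 : ℝ) < v := by positivity
  have hs : {y : ℝ | |y| < √v / 4} = Set.Ioo (-(√v / 4)) (√v / 4) := by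
    ext y; simp [abs_lt]
  have h1 : gaussianReal a v {y | |y| < √v / 4} ≤ ENNReal.ofReal (1 / 4) := by
    rw [gaussianReal_apply a hv, hs]
    calc ∫⁻ x in Set.Ioo (-(√v / 4)) (√v / 4), gaussianPDF a v x
        ≤ ∫⁻ _ in Set.Ioo (-(√v / 4)) (√v / 4), ENNReal.ofReal ((√(2 * Real.pi * v))⁻¹) := by
          refine setLIntegral_mono measurable_const fun x _ => ?_
          rw [gaussianPDF_def]
          refine ENNReal.ofReal_le_ofReal ?_
          rw [gaussianPDFReal_def]
          refine mul_le_of_le_one_right (by positivity) (Real.exp_le_one_iff.2 ?_)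
          rw [neg_div]
          exact neg_nonpos.2 (by positivity)
      _ = ENNReal.ofReal ((√(2 * Real.pi * v))⁻¹ * (√v / 2)) := by
          rw [setLIntegral_const, Real.volume_Ioo, ← ENNReal.ofReal_mul (by positivity)]
          congr 2; ring
      _ ≤ ENNReal.ofReal (1 / 4) := by
          refine ENNReal.ofReal_le_ofReal ?_
          rw [Real.sqrt_mul (by positivity)]
          have h2 : 2 ≤ √(2 * Real.pi) :=
            Real.le_sqrt_of_sq_le (by have := Real.pi_gt_three; linarith)
          have h3 : 0 < √(v : ℝ) := Real.sqrt_pos.2 hv0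
          have h4 : (√(2 * Real.pi) * √(v : ℝ))⁻¹ * (√v / 2) = 1 / (2 * √(2 * Real.pi)) := by
            field_simp
          rw [h4]
          exact one_div_le_one_div_of_le (by norm_num) (by linarith)
  exact ENNReal.toReal_le_of_le_ofReal (by norm_num) h1

/-! ### The law of the selected context and the loss of one selection. -/

/-- A centered Gaussian measure whose covariance has all its eigenvalues in `[k, K]`. -/
structure IsCenteredGaussian {d : ℕ} (ν : Measure (EuclideanSpace ℝ (Fin d))) (k K : ℝ) : Prop where
  gaussian : IsGaussian ν
  mean : ∫ x, x ∂ν = 0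
  lower : ∀ v, k * ‖v‖ ^ 2 ≤ covarianceBilin ν v v
  upper : ∀ v, covarianceBilin ν v v ≤ K * ‖v‖ ^ 2

section Selection

variable {d N : ℕ} {ν : Measure (EuclideanSpace ℝ (Fin d))} {k K : ℝ}

/-- An index computed from independent data picks a coordinate that still has the common law and is
independent of these data. -/
theorem measurePreserving_select {X Y : Type*} [MeasurableSpace X] [MeasurableSpace Y]
    (α : Measure X) (γ : Measure Y) [IsProbabilityMeasure α] [IsProbabilityMeasure γ]
    {a : X → Fin N} (ha : Measurable a) :
    MeasurePreserving (fun p : X × (Fin N → Y) => (p.1, p.2 (a p.1)))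
      (α.prod (Measure.pi fun _ => γ)) (α.prod γ) := by
  refine MeasurePreserving.skew_product (f := id) (g := fun x (g : Fin N → Y) => g (a x))
    (MeasurePreserving.id α) ?_ (ae_of_all _ fun x => ?_)
  · have : Measurable fun p : Fin N × (Fin N → Y) => p.2 p.1 :=
      measurable_from_prod_countable_right fun i => measurable_pi_apply i
    exact this.comp ((ha.comp measurable_fst).prodMk measurable_snd)
  · exact (measurePreserving_eval (fun _ : Fin N => γ) (a x)).map_eq

theorem IsCenteredGaussian.integral_inner (h : IsCenteredGaussian ν k K)
    (v : EuclideanSpace ℝ (Fin d)) : ∫ x, inner ℝ x v ∂ν = 0 := by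
  have := h.gaussian
  simp_rw [real_inner_comm v]
  rw [_root_.integral_inner (𝕜 := ℝ) IsGaussian.integrable_fun_id v, h.mean, inner_zero_right]

theorem IsCenteredGaussian.cov_inner (h : IsCenteredGaussian ν k K)
    (v w : EuclideanSpace ℝ (Fin d)) :
    cov[fun x => inner ℝ x v, fun x => inner ℝ x w; ν] = covarianceBilin ν v w := by
  have := h.gaussian
  rw [covarianceBilin_apply_eq_cov IsGaussian.memLp_two_id]
  simp_rw [real_inner_comm v, real_inner_comm w]

theorem IsCenteredGaussian.map_inner (h : IsCenteredGaussian ν k K)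
    (v : EuclideanSpace ℝ (Fin d)) :
    ν.map (fun x => inner ℝ x v) = gaussianReal 0 (covarianceBilin ν v v).toNNReal := by
  have := h.gaussian
  have h1 := IsGaussian.map_eq_gaussianReal (μ := ν) (innerSL ℝ v)
  have h2 : (⇑(innerSL ℝ v) : EuclideanSpace ℝ (Fin d) → ℝ) = fun x => inner ℝ x v := by
    ext x; rw [innerSL_apply_apply, real_inner_comm]
  rw [h2, h.integral_inner, ← covariance_self (by fun_prop), h.cov_inner] at h1
  exact h1

theorem IsCenteredGaussian.map_inner_inner (h : IsCenteredGaussian ν k K)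
    {u w : EuclideanSpace ℝ (Fin d)} (huw : covarianceBilin ν u w = 0) :
    MeasurePreserving (fun x => ((inner ℝ x u, inner ℝ x w) : ℝ × ℝ)) ν
      ((gaussianReal 0 (covarianceBilin ν u u).toNNReal).prod
        (gaussianReal 0 (covarianceBilin ν w w).toNNReal)) := by
  have := h.gaussian
  refine ⟨by fun_prop, ?_⟩
  have h1 : HasGaussianLaw (fun x => ((inner ℝ x u, inner ℝ x w) : ℝ × ℝ)) ν := by
    have h0 := (IsGaussian.hasGaussianLaw_id (μ := ν)).map
      (((innerSL ℝ u).prod (innerSL ℝ w) : EuclideanSpace ℝ (Fin d) →L[ℝ] ℝ × ℝ))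
    have h3 : (fun x => ((inner ℝ x u, inner ℝ x w) : ℝ × ℝ)) =
        ((innerSL ℝ u).prod (innerSL ℝ w) : EuclideanSpace ℝ (Fin d) →L[ℝ] ℝ × ℝ) ∘ id := by
      funext x
      simp only [Function.comp_apply, id, ContinuousLinearMap.prod_apply, innerSL_apply_apply,
        real_inner_comm x]
    rw [h3]
    exact h0
  have h2 := h1.indepFun_of_covariance_eq_zero (by rw [h.cov_inner, huw])
  rw [indepFun_iff_map_prod_eq_prod_map_map (by fun_prop) (by fun_prop)] at h2
  rw [h2, h.map_inner, h.map_inner]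

/-- Ties between scores are null events, so the unspecified tie-breaking of the rule is irrelevant.
-/
theorem ae_injective_pi_gaussian (N : ℕ) :
    ∀ᵐ s ∂(Measure.pi fun _ : Fin N => gaussianReal 0 1), Function.Injective s := by
  have hinj : ∀ i j : Fin N, i ≠ j →
      ∀ᵐ s ∂(Measure.pi fun _ : Fin N => gaussianReal 0 1), s i ≠ s j := by
    intro i j hij
    have h1 := (iIndepFun_pi (μ := fun _ : Fin N => gaussianReal 0 1) (X := fun _ x => x)
      (fun i => by fun_prop)).indepFun hij
    rw [indepFun_iff_map_prod_eq_prod_map_map (measurable_pi_apply i).aemeasurable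
      (measurable_pi_apply j).aemeasurable] at h1
    have h2 : ∀ i, (Measure.pi fun _ : Fin N => gaussianReal 0 1).map (fun s => s i)
      = gaussianReal 0 1 := fun i => (measurePreserving_eval (fun _ : Fin N => gaussianReal 0 1) i).map_eq
    rw [h2, h2] at h1
    have h3 : ∀ᵐ p ∂((gaussianReal 0 1).prod (gaussianReal 0 1)), p.1 ≠ p.2 := by
      have hm : MeasurableSet {p : ℝ × ℝ | p.1 ≠ p.2} :=
        (measurableSet_eq_fun measurable_fst measurable_snd).compl
      rw [Measure.ae_prod_iff_ae_ae hm]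
      refine ae_of_all _ fun x => ?_
      have := nullSingletonClass_gaussianReal (μ := 0) (v := 1) one_ne_zero
      have h4 : gaussianReal 0 1 {x} = 0 := measure_singleton x
      rw [ae_iff]
      simp [h4]
    rw [← h1] at h3
    exact ae_of_ae_map (f := fun s : Fin N → ℝ => (s i, s j))
      ((measurable_pi_apply i).prodMk (measurable_pi_apply j)).aemeasurable h3
  have := ae_all_iff.2 fun i => ae_all_iff.2 fun j => ae_all_iff.2 fun hij : i ≠ j => hinj i j hij
  filter_upwards [this] with s hs i j h
  by_contra hij
  exact hs i j hij h

variable {sel : (Fin N → EuclideanSpace ℝ (Fin d)) → EuclideanSpace ℝ (Fin d) → Fin N}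

theorem IsArgmaxRule.measurable_left (hs : IsArgmaxRule sel) (m : EuclideanSpace ℝ (Fin d)) :
    Measurable fun x => sel x m :=
  hs.measurable.comp (measurable_id.prodMk measurable_const)

theorem IsArgmaxRule.measurable_selected (hs : IsArgmaxRule sel) :
    Measurable fun p : (Fin N → EuclideanSpace ℝ (Fin d)) × EuclideanSpace ℝ (Fin d) =>
      p.1 (sel p.1 p.2) := by
  have : Measurable fun p : Fin N × (Fin N → EuclideanSpace ℝ (Fin d)) => p.2 p.1 :=
    measurable_from_prod_countable_right fun i => measurable_pi_apply i
  exact this.comp (hs.measurable.prodMk measurable_fst)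

theorem IsArgmaxRule.measurable_selected_left (hs : IsArgmaxRule sel)
    (m : EuclideanSpace ℝ (Fin d)) :
    Measurable fun x : Fin N → EuclideanSpace ℝ (Fin d) => x (sel x m) :=
  hs.measurable_selected.comp (measurable_id.prodMk measurable_const)

/-- The score of the selected arm, and any uncorrelated linear functional of its context, are
distributed as a maximum of normal variables and an independent normal variable. -/
theorem measurePreserving_selected (h : IsCenteredGaussian ν k K) (hs : IsArgmaxRule sel)
    {u w : EuclideanSpace ℝ (Fin d)} (hu : covarianceBilin ν u u = 1)
    (huw : covarianceBilin ν u w = 0) {c : ℝ} (hc : 0 < c) :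
    MeasurePreserving (fun x : Fin N → EuclideanSpace ℝ (Fin d) =>
        ((inner ℝ (x (sel x (c • u))) u, inner ℝ (x (sel x (c • u))) w) : ℝ × ℝ))
      (Measure.pi fun _ => ν)
      ((gaussianMax N).prod (gaussianReal 0 (covarianceBilin ν w w).toNNReal)) := by
  have := h.gaussian
  set γ := gaussianReal 0 (covarianceBilin ν w w).toNNReal
  have hmu : Measurable fun x => sel x (c • u) := hs.measurable_left _
  have hu0 : u ≠ 0 := by rintro rfl; simp at hu
  have huu : 0 < ‖u‖ ^ 2 := by positivity
  -- The rule may look at whole contexts when it breaks ties. Feeding it multiples of u with the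
  -- prescribed scores gives an arm that depends on the scores only, hence is independent of every
  -- functional uncorrelated with u.
  set a : (Fin N → ℝ) → Fin N := fun s => sel (fun i => (s i / ‖u‖ ^ 2) • u) (c • u) with ha
  have ham : Measurable a := hmu.comp (by fun_prop)
  have hamax : ∀ (s : Fin N → ℝ) i, s i ≤ s (a s) := by
    intro s i
    have h1 := hs.le (fun i => (s i / ‖u‖ ^ 2) • u) (c • u) i
    simp only [inner_smul_left, inner_smul_right, real_inner_self_eq_norm_sq] at h1
    simp only [conj_trivial] at h1
    rw [mul_left_comm, mul_left_comm (_ / _), div_mul_cancel₀ _ huu.ne',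
      div_mul_cancel₀ _ huu.ne'] at h1
    exact le_of_mul_le_mul_left h1 hc
  have hsup : ∀ s : Fin N → ℝ, s (a s) = ⨆ i, s i := fun s => by
    have : Nonempty (Fin N) := ⟨a s⟩
    exact le_antisymm (le_iSup_fin s _) (ciSup_le (hamax s))
  have hpair := h.map_inner_inner huw
  rw [hu, Real.toNNReal_one] at hpair
  have hΦ := (measurePreserving_arrowProdEquivProdArrow ℝ ℝ (Fin N) (fun _ => gaussianReal 0 1)
    (fun _ => γ)).comp (measurePreserving_pi (fun _ : Fin N => ν) _ fun _ => hpair)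
  have hsel := measurePreserving_select (Measure.pi fun _ : Fin N => gaussianReal 0 1) γ ham
  have hmax : MeasurePreserving (Prod.map (fun s : Fin N → ℝ => ⨆ i, s i) (id : ℝ → ℝ))
      ((Measure.pi fun _ : Fin N => gaussianReal 0 1).prod γ) ((gaussianMax N).prod γ) :=
    MeasurePreserving.prod ⟨measurable_iSup_fin N, rfl⟩ (MeasurePreserving.id γ)
  have hcomp := hmax.comp (hsel.comp hΦ)
  -- Both arms maximize the score, and the scores are almost surely distinct.
  have hae : ∀ᵐ x ∂(Measure.pi fun _ : Fin N => ν), a (fun i => inner ℝ (x i) u) = sel x (c • u) := by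
    have h2 := (measurePreserving_fst.comp hΦ).quasiMeasurePreserving.ae
      (ae_injective_pi_gaussian N)
    filter_upwards [h2] with x hx
    apply hx
    show inner ℝ (x (a fun i => inner ℝ (x i) u)) u = inner ℝ (x (sel x (c • u))) u
    refine le_antisymm ?_ (hamax (fun i => inner ℝ (x i) u) _)
    have h3 := hs.le x (c • u) (a fun i => inner ℝ (x i) u)
    rw [inner_smul_right, inner_smul_right] at h3
    exact le_of_mul_le_mul_left h3 hc
  refine ⟨?_, ?_⟩
  · have hx := hs.measurable_selected_left (c • u)
    exact (hx.inner measurable_const).prodMk (hx.inner measurable_const)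
  · rw [← hcomp.map_eq]
    refine Measure.map_congr ?_
    filter_upwards [hae] with x hx
    show _ = ((⨆ i, inner ℝ (x i) u : ℝ), inner ℝ (x (a fun i => inner ℝ (x i) u)) w)
    rw [← hsup fun i => inner ℝ (x i) u, hx]

/-- Scaling a direction to unit variance does not change which arms are maximizers and makes their
scores standard normal. -/
theorem IsCenteredGaussian.exists_normalized (h : IsCenteredGaussian ν k K) (hk : 0 < k)
    {m : EuclideanSpace ℝ (Fin d)} (hm : m ≠ 0) :
    ∃ r > 0, ∃ u, m = r • u ∧ covarianceBilin ν u u = 1 ∧ r ^ 2 = covarianceBilin ν m m := by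
  have h0 : 0 < covarianceBilin ν m m :=
    lt_of_lt_of_le (by positivity) (h.lower m)
  set r := √(covarianceBilin ν m m) with hr
  have hr0 : 0 < r := Real.sqrt_pos.2 h0
  have hr2 : r ^ 2 = covarianceBilin ν m m := Real.sq_sqrt h0.le
  refine ⟨r, hr0, r⁻¹ • m, by rw [smul_inv_smul₀ hr0.ne'], ?_, hr2⟩
  simp only [map_smul, smul_apply, smul_eq_mul]
  rw [← hr2]
  field_simp

/-- Gram–Schmidt for the covariance form: every direction splits into a multiple of u and a part
uncorrelated with u. -/
theorem covarianceBilin_sub_smul_left {u : EuclideanSpace ℝ (Fin d)}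
    (hu : covarianceBilin ν u u = 1) (v : EuclideanSpace ℝ (Fin d)) :
    covarianceBilin ν u (v - covarianceBilin ν u v • u) = 0 := by
  simp [hu]

theorem covarianceBilin_sub_smul_self {u : EuclideanSpace ℝ (Fin d)}
    (hu : covarianceBilin ν u u = 1) (v : EuclideanSpace ℝ (Fin d)) :
    covarianceBilin ν (v - covarianceBilin ν u v • u) (v - covarianceBilin ν u v • u)
      = covarianceBilin ν v v - covarianceBilin ν u v ^ 2 := by
  simp only [map_sub, map_smul, sub_apply, smul_apply,
    smul_eq_mul, hu, covarianceBilin_comm v u]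
  ring

theorem sq_covarianceBilin_le {u : EuclideanSpace ℝ (Fin d)}
    (hu : covarianceBilin ν u u = 1) (v : EuclideanSpace ℝ (Fin d)) :
    covarianceBilin ν u v ^ 2 ≤ covarianceBilin ν v v := by
  have h1 := covarianceBilin_self_nonneg (μ := ν) (v - covarianceBilin ν u v • u)
  rw [covarianceBilin_sub_smul_self hu] at h1
  linarith

/-- A linear functional of the context of the selected arm is a combination of a maximum of normal
variables and an independent normal variable. -/
theorem measurePreserving_selected_inner (h : IsCenteredGaussian ν k K) (hs : IsArgmaxRule sel)
    {u : EuclideanSpace ℝ (Fin d)} (hu : covarianceBilin ν u u = 1) {c : ℝ} (hc : 0 < c)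
    (v : EuclideanSpace ℝ (Fin d)) :
    (Measure.pi fun _ => ν).map
        (fun x : Fin N → EuclideanSpace ℝ (Fin d) => inner ℝ (x (sel x (c • u))) v) =
      ((gaussianMax N).prod
        (gaussianReal 0 (covarianceBilin ν v v - covarianceBilin ν u v ^ 2).toNNReal)).map
        fun p => covarianceBilin ν u v * p.1 + p.2 := by
  have h1 := measurePreserving_selected h hs hu (covarianceBilin_sub_smul_left hu v) hc
  rw [covarianceBilin_sub_smul_self hu] at h1
  rw [← h1.map_eq, Measure.map_map (by fun_prop) h1.measurable]
  congr 1
  funext x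
  simp only [Function.comp_apply, inner_sub_right, inner_smul_right]
  ring

variable (N) in
theorem integrable_fst_snd_prod [NeZero N] (v : NNReal) (f g : ℝ → ℝ)
    (hf : Integrable f (gaussianMax N)) (hg : Integrable g (gaussianReal 0 v)) :
    Integrable (fun p : ℝ × ℝ => f p.1) ((gaussianMax N).prod (gaussianReal 0 v)) ∧
    Integrable (fun p : ℝ × ℝ => g p.2) ((gaussianMax N).prod (gaussianReal 0 v)) ∧
    (∫ p, f p.1 ∂((gaussianMax N).prod (gaussianReal 0 v)) = ∫ y, f y ∂(gaussianMax N)) ∧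
    (∫ p, g p.2 ∂((gaussianMax N).prod (gaussianReal 0 v)) = ∫ z, g z ∂(gaussianReal 0 v)) := by
  refine ⟨hf.comp_fst _, hg.comp_snd _, ?_, ?_⟩
  · have := integral_fun_fst (μ := gaussianMax N) (ν := gaussianReal 0 v) f
    simpa using this
  · have := integral_fun_snd (μ := gaussianMax N) (ν := gaussianReal 0 v) g
    simpa using this

theorem integral_selected_inner [NeZero N] (h : IsCenteredGaussian ν k K) (hs : IsArgmaxRule sel)
    {u : EuclideanSpace ℝ (Fin d)} (hu : covarianceBilin ν u u = 1) {c : ℝ} (hc : 0 < c)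
    (v : EuclideanSpace ℝ (Fin d)) :
    Integrable (fun x : Fin N → EuclideanSpace ℝ (Fin d) => inner ℝ (x (sel x (c • u))) v)
      (Measure.pi fun _ => ν) ∧
    ∫ x : Fin N → EuclideanSpace ℝ (Fin d), inner ℝ (x (sel x (c • u))) v ∂(Measure.pi fun _ => ν)
      = covarianceBilin ν u v * ∫ y, y ∂(gaussianMax N) := by
  have h1 := measurePreserving_selected_inner h hs hu hc v
  have hm : Measurable fun x : Fin N → EuclideanSpace ℝ (Fin d) =>
    (inner ℝ (x (sel x (c • u))) v : ℝ) := (hs.measurable_selected_left _).inner measurable_const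
  set w := (covarianceBilin ν v v - covarianceBilin ν u v ^ 2).toNNReal
  obtain ⟨i1, i2, e1, e2⟩ := integrable_fst_snd_prod N w (fun y => covarianceBilin ν u v * y)
    (fun z => z) ((integrable_id_gaussianMax N).const_mul _) (integrable_id_gaussianReal w)
  have hid : Integrable (fun y : ℝ => y) ((Measure.pi fun _ => ν).map
        (fun x : Fin N → EuclideanSpace ℝ (Fin d) => inner ℝ (x (sel x (c • u))) v)) := by
    rw [h1]
    exact (integrable_map_measure (by fun_prop) (by fun_prop)).2 (i1.add i2)
  constructor
  · exact (integrable_map_measure (by fun_prop) hm.aemeasurable).1 hid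
  · have h2 : ∫ y, y ∂((Measure.pi fun _ => ν).map
        (fun x : Fin N → EuclideanSpace ℝ (Fin d) => (inner ℝ (x (sel x (c • u))) v : ℝ)))
        = ∫ x : Fin N → EuclideanSpace ℝ (Fin d), inner ℝ (x (sel x (c • u))) v
          ∂(Measure.pi fun _ => ν) := integral_map hm.aemeasurable (by fun_prop)
    rw [← h2, h1, integral_map (by fun_prop) (by fun_prop), integral_add i1 i2, e1, e2,
      integral_const_mul]
    simp

/-- The bracket equals (r − p)² + (U² − p²). For p ≥ 0 the factor U + p of U² − p² is at least U;
for p ≤ 0 the bracket is already at least U², while U − p ≤ 2U. In the application it is the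
variance of the score in direction m − μ, so the loss is quadratic in the error. -/
theorem regret_angle_bound {U p r : ℝ} (hU : 0 < U) (hr : 0 ≤ r) (hp : p ^ 2 ≤ U ^ 2) :
    U - p ≤ 2 * (r ^ 2 - 2 * r * p + U ^ 2) / U ∧ U - p ≤ 2 * U := by
  have h1 := abs_le_of_sq_le_sq' hp hU.le
  refine ⟨?_, by linarith [h1.1]⟩
  rw [le_div_iff₀ hU]
  rcases le_total 0 p with h0 | h0
  · nlinarith [sq_nonneg (r - p), mul_nonneg h0 (sub_nonneg.2 h1.2)]
  · nlinarith [sq_nonneg r, mul_nonneg hr (neg_nonneg.2 h0), mul_nonneg hU.le (sub_nonneg.2 h1.1)]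

/-- The expected loss of playing according to `m` instead of `μ`. -/
theorem integral_regret_le (h : IsCenteredGaussian ν k K) (hk : 0 < k)
    (hN : 2 ≤ N) (hs : IsArgmaxRule sel) {κ : ℝ} (hκ : 0 < κ) {μ m : EuclideanSpace ℝ (Fin d)}
    (hμ1 : κ⁻¹ ≤ ‖μ‖) (hμ2 : ‖μ‖ ≤ κ) (hm : m ≠ 0) :
    Integrable (fun x : Fin N → EuclideanSpace ℝ (Fin d) =>
      (inner ℝ (x (sel x μ)) μ - inner ℝ (x (sel x m)) μ : ℝ)) (Measure.pi fun _ => ν) ∧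
    ∫ x : Fin N → EuclideanSpace ℝ (Fin d), (inner ℝ (x (sel x μ)) μ - inner ℝ (x (sel x m)) μ : ℝ)
      ∂(Measure.pi fun _ => ν) ≤
      4 * (K / (√k * κ⁻¹) + √K * κ) * √(Real.log N) * min 1 (‖m - μ‖ ^ 2) := by
  have : NeZero N := ⟨by omega⟩
  have hμ0 : μ ≠ 0 := by
    rintro rfl
    rw [norm_zero] at hμ1
    exact absurd hμ1 (not_le.2 (inv_pos.2 hκ))
  obtain ⟨r, hr, u, hmu, hu, hr2⟩ := h.exists_normalized hk hm
  obtain ⟨U, hU, u', hmu', hu', hU2⟩ := h.exists_normalized hk hμ0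
  have A := integral_selected_inner (N := N) h hs hu hr μ
  have A' := integral_selected_inner (N := N) h hs hu' hU μ
  rw [← hmu] at A
  rw [← hmu'] at A'
  refine ⟨A'.1.sub A.1, ?_⟩
  -- Both expectations are multiples of the mean of the same maximum, with factors the standard
  -- deviation U of the score in direction μ and the covariance p of that score with the normalized
  -- m.
  rw [integral_sub A'.1 A.1, A.2, A'.2, ← sub_mul]
  have hu'μ : covarianceBilin ν u' μ = U := by
    have : covarianceBilin ν u' (U • u') = U := by simp [hu']
    rwa [← hmu'] at this
  rw [hu'μ]
  set p := covarianceBilin ν u μ with hp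
  have hp2 : p ^ 2 ≤ U ^ 2 := hU2 ▸ sq_covarianceBilin_le hu μ
  have hdiff : covarianceBilin ν (m - μ) (m - μ) = r ^ 2 - 2 * r * p + U ^ 2 := by
    have hmμ : covarianceBilin ν m μ = r * p := by rw [hmu]; simp [hp]
    simp only [map_sub, sub_apply, covarianceBilin_comm μ m, hmμ, ← hr2, ← hU2]
    ring
  have hK : 0 < K := by
    have h1 := (h.lower μ).trans (h.upper μ)
    have h2 : 0 < ‖μ‖ ^ 2 := by positivity
    nlinarith
  have hUlow : √k * κ⁻¹ ≤ U := by
    refine le_of_sq_le_sq ?_ hU.le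
    rw [mul_pow, Real.sq_sqrt hk.le, hU2]
    refine le_trans ?_ (h.lower μ)
    gcongr
  have hUup : U ≤ √K * κ := by
    refine le_of_sq_le_sq ?_ (by positivity)
    rw [mul_pow, Real.sq_sqrt hK.le, hU2]
    refine (h.upper μ).trans ?_
    gcongr
  obtain ⟨b1, b2⟩ := regret_angle_bound hU hr.le hp2
  rw [← hdiff] at b1
  have hpos : 0 < √k * κ⁻¹ := by positivity
  have hc1 : 0 ≤ K / (√k * κ⁻¹) := by positivity
  have hc2 : 0 ≤ √K * κ := by positivity
  have hUp : U - p ≤ 2 * (K / (√k * κ⁻¹) + √K * κ) * min 1 (‖m - μ‖ ^ 2) := by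
    rcases min_choice (1 : ℝ) (‖m - μ‖ ^ 2) with hh | hh <;> rw [hh]
    · linarith
    · have h3 : 2 * covarianceBilin ν (m - μ) (m - μ) / U
          ≤ 2 * (K * ‖m - μ‖ ^ 2) / (√k * κ⁻¹) := by
        gcongr
        exact h.upper _
      have h4 : 2 * (K * ‖m - μ‖ ^ 2) / (√k * κ⁻¹) = 2 * (K / (√k * κ⁻¹)) * ‖m - μ‖ ^ 2 := by ring
      have h5 : 0 ≤ √K * κ * ‖m - μ‖ ^ 2 := by positivity
      nlinarith
  have hUp0 : 0 ≤ 2 * (K / (√k * κ⁻¹) + √K * κ) * min 1 (‖m - μ‖ ^ 2) :=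
    mul_nonneg (by positivity) (le_min zero_le_one (sq_nonneg _))
  calc (U - p) * ∫ y, y ∂(gaussianMax N)
      ≤ (2 * (K / (√k * κ⁻¹) + √K * κ) * min 1 (‖m - μ‖ ^ 2)) * (2 * √(Real.log N)) :=
        mul_le_mul hUp (integral_id_gaussianMax_le N hN) (integral_id_gaussianMax_nonneg N) hUp0
    _ = _ := by ring

end Selection

/-! ### Lower and upper bounds for the selected context in every direction. -/

section Exploration

variable {d N : ℕ} {ν : Measure (EuclideanSpace ℝ (Fin d))} {k K : ℝ}
  {sel : (Fin N → EuclideanSpace ℝ (Fin d)) → EuclideanSpace ℝ (Fin d) → Fin N}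

theorem min_one_add_le {a b : ℝ} (ha : 0 ≤ a) (hb : 0 ≤ b) :
    min 1 (a + b) ≤ min 1 a + min 1 b := by
  rcases le_total 1 a with h1 | h1 <;> rcases le_total 1 b with h2 | h2 <;>
    rcases le_total 1 (a + b) with h3 | h3 <;> simp [*] <;> linarith

theorem min_one_mul_le {a b : ℝ} (ha : 0 ≤ a) (hb : 0 ≤ b) :
    min 1 a * min 1 b ≤ min 1 (a * b) := by
  refine le_min ?_ ?_
  · exact mul_le_one₀ (min_le_left _ _) (le_min zero_le_one hb) (min_le_left _ _)
  · exact mul_le_mul (min_le_right _ _) (min_le_right _ _) (le_min zero_le_one hb) ha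

theorem gaussianReal_map_neg_zero (w : NNReal) :
    MeasurePreserving (fun z : ℝ => -z) (gaussianReal 0 w) (gaussianReal 0 w) :=
  ⟨by fun_prop, by rw [gaussianReal_map_neg]; simp⟩

theorem integral_min_one_sq_gaussianReal_var {b : ℝ} (hb : 0 ≤ b) :
    min 1 b * gaussianTrunc ≤ ∫ z, min 1 (z ^ 2) ∂(gaussianReal 0 b.toNNReal) := by
  have h1 : gaussianReal 0 b.toNNReal = (gaussianReal 0 1).map (fun z => √b * z) := by
    rw [gaussianReal_map_const_mul]
    congr 1
    · simp
    · ext; simp [Real.sq_sqrt hb, hb]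
  rw [h1, integral_map (by fun_prop) (by fun_prop)]
  have h2 := integral_min_one_sq_gaussianReal (√b)
  rwa [Real.sq_sqrt hb] at h2

/-- Symmetrization of the independent normal variable. -/
theorem integral_min_one_sq_add (M : Measure ℝ) [IsProbabilityMeasure M] (a : ℝ) (w : NNReal) :
    max (∫ y, min 1 ((a * y) ^ 2) ∂M) (∫ z, min 1 (z ^ 2) ∂(gaussianReal 0 w)) / 2 ≤
      ∫ p, min 1 ((a * p.1 + p.2) ^ 2) ∂(M.prod (gaussianReal 0 w)) := by
  set Q := M.prod (gaussianReal 0 w)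
  have hneg : MeasurePreserving (fun p : ℝ × ℝ => (p.1, -p.2)) Q Q :=
    (MeasurePreserving.id M).prod (gaussianReal_map_neg_zero w)
  have hi1 : Integrable (fun p : ℝ × ℝ => min 1 ((a * p.1 + p.2) ^ 2)) Q :=
    integrable_min_one_sq Q (by fun_prop)
  have hi2 : Integrable (fun p : ℝ × ℝ => min 1 ((a * p.1 + -p.2) ^ 2)) Q :=
    hneg.integrable_comp_of_integrable hi1
  have heq : ∫ p, min 1 ((a * p.1 + -p.2) ^ 2) ∂Q = ∫ p, min 1 ((a * p.1 + p.2) ^ 2) ∂Q := by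
    conv_rhs => rw [← hneg.map_eq]
    rw [integral_map hneg.measurable.aemeasurable (by fun_prop)]
  have hi3 : Integrable (fun y : ℝ => min 1 ((a * y) ^ 2)) M :=
    integrable_min_one_sq M (f := fun y => a * y) (by fun_prop)
  have hi4 : Integrable (fun z : ℝ => min 1 (z ^ 2)) (gaussianReal 0 w) :=
    integrable_min_one_sq _ (f := fun z => z) (by fun_prop)
  -- For one of the two signs the cross term is nonnegative, so s and t do not cancel.
  have key : ∀ s t : ℝ, min 1 (s ^ 2 + t ^ 2) ≤ min 1 ((s + t) ^ 2) + min 1 ((s + -t) ^ 2) := by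
    intro s t
    have hp : 0 ≤ min 1 ((s + t) ^ 2) := le_min zero_le_one (sq_nonneg _)
    have hq : 0 ≤ min 1 ((s + -t) ^ 2) := le_min zero_le_one (sq_nonneg _)
    rcases le_total 0 (s * t) with h | h
    · have := min_le_min (le_refl (1 : ℝ)) (by nlinarith : s ^ 2 + t ^ 2 ≤ (s + t) ^ 2)
      linarith
    · have := min_le_min (le_refl (1 : ℝ)) (by nlinarith : s ^ 2 + t ^ 2 ≤ (s + -t) ^ 2)
      linarith
  have e1 : ∫ p, min 1 ((a * p.1) ^ 2) ∂Q = ∫ y, min 1 ((a * y) ^ 2) ∂M := by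
    have := integral_fun_fst (μ := M) (ν := gaussianReal 0 w) (fun y => min 1 ((a * y) ^ 2))
    simpa using this
  have e2 : ∫ p : ℝ × ℝ, min 1 (p.2 ^ 2) ∂Q = ∫ z, min 1 (z ^ 2) ∂(gaussianReal 0 w) := by
    have := integral_fun_snd (μ := M) (ν := gaussianReal 0 w) (fun z => min 1 (z ^ 2))
    simpa using this
  have h1 := integral_mono (hi3.comp_fst (gaussianReal 0 w)) (hi1.add hi2) fun p =>
    (min_le_min (le_refl (1 : ℝ)) (by nlinarith [sq_nonneg p.2] :
      (a * p.1) ^ 2 ≤ (a * p.1) ^ 2 + p.2 ^ 2)).trans (key _ _)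
  have h2 := integral_mono (hi4.comp_snd M) (hi1.add hi2) fun p =>
    (min_le_min (le_refl (1 : ℝ)) (by nlinarith [sq_nonneg (a * p.1)] :
      p.2 ^ 2 ≤ (a * p.1) ^ 2 + p.2 ^ 2)).trans (key _ _)
  simp only [Pi.add_apply] at h1 h2
  rw [integral_add hi1 hi2, heq] at h1 h2
  rw [e1] at h1
  rw [e2] at h2
  rw [div_le_iff₀ two_pos]
  exact max_le (by linarith) (by linarith)

theorem integral_selected_comp (h : IsCenteredGaussian ν k K) (hs : IsArgmaxRule sel)
    {u : EuclideanSpace ℝ (Fin d)} (hu : covarianceBilin ν u u = 1) {c : ℝ} (hc : 0 < c)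
    (v : EuclideanSpace ℝ (Fin d)) {f : ℝ → ℝ} (hf : Measurable f) :
    ∫ x : Fin N → EuclideanSpace ℝ (Fin d), f (inner ℝ (x (sel x (c • u))) v)
        ∂(Measure.pi fun _ => ν) =
      ∫ p, f (covarianceBilin ν u v * p.1 + p.2) ∂((gaussianMax N).prod
        (gaussianReal 0 (covarianceBilin ν v v - covarianceBilin ν u v ^ 2).toNNReal)) := by
  have hm : Measurable fun x : Fin N → EuclideanSpace ℝ (Fin d) =>
    (inner ℝ (x (sel x (c • u))) v : ℝ) := (hs.measurable_selected_left _).inner measurable_const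
  have h1 := measurePreserving_selected_inner h hs hu hc v
  have h2 := integral_map hm.aemeasurable (f := f) (μ := Measure.pi fun _ => ν)
    hf.aestronglyMeasurable
  rw [← h2, h1, integral_map (by fun_prop) (by fun_prop)]

/-- The context of the selected arm is spread in every direction. -/
theorem integral_min_one_sq_selected (h : IsCenteredGaussian ν k K) (hk : 0 < k) [NeZero N]
    (hs : IsArgmaxRule sel) {m : EuclideanSpace ℝ (Fin d)} (hm : m ≠ 0)
    (v : EuclideanSpace ℝ (Fin d)) :
    gaussianTrunc / 8 * min 1 k * min 1 (‖v‖ ^ 2) ≤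
      ∫ x : Fin N → EuclideanSpace ℝ (Fin d), min 1 ((inner ℝ (x (sel x m)) v : ℝ) ^ 2)
        ∂(Measure.pi fun _ => ν) := by
  obtain ⟨r, hr, u, rfl, hu, -⟩ := h.exists_normalized hk hm
  rw [integral_selected_comp h hs hu hr v (f := fun y => min 1 (y ^ 2)) (by fun_prop)]
  refine le_trans ?_ (integral_min_one_sq_add _ _ _)
  set α := covarianceBilin ν u v
  have hb := sub_nonneg.2 (sq_covarianceBilin_le (ν := ν) hu v)
  set b := covarianceBilin ν v v - α ^ 2
  have h1 := (div_le_div_of_nonneg_right (integral_min_one_sq_gaussianReal α)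
    (by norm_num : (0 : ℝ) ≤ 2)).trans (integral_min_one_sq_gaussianMax N α)
  have h2 := integral_min_one_sq_gaussianReal_var hb
  have h3 := min_one_add_le (sq_nonneg α) hb
  have h4 : α ^ 2 + b = covarianceBilin ν v v := by simp [b]
  rw [h4] at h3
  have h5 : min 1 k * min 1 (‖v‖ ^ 2) ≤ min 1 (covarianceBilin ν v v) :=
    (min_one_mul_le hk.le (sq_nonneg _)).trans (min_le_min le_rfl (h.lower v))
  have hg := gaussianTrunc_pos
  have h6 : 0 ≤ min 1 b := le_min zero_le_one hb
  have h7 := h1.trans (le_max_left _ (∫ z, min 1 (z ^ 2) ∂(gaussianReal 0 b.toNNReal)))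
  have h8 := h2.trans (le_max_right (∫ y, min 1 ((α * y) ^ 2) ∂(gaussianMax N)) _)
  -- The 1/8 collects three halvings: symmetrizing the normal part, symmetrizing the maximum, and
  -- bounding the larger of two terms by their average.
  nlinarith [mul_le_mul_of_nonneg_left (h5.trans h3) hg.le, mul_nonneg hg.le h6]

/-- The truncation sits outside the sum, so the one-direction bound is applied to the unit vectors g
j/‖g j‖ with weights ‖g j‖²/max(1, τ). These have total mass min(1, τ), so the weighted sum of the
truncated squares stays below both 1 and the quadratic form, and no factor of the dimension is lost.
-/
theorem integral_min_one_quadratic_selected (h : IsCenteredGaussian ν k K) (hk : 0 < k) [NeZero N]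
    (hs : IsArgmaxRule sel) {m : EuclideanSpace ℝ (Fin d)} (hm : m ≠ 0)
    {ι : Type*} [Fintype ι] (g : ι → EuclideanSpace ℝ (Fin d)) :
    gaussianTrunc / 8 * min 1 k * min 1 (∑ j, ‖g j‖ ^ 2) ≤
      ∫ x : Fin N → EuclideanSpace ℝ (Fin d), min 1 (∑ j, (inner ℝ (x (sel x m)) (g j) : ℝ) ^ 2)
        ∂(Measure.pi fun _ => ν) := by
  have := h.gaussian
  set τ := ∑ j, ‖g j‖ ^ 2 with hτ
  set c := gaussianTrunc / 8 * min 1 k with hc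
  have hτ0 : 0 ≤ τ := Finset.sum_nonneg fun j _ => sq_nonneg _
  set M := max 1 τ with hM
  have hM0 : 0 < M := lt_of_lt_of_le one_pos (le_max_left _ _)
  have hx := hs.measurable_selected_left m
  set P : Measure (Fin N → EuclideanSpace ℝ (Fin d)) := Measure.pi fun _ => ν
  set ω : ι → ℝ := fun j => ‖g j‖ ^ 2 / M with hω
  have hω0 : ∀ j, 0 ≤ ω j := fun j => by positivity
  have hωsum : ∑ j, ω j = min 1 τ := by
    rw [hω, ← Finset.sum_div, ← hτ]
    rcases le_total 1 τ with h1 | h1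
    · simp [hM, h1, (by linarith : τ ≠ 0)]
    · simp [hM, h1]
  have hint : ∀ j, Integrable (fun x : Fin N → EuclideanSpace ℝ (Fin d) =>
      min 1 ((inner ℝ (x (sel x m)) (‖g j‖⁻¹ • g j) : ℝ) ^ 2)) P := fun j =>
    integrable_min_one_sq P (hx.inner measurable_const).aestronglyMeasurable
  have hlow : c * min 1 τ ≤ ∫ x : Fin N → EuclideanSpace ℝ (Fin d),
      ∑ j, ω j * min 1 ((inner ℝ (x (sel x m)) (‖g j‖⁻¹ • g j) : ℝ) ^ 2) ∂P := by
    rw [integral_finsetSum _ fun j _ => (hint j).const_mul _, ← hωsum, Finset.mul_sum]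
    refine Finset.sum_le_sum fun j _ => ?_
    rw [integral_const_mul, mul_comm c]
    by_cases hj : g j = 0
    · simp [hω, hj]
    · refine mul_le_mul_of_nonneg_left ?_ (hω0 j)
      have h1 := integral_min_one_sq_selected h hk hs hm (‖g j‖⁻¹ • g j)
      rw [norm_smul, norm_inv, norm_norm, inv_mul_cancel₀ (norm_ne_zero_iff.2 hj)] at h1
      simpa using h1
  refine hlow.trans (integral_mono (integrable_finsetSum _ fun j _ => (hint j).const_mul _) ?_ ?_)
  · refine Integrable.mono' (integrable_const (1 : ℝ)) ?_ (ae_of_all _ fun x => ?_)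
    · refine (measurable_const.min (Finset.measurable_sum _ fun j _ => ?_)).aestronglyMeasurable
      exact (hx.inner measurable_const).pow_const 2
    · rw [Real.norm_of_nonneg (le_min zero_le_one (Finset.sum_nonneg fun j _ => sq_nonneg _))]
      exact min_le_left _ _
  · intro x
    refine le_min ?_ ?_
    · calc ∑ j, ω j * min 1 ((inner ℝ (x (sel x m)) (‖g j‖⁻¹ • g j) : ℝ) ^ 2)
          ≤ ∑ j, ω j * 1 := Finset.sum_le_sum fun j _ =>
            mul_le_mul_of_nonneg_left (min_le_left _ _) (hω0 j)
        _ ≤ 1 := by simp only [mul_one, hωsum]; exact min_le_left _ _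
    · refine Finset.sum_le_sum fun j _ => ?_
      refine (mul_le_mul_of_nonneg_left (min_le_right _ _) (hω0 j)).trans ?_
      by_cases hj : g j = 0
      · simp [hj]
      · have hn : 0 < ‖g j‖ := norm_pos_iff.2 hj
        have : ω j * (inner ℝ (x (sel x m)) (‖g j‖⁻¹ • g j) : ℝ) ^ 2
            = (inner ℝ (x (sel x m)) (g j) : ℝ) ^ 2 / M := by
          rw [inner_smul_right]; simp only [hω]; field_simp
        rw [this]
        exact div_le_self (sq_nonneg _) (le_max_left _ _)

/-- Selection inflates second moments by at most a factor of order log N, through the second moment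
of the maximum. This controls the growth of the trace of the precision matrix. -/
theorem integral_sq_selected_le (h : IsCenteredGaussian ν k K) (hk : 0 < k) [NeZero N]
    (hs : IsArgmaxRule sel) {m : EuclideanSpace ℝ (Fin d)} (hm : m ≠ 0)
    (v : EuclideanSpace ℝ (Fin d)) :
    Integrable (fun x : Fin N → EuclideanSpace ℝ (Fin d) => (inner ℝ (x (sel x m)) v : ℝ) ^ 2)
      (Measure.pi fun _ => ν) ∧
    ∫ x : Fin N → EuclideanSpace ℝ (Fin d), (inner ℝ (x (sel x m)) v : ℝ) ^ 2
        ∂(Measure.pi fun _ => ν) ≤ 8 * K * (Real.log N + 1) * ‖v‖ ^ 2 := by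
  obtain ⟨r, hr, u, rfl, hu, -⟩ := h.exists_normalized hk hm
  have hmeas : Measurable fun x : Fin N → EuclideanSpace ℝ (Fin d) =>
    (inner ℝ (x (sel x (r • u))) v : ℝ) := (hs.measurable_selected_left _).inner measurable_const
  rw [integral_selected_comp h hs hu hr v (f := fun y => y ^ 2) (by fun_prop)]
  have h1 := measurePreserving_selected_inner (N := N) h hs hu hr v
  set α := covarianceBilin ν u v
  have hb := sub_nonneg.2 (sq_covarianceBilin_le (ν := ν) hu v)
  set b := covarianceBilin ν v v - α ^ 2 with hbd
  obtain ⟨i1, i2, e1, e2⟩ := integrable_fst_snd_prod N b.toNNReal (fun y => 2 * α ^ 2 * y ^ 2)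
    (fun z => 2 * z ^ 2) ((integrable_sq_gaussianMax N).const_mul _)
    ((integrable_sq_gaussianReal _).const_mul _)
  have hpt : ∀ p : ℝ × ℝ, (α * p.1 + p.2) ^ 2 ≤ 2 * α ^ 2 * p.1 ^ 2 + 2 * p.2 ^ 2 := fun p => by
    nlinarith [sq_nonneg (α * p.1 - p.2)]
  have hint : Integrable (fun p : ℝ × ℝ => (α * p.1 + p.2) ^ 2)
      ((gaussianMax N).prod (gaussianReal 0 b.toNNReal)) := by
    refine (i1.add i2).mono' (by fun_prop) (ae_of_all _ fun p => ?_)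
    rw [Real.norm_of_nonneg (sq_nonneg _)]
    exact hpt p
  constructor
  · have h3 : Integrable (fun y : ℝ => y ^ 2) ((Measure.pi fun _ => ν).map
        (fun x : Fin N → EuclideanSpace ℝ (Fin d) => (inner ℝ (x (sel x (r • u))) v : ℝ))) := by
      rw [h1]
      exact (integrable_map_measure (by fun_prop) (by fun_prop)).2 hint
    exact (integrable_map_measure (by fun_prop) hmeas.aemeasurable).1 h3
  · refine (integral_mono hint (i1.add i2) hpt).trans ?_
    simp only [Pi.add_apply]
    rw [integral_add i1 i2, e1, e2, integral_const_mul, integral_const_mul,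
      integral_sq_gaussianReal, Real.coe_toNNReal _ hb]
    have h3 := integral_sq_gaussianMax_le N
    have hL : 0 ≤ Real.log N := Real.log_natCast_nonneg N
    have h4 := h.upper v
    have h5 : 0 ≤ covarianceBilin ν v v := covarianceBilin_self_nonneg v
    calc 2 * α ^ 2 * ∫ y, y ^ 2 ∂(gaussianMax N) + 2 * b
        ≤ 2 * α ^ 2 * (4 * (Real.log N + 1)) + 2 * b := by gcongr
      _ ≤ 8 * (Real.log N + 1) * (α ^ 2 + b) := by nlinarith [mul_nonneg hL hb]
      _ ≤ 8 * (Real.log N + 1) * (K * ‖v‖ ^ 2) := by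
          gcongr
          rw [hbd]; linarith
      _ = _ := by ring

/-- When there are many arms, the context of the selected arm is long in the direction in which
it has been selected. -/
theorem measure_sq_selected_ge (h : IsCenteredGaussian ν k K) (hk : 0 < k)
    (hL : 4 ≤ Real.log N) (hs : IsArgmaxRule sel) {m : EuclideanSpace ℝ (Fin d)} (hm : m ≠ 0)
    (v : EuclideanSpace ℝ (Fin d)) :
    1 / 4 ≤ (Measure.pi fun _ : Fin N => ν).real
      {x | covarianceBilin ν m v ^ 2 / covarianceBilin ν m m * (Real.log N / 4)
        ≤ (inner ℝ (x (sel x m)) v : ℝ) ^ 2} := by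
  obtain ⟨r, hr, u, rfl, hu, -⟩ := h.exists_normalized hk hm
  have hmeas : Measurable fun x : Fin N → EuclideanSpace ℝ (Fin d) =>
    (inner ℝ (x (sel x (r • u))) v : ℝ) := (hs.measurable_selected_left _).inner measurable_const
  have h1 := measurePreserving_selected_inner (N := N) h hs hu hr v
  set α := covarianceBilin ν u v with hα
  have hquot : covarianceBilin ν (r • u) v ^ 2 / covarianceBilin ν (r • u) (r • u) = α ^ 2 := by
    simp only [map_smul, smul_apply, smul_eq_mul, hu, ← hα]
    field_simp
  rw [hquot]
  set w := (covarianceBilin ν v v - α ^ 2).toNNReal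
  set t := α ^ 2 * (Real.log N / 4) with ht
  have hset : MeasurableSet {y : ℝ | t ≤ y ^ 2} := measurableSet_le measurable_const (by fun_prop)
  have h2 : (Measure.pi fun _ : Fin N => ν).real
      {x | t ≤ (inner ℝ (x (sel x (r • u))) v : ℝ) ^ 2}
      = ((gaussianMax N).prod (gaussianReal 0 w)).real {p | t ≤ (α * p.1 + p.2) ^ 2} := by
    have h3 := map_measureReal_apply (μ := Measure.pi fun _ : Fin N => ν) hmeas hset
    rw [h1, map_measureReal_apply (by fun_prop) hset] at h3
    exact h3.symm
  rw [h2]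
  have hl : (√(Real.log N)) ^ 2 = Real.log N := Real.sq_sqrt (by linarith)
  -- When the maximum is large and the independent part has the sign of α, the two add up. Each
  -- event has probability at least 1/2 and they are independent.
  have hsub : Set.Ici (√(Real.log N) / 2) ×ˢ {z : ℝ | 0 ≤ α * z} ⊆
      {p : ℝ × ℝ | t ≤ (α * p.1 + p.2) ^ 2} := by
    rintro ⟨y, z⟩ ⟨hy, hz⟩
    simp only [Set.mem_Ici, Set.mem_ofPred_eq] at hy hz ⊢
    have hy0 : 0 ≤ y := le_trans (by positivity) hy
    have hy2 : Real.log N / 4 ≤ y ^ 2 := by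
      rw [← hl]; nlinarith [Real.sqrt_nonneg (Real.log N)]
    have : t ≤ α ^ 2 * y ^ 2 := mul_le_mul_of_nonneg_left hy2 (sq_nonneg _)
    nlinarith [mul_nonneg hy0 hz, sq_nonneg z]
  refine le_trans ?_ (measureReal_mono hsub)
  rw [measureReal_prod_prod]
  have hhalf : 1 / 2 ≤ (gaussianReal 0 w).real {z : ℝ | 0 ≤ α * z} := by
    have hms : MeasurableSet {z : ℝ | 0 ≤ α * z} := measurableSet_le measurable_const (by fun_prop)
    have h4 := (gaussianReal_map_neg_zero w).measureReal_preimage hms.nullMeasurableSet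
    have h5 : (Set.univ : Set ℝ) ⊆ ((fun z : ℝ => -z) ⁻¹' {z : ℝ | 0 ≤ α * z}) ∪ {z : ℝ | 0 ≤ α * z} := by
      intro z _
      rcases le_total 0 (α * z) with h | h
      · exact Or.inr h
      · left
        simp only [Set.mem_preimage, Set.mem_ofPred_eq]
        linarith
    have h6 := (measureReal_mono (μ := gaussianReal 0 w) h5).trans (measureReal_union_le _ _)
    rw [probReal_univ, h4] at h6
    linarith
  have := mul_le_mul (gaussianMax_tail hL) hhalf (by norm_num) measureReal_nonneg
  linarith

end Exploration

open Matrix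

/-! ### Rank-one updates of a positive definite matrix. -/

section RankOne

open scoped MatrixOrder

variable {d : ℕ} {B : Matrix (Fin d) (Fin d) ℝ}

theorem Matrix.PosDef.add_vecMulVec_self (hB : B.PosDef) (x : Fin d → ℝ) :
    (B + vecMulVec x x).PosDef := by
  have := posSemidef_vecMulVec_self_star x
  rw [star_trivial] at this
  exact hB.add_posSemidef this

theorem Matrix.PosDef.isUnit_det' (hB : B.PosDef) : IsUnit B.det :=
  isUnit_iff_ne_zero.2 hB.det_pos.ne'

theorem Matrix.PosDef.mulVec_inv_mulVec (hB : B.PosDef) (x : Fin d → ℝ) :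
    B *ᵥ (B⁻¹ *ᵥ x) = x := by
  rw [mulVec_mulVec, mul_nonsing_inv _ hB.isUnit_det', one_mulVec]

theorem Matrix.PosDef.dotProduct_mulVec_comm (hB : B.PosDef) (x y : Fin d → ℝ) :
    x ⬝ᵥ B *ᵥ y = y ⬝ᵥ B *ᵥ x := by
  have h1 : Bᵀ = B := by
    have := hB.1.eq
    rwa [conjTranspose_eq_transpose_of_trivial] at this
  rw [dotProduct_mulVec, ← mulVec_transpose, h1, dotProduct_comm]

theorem Matrix.PosDef.quad_inv_nonneg (hB : B.PosDef) (x : Fin d → ℝ) :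
    0 ≤ x ⬝ᵥ B⁻¹ *ᵥ x := by
  have := hB.inv.posSemidef.dotProduct_mulVec_nonneg x
  rwa [star_trivial] at this

theorem Matrix.PosDef.quad_nonneg (hB : B.PosDef) (x : Fin d → ℝ) :
    0 ≤ x ⬝ᵥ B *ᵥ x := by
  have := hB.posSemidef.dotProduct_mulVec_nonneg x
  rwa [star_trivial] at this

theorem Matrix.PosDef.det_add_vecMulVec_self (hB : B.PosDef) (x : Fin d → ℝ) :
    (B + vecMulVec x x).det = B.det * (1 + x ⬝ᵥ B⁻¹ *ᵥ x) := by
  rw [vecMulVec_eq Unit, det_add_replicateCol_mul_replicateRow hB.isUnit_det']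
  congr 1
  rw [det_unique]
  simp [Matrix.mul_assoc, Matrix.mul_apply, dotProduct, mulVec]

/-- The change of the weighted squared error of the least squares estimate after one more
observation. -/
theorem Matrix.PosDef.quad_rankOne_update (hB : B.PosDef) (x e e' : Fin d → ℝ) (η : ℝ)
    (he : (B + vecMulVec x x) *ᵥ e' = B *ᵥ e + η • x) :
    e' ⬝ᵥ (B + vecMulVec x x) *ᵥ e' =
      e ⬝ᵥ B *ᵥ e - (x ⬝ᵥ e) ^ 2 / (1 + x ⬝ᵥ B⁻¹ *ᵥ x)
        + 2 * η * ((x ⬝ᵥ e) / (1 + x ⬝ᵥ B⁻¹ *ᵥ x))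
        + η ^ 2 * ((x ⬝ᵥ B⁻¹ *ᵥ x) / (1 + x ⬝ᵥ B⁻¹ *ᵥ x)) := by
  have hB' := hB.add_vecMulVec_self x
  set h := x ⬝ᵥ B⁻¹ *ᵥ x with hh
  have h1 : 0 < 1 + h := by have := hB.quad_inv_nonneg x; linarith
  set u := B⁻¹ *ᵥ x with hu
  have hBu : B *ᵥ u = x := hB.mulVec_inv_mulVec x
  set c := (η - x ⬝ᵥ e) / (1 + h) with hc
  have hmul : ∀ y, vecMulVec x x *ᵥ y = (x ⬝ᵥ y) • x := fun y => by
    rw [vecMulVec_mulVec]; simp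
  -- Sherman–Morrison in solved form: the correction is B⁻¹x times the prediction error η − x·e,
  -- damped by 1 + h.
  have hsol : e' = e + c • u := by
    apply mulVec_injective_of_isUnit ((isUnit_iff_isUnit_det _).2 hB'.isUnit_det')
    have hη : η = x ⬝ᵥ e + c * (1 + h) := by rw [hc, div_mul_cancel₀ _ h1.ne']; ring
    rw [he, mulVec_add, mulVec_smul, add_mulVec, add_mulVec, hBu, hmul, hmul, ← hh]
    conv_lhs => rw [hη]
    module
  rw [he, hsol]
  have h2 : u ⬝ᵥ B *ᵥ e = x ⬝ᵥ e := by rw [hB.dotProduct_mulVec_comm, hBu, dotProduct_comm]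
  have h3 : u ⬝ᵥ x = h := by rw [hh, dotProduct_comm]
  simp only [add_dotProduct, dotProduct_add, smul_dotProduct, dotProduct_smul, smul_eq_mul, h2, h3,
    dotProduct_comm e x]
  rw [hc]
  field_simp
  ring

/-- The logarithm of each eigenvalue lies below the tangent of log at a. -/
theorem Matrix.PosDef.log_det_le (hB : B.PosDef) {a : ℝ} (ha : 0 < a) :
    Real.log B.det ≤ d * Real.log a + B.trace / a - d := by
  rw [hB.1.det_eq_prod_eigenvalues, hB.1.trace_eq_sum_eigenvalues]
  simp only [RCLike.ofReal_real_eq_id, id]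
  rw [Real.log_prod fun i _ => (hB.eigenvalues_pos i).ne']
  have h1 : ∀ i ∈ Finset.univ, Real.log (hB.1.eigenvalues i) ≤
      Real.log a + hB.1.eigenvalues i / a - 1 := by
    intro i _
    have hp := hB.eigenvalues_pos i
    have := Real.log_le_sub_one_of_pos (div_pos hp ha)
    rw [Real.log_div hp.ne' ha.ne'] at this
    linarith
  refine (Finset.sum_le_sum h1).trans (le_of_eq ?_)
  rw [Finset.sum_sub_distrib, Finset.sum_add_distrib, Finset.sum_div]
  simp

/-- Cauchy–Schwarz for the form of B, applied to B⁻¹x and v. -/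
theorem Matrix.PosDef.sq_dotProduct_le (hB : B.PosDef) (x v : Fin d → ℝ) :
    (x ⬝ᵥ v) ^ 2 ≤ (x ⬝ᵥ B⁻¹ *ᵥ x) * (v ⬝ᵥ B *ᵥ v) := by
  by_cases hv : v = 0
  · simp [hv]
  have hq : 0 < v ⬝ᵥ B *ᵥ v := by
    have := hB.dotProduct_mulVec_pos hv
    rwa [star_trivial] at this
  set q := v ⬝ᵥ B *ᵥ v
  set u := B⁻¹ *ᵥ x with hu
  have hBu : B *ᵥ u = x := hB.mulVec_inv_mulVec x
  have h0 := hB.quad_nonneg (u - ((x ⬝ᵥ v) / q) • v)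
  have h2 : u ⬝ᵥ B *ᵥ v = x ⬝ᵥ v := by rw [hB.dotProduct_mulVec_comm, hBu, dotProduct_comm]
  simp only [mulVec_sub, mulVec_smul, hBu, sub_dotProduct, dotProduct_sub, smul_dotProduct,
    dotProduct_smul, smul_eq_mul, h2, dotProduct_comm v x] at h0
  rw [dotProduct_comm u x] at h0
  have h3 : x ⬝ᵥ v / q * (v ⬝ᵥ B *ᵥ v) = x ⬝ᵥ v := div_mul_cancel₀ _ hq.ne'
  rw [h3] at h0
  have h4 : (x ⬝ᵥ v) / q * (x ⬝ᵥ v) ≤ x ⬝ᵥ u := by linarith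
  have h5 : (x ⬝ᵥ v) / q * (x ⬝ᵥ v) = (x ⬝ᵥ v) ^ 2 / q := by ring
  rwa [h5, div_le_iff₀ hq] at h4

/-- The g j are the rows of a factor G with B⁻¹ = GᵀG. This puts the information gain into the form
required by `integral_min_one_quadratic_selected`. -/
theorem Matrix.PosDef.exists_sum_sq_inv (hB : B.PosDef) :
    ∃ g : Fin d → EuclideanSpace ℝ (Fin d),
      (∀ x : EuclideanSpace ℝ (Fin d),
        x.ofLp ⬝ᵥ B⁻¹ *ᵥ x.ofLp = ∑ j, (inner ℝ x (g j) : ℝ) ^ 2) ∧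
      B⁻¹.trace = ∑ j, ‖g j‖ ^ 2 := by
  obtain ⟨G, hG⟩ := CStarAlgebra.nonneg_iff_eq_star_mul_self.1 hB.inv.posSemidef.nonneg
  rw [star_eq_conjTranspose, conjTranspose_eq_transpose_of_trivial] at hG
  refine ⟨fun j => WithLp.toLp 2 (G j), fun x => ?_, ?_⟩
  · rw [hG, ← mulVec_mulVec, dotProduct_mulVec, vecMul_transpose]
    simp [dotProduct, mulVec, PiLp.inner_apply, sq]
  · rw [hG]
    simp only [EuclideanSpace.real_norm_sq_eq, trace, diag_apply, mul_apply, transpose_apply]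
    rw [Finset.sum_comm]
    simp [sq]

/-- For w = B⁻¹eᵢ the form wᵀBw is the diagonal entry wᵢ itself, so l·wᵢ² ≤ l‖w‖² ≤ wᵢ and each
diagonal entry is at most 1/l. -/
theorem Matrix.PosDef.trace_inv_le (hB : B.PosDef) {l : ℝ} (hl : 0 < l)
    (h : ∀ v : Fin d → ℝ, l * (v ⬝ᵥ v) ≤ v ⬝ᵥ B *ᵥ v) : B⁻¹.trace ≤ d / l := by
  have h1 : ∀ i ∈ Finset.univ, B⁻¹ i i ≤ 1 / l := by
    intro i _
    set w := B⁻¹ *ᵥ Pi.single i 1 with hw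
    have h2 := h w
    rw [hw, hB.mulVec_inv_mulVec, ← hw, dotProduct_single_one] at h2
    have h3 : w i = B⁻¹ i i := by simp [hw]
    have h4 : w i * w i ≤ w ⬝ᵥ w :=
      Finset.single_le_sum (f := fun j => w j * w j) (fun j _ => mul_self_nonneg _)
        (Finset.mem_univ i)
    rw [← h3, le_div_iff₀ hl]
    by_contra hcon
    push Not at hcon
    have h5 : 0 < w i := pos_of_mul_pos_left (one_pos.trans hcon) hl.le
    nlinarith
  refine (Finset.sum_le_sum h1).trans (le_of_eq ?_)
  simp [div_eq_mul_inv]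

end RankOne

/-! ### Moments of the Gaussian posterior. -/

section Sampling

variable {d : ℕ} {S : Matrix (Fin d) (Fin d) ℝ} {μ : EuclideanSpace ℝ (Fin d)}

theorem dotProduct_ofLp (x y : EuclideanSpace ℝ (Fin d)) : x.ofLp ⬝ᵥ y.ofLp = inner ℝ x y := by
  rw [EuclideanSpace.inner_eq_star_dotProduct, star_trivial, dotProduct_comm]

theorem map_inner_multivariateGaussian (hS : S.PosSemidef) (v : EuclideanSpace ℝ (Fin d)) :
    (multivariateGaussian μ S).map (fun m => inner ℝ v m) =
      gaussianReal (inner ℝ v μ) (v.ofLp ⬝ᵥ S *ᵥ v.ofLp).toNNReal := by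
  have h1 := IsGaussian.map_eq_gaussianReal (μ := multivariateGaussian μ S) (innerSL ℝ v)
  have h2 : (⇑(innerSL ℝ v) : EuclideanSpace ℝ (Fin d) → ℝ) = fun x => inner ℝ v x := by
    ext x; rw [innerSL_apply_apply]
  rw [h2, _root_.integral_inner (𝕜 := ℝ) IsGaussian.integrable_fun_id v,
    integral_id_multivariateGaussian, ← covarianceBilin_self IsGaussian.memLp_two_id,
    covarianceBilin_multivariateGaussian hS] at h1
  exact h1

/-- The law of the selected context is only available for a nonzero direction; a sample from the
posterior is almost surely one. -/
theorem ae_ne_zero_multivariateGaussian (hS : S.PosDef) (hd : d ≠ 0) :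
    ∀ᵐ m ∂(multivariateGaussian μ S), m ≠ 0 := by
  have : NeZero d := ⟨hd⟩
  set v : EuclideanSpace ℝ (Fin d) := EuclideanSpace.single 0 1 with hv
  have hv0 : v.ofLp ≠ 0 := by
    intro h
    have := congrFun h 0
    simp [hv] at this
  have hq : 0 < v.ofLp ⬝ᵥ S *ᵥ v.ofLp := by
    have := hS.dotProduct_mulVec_pos hv0
    rwa [star_trivial] at this
  have hq' : (v.ofLp ⬝ᵥ S *ᵥ v.ofLp).toNNReal ≠ 0 := by
    simpa using hq
  have := nullSingletonClass_gaussianReal (μ := inner ℝ v μ) hq'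
  have h1 : ∀ᵐ y ∂((multivariateGaussian μ S).map fun m => (inner ℝ v m : ℝ)), y ≠ 0 := by
    rw [map_inner_multivariateGaussian hS.posSemidef]
    simp [ae_iff]
  have h2 := ae_of_ae_map (by fun_prop) h1
  filter_upwards [h2] with m hm h0
  simp [h0] at hm

theorem integral_norm_sub_sq_multivariateGaussian (hS : S.PosSemidef)
    (a : EuclideanSpace ℝ (Fin d)) :
    Integrable (fun m => ‖m - a‖ ^ 2) (multivariateGaussian μ S) ∧
    ∫ m, ‖m - a‖ ^ 2 ∂(multivariateGaussian μ S) = ‖μ - a‖ ^ 2 + S.trace := by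
  set Q := multivariateGaussian μ S
  have hcoord : ∀ i, Q.map (fun m => m i) = gaussianReal (μ i) (S i i).toNNReal := fun i =>
    (measurePreserving_eval_multivariateGaussian hS).map_eq
  have hL2 : ∀ i, MemLp (fun m : EuclideanSpace ℝ (Fin d) => m i) 2 Q := by
    intro i
    have h := memLp_id_gaussianReal (μ := μ i) (v := (S i i).toNNReal) 2
    rw [← hcoord i] at h
    exact (memLp_map_measure_iff (by fun_prop) (by fun_prop)).1 h
  have hmean : ∀ i, ∫ m : EuclideanSpace ℝ (Fin d), m i ∂Q = μ i := by
    intro i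
    have h := integral_id_gaussianReal (μ := μ i) (v := (S i i).toNNReal)
    rw [← hcoord i, integral_map (by fun_prop) (by fun_prop)] at h
    exact h
  have hvar : ∀ i, ∫ m : EuclideanSpace ℝ (Fin d), (m i - a i) ^ 2 ∂Q
      = (μ i - a i) ^ 2 + S i i := by
    intro i
    have h1 := variance_eval_multivariateGaussian (μ := μ) hS i
    have h2 : MemLp (fun m : EuclideanSpace ℝ (Fin d) => m i - a i) 2 Q :=
      (hL2 i).sub (memLp_const _)
    have h3 := variance_eq_sub h2
    rw [variance_sub_const (by fun_prop), h1] at h3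
    simp only [Pi.pow_apply] at h3
    rw [integral_sub ((hL2 i).integrable (by norm_num)) (integrable_const _), hmean] at h3
    simp only [integral_const, probReal_univ, one_smul] at h3
    linarith
  have hint : ∀ i, Integrable (fun m : EuclideanSpace ℝ (Fin d) => (m i - a i) ^ 2) Q := fun i =>
    ((hL2 i).sub (memLp_const _)).integrable_sq
  simp only [EuclideanSpace.real_norm_sq_eq, PiLp.sub_apply]
  refine ⟨integrable_finsetSum _ fun i _ => hint i, ?_⟩
  rw [integral_finsetSum _ fun i _ => hint i]
  simp only [hvar, Finset.sum_add_distrib, trace, diag_apply]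

theorem integral_min_one_norm_sub_sq_le (hS : S.PosSemidef) (a : EuclideanSpace ℝ (Fin d)) :
    Integrable (fun m => min 1 (‖m - a‖ ^ 2)) (multivariateGaussian μ S) ∧
    ∫ m, min 1 (‖m - a‖ ^ 2) ∂(multivariateGaussian μ S) ≤ min 1 (S.trace + ‖μ - a‖ ^ 2) := by
  obtain ⟨h1, h2⟩ := integral_norm_sub_sq_multivariateGaussian (μ := μ) hS a
  have h3 : Integrable (fun m => min 1 (‖m - a‖ ^ 2)) (multivariateGaussian μ S) :=
    integrable_min_one_sq _ (by fun_prop)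
  refine ⟨h3, le_min ?_ ?_⟩
  · have := integral_mono h3 (integrable_const (1 : ℝ)) fun m => min_le_left _ _
    simpa using this
  · rw [add_comm, ← h2]
    exact integral_mono h3 h1 fun m => min_le_right _ _

end Sampling

/-! ### One round: regret against spread, and spread against information. -/

section OneStep

variable {d N : ℕ} {ν : Measure (EuclideanSpace ℝ (Fin d))} {k K : ℝ}
  {sel : (Fin N → EuclideanSpace ℝ (Fin d)) → EuclideanSpace ℝ (Fin d) → Fin N}
  {B : Matrix (Fin d) (Fin d) ℝ} {m₀ μ : EuclideanSpace ℝ (Fin d)}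

/-- The increase of information caused by observing the context `x`. -/
def infoGain (B : Matrix (Fin d) (Fin d) ℝ) (x : EuclideanSpace ℝ (Fin d)) : ℝ :=
  x.ofLp ⬝ᵥ B⁻¹ *ᵥ x.ofLp

theorem infoGain_nonneg (hB : B.PosDef) (x : EuclideanSpace ℝ (Fin d)) : 0 ≤ infoGain B x :=
  hB.quad_inv_nonneg _

theorem continuous_infoGain (B : Matrix (Fin d) (Fin d) ℝ) : Continuous (infoGain B) := by
  unfold infoGain
  exact (PiLp.continuous_ofLp 2 _).dotProduct
    (continuous_const.matrix_mulVec (PiLp.continuous_ofLp 2 _))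

theorem le_lintegral_of_le_on {X : Type*} [MeasurableSpace X] {P : Measure X} {A : Set X}
    (hA : MeasurableSet A) {f : X → ENNReal} {c : ENNReal} (h : ∀ x ∈ A, c ≤ f x) :
    c * P A ≤ ∫⁻ x, f x ∂P := by
  rw [← setLIntegral_const]
  exact (setLIntegral_mono' hA h).trans (setLIntegral_le_lintegral _ _)

/-- Averages `integral_regret_le` over the sampled parameter. The mean of the truncated square is
bounded both by 1 and by squared bias plus trace of the posterior covariance. -/
theorem lintegral_regret_le (h : IsCenteredGaussian ν k K) (hk : 0 < k)
    (hN : 2 ≤ N) (hd : d ≠ 0) (hs : IsArgmaxRule sel) {κ : ℝ} (hκ : 0 < κ)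
    (hμ1 : κ⁻¹ ≤ ‖μ‖) (hμ2 : ‖μ‖ ≤ κ) (hB : B.PosDef) :
    ∫⁻ m, ∫⁻ x : Fin N → EuclideanSpace ℝ (Fin d),
        ENNReal.ofReal (inner ℝ (x (sel x μ)) μ - inner ℝ (x (sel x m)) μ)
        ∂(Measure.pi fun _ => ν) ∂(multivariateGaussian m₀ B⁻¹) ≤
      ENNReal.ofReal (4 * (K / (√k * κ⁻¹) + √K * κ) * √(Real.log N)) *
        ENNReal.ofReal (min 1 (B⁻¹.trace + ‖m₀ - μ‖ ^ 2)) := by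
  set c := 4 * (K / (√k * κ⁻¹) + √K * κ) * √(Real.log N) with hc
  obtain ⟨i1, i2⟩ := integral_min_one_norm_sub_sq_le (μ := m₀) hB.inv.posSemidef μ
  have hμ : μ ≠ 0 := by
    rintro rfl
    rw [norm_zero] at hμ1
    exact absurd hμ1 (not_le.2 (inv_pos.2 hκ))
  have hK : 0 ≤ K := by
    have h1 := (h.lower μ).trans (h.upper μ)
    have h2 : 0 < ‖μ‖ ^ 2 := by positivity
    nlinarith
  have hc0 : 0 ≤ c := by positivity
  calc _ ≤ ∫⁻ m, ENNReal.ofReal (c * min 1 (‖m - μ‖ ^ 2)) ∂(multivariateGaussian m₀ B⁻¹) := by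
        refine lintegral_mono_ae ?_
        filter_upwards [ae_ne_zero_multivariateGaussian hB.inv hd] with m hm
        obtain ⟨j1, j2⟩ := integral_regret_le h hk hN hs hκ hμ1 hμ2 hm
        rw [← ofReal_integral_eq_lintegral_ofReal j1
          (ae_of_all _ fun x => sub_nonneg.2 (hs.le x μ _))]
        exact ENNReal.ofReal_le_ofReal j2
    _ = ENNReal.ofReal (c * ∫ m, min 1 (‖m - μ‖ ^ 2) ∂(multivariateGaussian m₀ B⁻¹)) := by
        rw [← integral_const_mul, ofReal_integral_eq_lintegral_ofReal (i1.const_mul c)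
          (ae_of_all _ fun m => mul_nonneg hc0 (le_min zero_le_one (sq_nonneg _)))]
    _ ≤ _ := by
        rw [← ENNReal.ofReal_mul hc0]
        exact ENNReal.ofReal_le_ofReal (mul_le_mul_of_nonneg_left i2 hc0)

theorem min_one_le_two_mul_log {y : ℝ} (hy : 0 ≤ y) : min 1 y ≤ 2 * Real.log (1 + y) := by
  have h1 := Real.one_sub_inv_le_log_of_pos (by linarith : 0 < 1 + y)
  have h2 : 1 - (1 + y)⁻¹ = y / (1 + y) := by field_simp; ring
  rw [h2] at h1
  refine le_trans ?_ (mul_le_mul_of_nonneg_left h1 two_pos.le)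
  rw [mul_div_assoc', le_div_iff₀ (by linarith)]
  rcases le_total 1 y with h | h
  · rw [min_eq_left h]; linarith
  · rw [min_eq_right h]; nlinarith

/-- If y ≥ 1 the logarithm alone pays for the left side; if y ≤ 1 the discount 1 + y is at most 2.
The discounted square is exactly what the recursion of the weighted error can absorb. -/
theorem min_one_le_log_add {y q : ℝ} (hy : 0 ≤ y) (hq : 0 ≤ q) :
    min 1 q ≤ 2 * Real.log (1 + y) + 2 * (q / (1 + y)) := by
  have h0 := min_one_le_two_mul_log hy
  rcases le_total 1 y with h | h
  · rw [min_eq_left h] at h0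
    have : 0 ≤ q / (1 + y) := by positivity
    linarith [min_le_left 1 q]
  · have h1 : q / 2 ≤ q / (1 + y) := by gcongr; linarith
    have h2 : 0 ≤ Real.log (1 + y) := Real.log_nonneg (by linarith)
    linarith [min_le_right 1 q]

/-- The posterior uncertainty and the estimation error are controlled by the expected information
gain and the expected squared prediction error. -/
theorem min_one_le_lintegral (h : IsCenteredGaussian ν k K) (hk : 0 < k) (hN : N ≠ 0) (hd : d ≠ 0)
    (hs : IsArgmaxRule sel) (hB : B.PosDef) (e : EuclideanSpace ℝ (Fin d)) :
    ENNReal.ofReal (gaussianTrunc / 8 * min 1 k) * ENNReal.ofReal (min 1 (B⁻¹.trace + ‖e‖ ^ 2)) ≤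
      ∫⁻ m, ∫⁻ x : Fin N → EuclideanSpace ℝ (Fin d),
        ENNReal.ofReal (4 * Real.log (1 + infoGain B (x (sel x m))) +
          2 * ((inner ℝ (x (sel x m)) e) ^ 2 / (1 + infoGain B (x (sel x m)))))
        ∂(Measure.pi fun _ => ν) ∂(multivariateGaussian m₀ B⁻¹) := by
  have : NeZero N := ⟨hN⟩
  have := h.gaussian
  set c := gaussianTrunc / 8 * min 1 k with hc
  have hc0 : 0 ≤ c := mul_nonneg (by linarith [gaussianTrunc_pos]) (le_min zero_le_one hk.le)
  obtain ⟨g, hg, hgt⟩ := hB.exists_sum_sq_inv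
  have htr : 0 ≤ B⁻¹.trace := by rw [hgt]; positivity
  have key : ∀ m : EuclideanSpace ℝ (Fin d), m ≠ 0 →
      ENNReal.ofReal (c * min 1 (B⁻¹.trace + ‖e‖ ^ 2)) ≤
      ∫⁻ x : Fin N → EuclideanSpace ℝ (Fin d),
        ENNReal.ofReal (4 * Real.log (1 + infoGain B (x (sel x m))) +
          2 * ((inner ℝ (x (sel x m)) e) ^ 2 / (1 + infoGain B (x (sel x m)))))
        ∂(Measure.pi fun _ => ν) := by
    intro m hm
    have hx := hs.measurable_selected_left m
    have h1 := integral_min_one_quadratic_selected h hk hs hm g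
    simp only [← hg] at h1
    rw [← hgt, ← hc] at h1
    have h2 := integral_min_one_sq_selected h hk hs hm e
    rw [← hc] at h2
    have j1 : Integrable (fun x : Fin N → EuclideanSpace ℝ (Fin d) =>
        min 1 (infoGain B (x (sel x m)))) (Measure.pi fun _ => ν) := by
      refine Integrable.mono' (integrable_const (1 : ℝ)) ?_ (ae_of_all _ fun x => ?_)
      · exact (measurable_const.min ((continuous_infoGain B).measurable.comp hx)).aestronglyMeasurable
      · rw [Real.norm_of_nonneg (le_min zero_le_one (infoGain_nonneg hB _))]
        exact min_le_left _ _
    have j2 : Integrable (fun x : Fin N → EuclideanSpace ℝ (Fin d) =>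
        min 1 ((inner ℝ (x (sel x m)) e : ℝ) ^ 2)) (Measure.pi fun _ => ν) :=
      integrable_min_one_sq _ (hx.inner measurable_const).aestronglyMeasurable
    calc ENNReal.ofReal (c * min 1 (B⁻¹.trace + ‖e‖ ^ 2))
        ≤ ENNReal.ofReal (∫ x : Fin N → EuclideanSpace ℝ (Fin d),
          (min 1 (infoGain B (x (sel x m))) + min 1 ((inner ℝ (x (sel x m)) e : ℝ) ^ 2))
            ∂(Measure.pi fun _ => ν)) := by
          rw [integral_add j1 j2]
          refine ENNReal.ofReal_le_ofReal (le_trans ?_ (add_le_add h1 h2))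
          rw [← mul_add]
          exact mul_le_mul_of_nonneg_left (min_one_add_le htr (sq_nonneg _)) hc0
      _ = ∫⁻ x : Fin N → EuclideanSpace ℝ (Fin d), ENNReal.ofReal
          (min 1 (infoGain B (x (sel x m))) + min 1 ((inner ℝ (x (sel x m)) e : ℝ) ^ 2))
            ∂(Measure.pi fun _ => ν) := by
          exact ofReal_integral_eq_lintegral_ofReal (j1.add j2) (ae_of_all _ fun x =>
            add_nonneg (le_min zero_le_one (infoGain_nonneg hB _))
              (le_min zero_le_one (sq_nonneg _)))
      _ ≤ _ := by
          refine lintegral_mono fun x => ENNReal.ofReal_le_ofReal ?_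
          have a1 := min_one_le_two_mul_log (infoGain_nonneg hB (x (sel x m)))
          have a2 := min_one_le_log_add (infoGain_nonneg hB (x (sel x m)))
            (sq_nonneg (inner ℝ (x (sel x m)) e))
          linarith
  rw [← ENNReal.ofReal_mul hc0]
  calc _ = ∫⁻ _, ENNReal.ofReal (c * min 1 (B⁻¹.trace + ‖e‖ ^ 2))
        ∂(multivariateGaussian m₀ B⁻¹) := by simp
    _ ≤ _ := by
        refine lintegral_mono_ae ?_
        filter_upwards [ae_ne_zero_multivariateGaussian hB.inv hd] with m hm
        exact key m hm

end OneStep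

/-! ### One round with very many arms. -/

section OneStep

variable {d N : ℕ} {ν : Measure (EuclideanSpace ℝ (Fin d))} {k K : ℝ}
  {sel : (Fin N → EuclideanSpace ℝ (Fin d)) → EuclideanSpace ℝ (Fin d) → Fin N}
  {B : Matrix (Fin d) (Fin d) ℝ} {m₀ μ : EuclideanSpace ℝ (Fin d)}

theorem lintegral_norm_sq_selected_le (h : IsCenteredGaussian ν k K) (hk : 0 < k) (hN : N ≠ 0)
    (hd : d ≠ 0) (hs : IsArgmaxRule sel) (hB : B.PosDef) :
    ∫⁻ m, ∫⁻ x : Fin N → EuclideanSpace ℝ (Fin d),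
        ENNReal.ofReal (‖x (sel x m)‖ ^ 2) ∂(Measure.pi fun _ => ν) ∂(multivariateGaussian m₀ B⁻¹) ≤
      ENNReal.ofReal (8 * K * (Real.log N + 1) * d) := by
  have : NeZero N := ⟨hN⟩
  calc _ ≤ ∫⁻ _, ENNReal.ofReal (8 * K * (Real.log N + 1) * d) ∂(multivariateGaussian m₀ B⁻¹) := by
        refine lintegral_mono_ae ?_
        filter_upwards [ae_ne_zero_multivariateGaussian hB.inv hd] with m hm
        set b := EuclideanSpace.basisFun (Fin d) ℝ
        have hb : ∀ y : EuclideanSpace ℝ (Fin d), ‖y‖ ^ 2 = ∑ i, (inner ℝ y (b i) : ℝ) ^ 2 :=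
          fun y => (b.sum_sq_inner_left y).symm
        have hI := fun i => integral_sq_selected_le h hk hs hm (b i)
        simp only [hb]
        rw [← ofReal_integral_eq_lintegral_ofReal (integrable_finsetSum _ fun i _ => (hI i).1)
          (ae_of_all _ fun x => Finset.sum_nonneg fun i _ => sq_nonneg _),
          integral_finsetSum _ fun i _ => (hI i).1]
        refine ENNReal.ofReal_le_ofReal ((Finset.sum_le_sum fun i _ => (hI i).2).trans ?_)
        simp [mul_comm]
    _ = _ := by simp

/-- The covariance of a random score with the score of v is ⟨v', m⟩ for a fixed vector v', hence
Gaussian under the posterior with variance v'ᵀB⁻¹v'. Cauchy–Schwarz bounds this below by ⟨v',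
v⟩²/(vᵀBv), which is large because v is poorly explored. A Gaussian with that variance avoids a
small ball around 0, whatever its mean. -/
theorem sampled_direction (h : IsCenteredGaussian ν k K) (hk : 0 < k) (hB : B.PosDef)
    {T : ℝ} (hT0 : 0 < T) {v : EuclideanSpace ℝ (Fin d)} (hv : v ≠ 0)
    (hv₀ : v.ofLp ⬝ᵥ B *ᵥ v.ofLp < T ^ 2 * ‖v‖ ^ 2) :
    (multivariateGaussian m₀ B⁻¹).real
      {m | k ^ 2 * ‖v‖ ^ 2 / (16 * T ^ 2) ≤ covarianceBilin ν m v ^ 2}ᶜ ≤ 1 / 4 := by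
  have hvpos : 0 < ‖v‖ ^ 2 := by positivity
  set n := ‖v‖ ^ 2 with hn
  set v' : EuclideanSpace ℝ (Fin d) :=
    (InnerProductSpace.toDual ℝ (EuclideanSpace ℝ (Fin d))).symm (covarianceBilin ν v) with hv'
  have hv'm : ∀ m, (inner ℝ v' m : ℝ) = covarianceBilin ν m v := fun m => by
    rw [hv', InnerProductSpace.toDual_symm_apply, covarianceBilin_comm]
  set s2 := v'.ofLp ⬝ᵥ B⁻¹ *ᵥ v'.ofLp with hs2
  have hs2low : k ^ 2 * n / T ^ 2 ≤ s2 := by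
    have h1 := hB.sq_dotProduct_le v'.ofLp v.ofLp
    rw [dotProduct_ofLp, hv'm, ← hs2] at h1
    have h2 := h.lower v
    have h3 : (k * n) ^ 2 ≤ s2 * (T ^ 2 * n) :=
      (pow_le_pow_left₀ (by positivity) h2 2).trans
        (h1.trans (mul_le_mul_of_nonneg_left hv₀.le (hB.quad_inv_nonneg _)))
    rw [div_le_iff₀ (by positivity)]
    have h4 : n * (k ^ 2 * n) ≤ n * (s2 * T ^ 2) := by nlinarith
    exact le_of_mul_le_mul_left h4 hvpos
  have hs2pos : 0 < s2 := lt_of_lt_of_le (by positivity) hs2low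
  have hs2nn : s2.toNNReal ≠ 0 := by simpa using hs2pos
  have hs2coe : ((s2.toNNReal : NNReal) : ℝ) = s2 := Real.coe_toNNReal _ hs2pos.le
  have hlaw : (multivariateGaussian m₀ B⁻¹).map (fun m => inner ℝ v' m) = gaussianReal (inner ℝ v' m₀) s2.toNNReal :=
    map_inner_multivariateGaussian hB.inv.posSemidef v'
  have h1 := gaussianReal_small_ball (inner ℝ v' m₀) hs2nn
  rw [← hlaw, map_measureReal_apply (by fun_prop)
    (measurableSet_lt (by fun_prop) measurable_const), hs2coe] at h1
  refine le_trans (measureReal_mono fun m hm => ?_) h1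
  simp only [Set.mem_compl_iff, Set.mem_ofPred_eq, not_le, Set.mem_preimage, ← hv'm] at hm ⊢
  by_contra hcon
  push Not at hcon
  have h2 := pow_le_pow_left₀ (by positivity) hcon 2
  rw [sq_abs, div_pow, Real.sq_sqrt hs2pos.le] at h2
  have h3 : k ^ 2 * n / (16 * T ^ 2) ≤ s2 / 4 ^ 2 := by
    calc k ^ 2 * n / (16 * T ^ 2) = (k ^ 2 * n / T ^ 2) / 4 ^ 2 := by ring
      _ ≤ s2 / 4 ^ 2 := by gcongr
  linarith

/-- Markov's inequality for ‖m‖², whose posterior mean ‖m₀‖² + tr B⁻¹ is at most a quarter of the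
threshold. -/
theorem sampled_norm_sq (hB : B.PosDef) {κ T : ℝ} (hκ : 0 < κ)
    (hB0 : ∀ v : Fin d → ℝ, κ⁻¹ * (v ⬝ᵥ v) ≤ v ⬝ᵥ B *ᵥ v) (hμ : ‖μ‖ ≤ κ)
    (hT : 1 ≤ T) (hdT : d ≤ T) (hbig : ‖m₀ - μ‖ ^ 2 ≤ T ^ 3) :
    (multivariateGaussian m₀ B⁻¹).real {m | ‖m‖ ^ 2 ≤ 4 * (2 + 2 * κ ^ 2 + κ) * T ^ 3}ᶜ ≤ 1 / 4 := by
  have hT0 : 0 < T := one_pos.trans_le hT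
  set Q := multivariateGaussian m₀ B⁻¹
  set e := m₀ - μ with he
  set C := 2 + 2 * κ ^ 2 + κ with hC
  have hC0 : 0 < C := by positivity
  set R := 4 * C * T ^ 3 with hR
  have hR0 : 0 < R := by positivity
  set A₂ : Set (EuclideanSpace ℝ (Fin d)) := {m | ‖m‖ ^ 2 ≤ R} with hA₂
  obtain ⟨j1, j2⟩ := integral_norm_sub_sq_multivariateGaussian (μ := m₀) hB.inv.posSemidef 0
  simp only [sub_zero] at j1 j2
  have h1 := mul_meas_ge_le_integral_of_nonneg (μ := Q)
    (ae_of_all _ fun m => sq_nonneg ‖m‖) j1 R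
  have h2 : ‖m₀‖ ^ 2 ≤ 2 * ‖e‖ ^ 2 + 2 * ‖μ‖ ^ 2 := by
    have h3 : ‖m₀‖ ≤ ‖e‖ + ‖μ‖ := by
      have := norm_add_le e μ
      rwa [he, sub_add_cancel] at this
    nlinarith [sq_nonneg (‖e‖ - ‖μ‖), norm_nonneg m₀, norm_nonneg e, norm_nonneg μ]
  have h3 := hB.trace_inv_le (inv_pos.2 hκ) hB0
  have h4 : (d : ℝ) / κ⁻¹ = d * κ := by rw [div_inv_eq_mul]
  have h5 : ‖μ‖ ^ 2 ≤ κ ^ 2 := by gcongr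
  have h6 : T ≤ T ^ 3 := le_self_pow₀ hT (by norm_num)
  have h7 : ‖m₀‖ ^ 2 + (B⁻¹).trace ≤ C * T ^ 3 := by
    have h8 : (d : ℝ) * κ ≤ T ^ 3 * κ := by gcongr; linarith
    have h9 : κ ^ 2 ≤ κ ^ 2 * T ^ 3 := le_mul_of_one_le_right (sq_nonneg _) (one_le_pow₀ hT)
    rw [hC]
    nlinarith
  rw [j2] at h1
  have h8 : Q.real A₂ᶜ ≤ Q.real {m | R ≤ ‖m‖ ^ 2} := by
    refine measureReal_mono fun m hm => ?_
    simp only [hA₂, Set.mem_compl_iff, Set.mem_ofPred_eq, not_le] at hm ⊢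
    exact hm.le
  have h9 : R * Q.real {m | R ≤ ‖m‖ ^ 2} ≤ R * (1 / 4) := by
    refine (h1.trans h7).trans (le_of_eq ?_)
    rw [hR]; ring
  exact h8.trans (le_of_mul_le_mul_left h9 hR0)

/-- On an event of probability at least 1/4, ⟨x,v⟩² is of order log N, while Cauchy–Schwarz bounds
it by the information gain times T²‖v‖². The losses T² from the correlation, T³ from ‖m‖² and T²
from the exploration make up T⁷, and 256 = 16·4·4; dividing log N by the resulting constant times T⁷
still leaves at least √(log N). -/
theorem infoGain_of_many_arms (h : IsCenteredGaussian ν k K) (hk : 0 < k) (hK : 0 < K)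
    (hs : IsArgmaxRule sel) (hB : B.PosDef) {C T : ℝ} (hC0 : 0 < C)
    (hT0 : 0 < T) (hL4 : 4 ≤ Real.log N) (hL : 256 * K * C / k ^ 2 * T ^ 7 ≤ √(Real.log N))
    {v m : EuclideanSpace ℝ (Fin d)} (hv : v ≠ 0)
    (hv₀ : v.ofLp ⬝ᵥ B *ᵥ v.ofLp < T ^ 2 * ‖v‖ ^ 2)
    (hcov : k ^ 2 * ‖v‖ ^ 2 / (16 * T ^ 2) ≤ covarianceBilin ν m v ^ 2)
    (hm2 : ‖m‖ ^ 2 ≤ 4 * C * T ^ 3) :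
    ENNReal.ofReal (Real.log (Real.log N) / 2) * ENNReal.ofReal (1 / 4) ≤
      ∫⁻ x : Fin N → EuclideanSpace ℝ (Fin d),
        ENNReal.ofReal (Real.log (1 + infoGain B (x (sel x m)))) ∂(Measure.pi fun _ => ν) := by
  have := h.gaussian
  set L := Real.log N with hLd
  have hvpos : 0 < ‖v‖ ^ 2 := by positivity
  set n := ‖v‖ ^ 2 with hn
  set R := 4 * C * T ^ 3 with hR
  have hR0 : 0 < R := by positivity
  have hm0 : m ≠ 0 := by
    rintro rfl
    have : 0 < k ^ 2 * n / (16 * T ^ 2) := by positivity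
    simp at hcov
    linarith
  have hx := hs.measurable_selected_left m
  have hvar : covarianceBilin ν m m ≤ K * R := (h.upper m).trans (by gcongr)
  have hvar0 : 0 < covarianceBilin ν m m := by
    have : 0 < ‖m‖ := norm_pos_iff.2 hm0
    exact lt_of_lt_of_le (by positivity) (h.lower m)
  set Am : Set (Fin N → EuclideanSpace ℝ (Fin d)) :=
    {x | covarianceBilin ν m v ^ 2 / covarianceBilin ν m m * (L / 4)
      ≤ (inner ℝ (x (sel x m)) v : ℝ) ^ 2} with hAm
  have hmAm : MeasurableSet Am :=
    measurableSet_le measurable_const ((hx.inner measurable_const).pow_const 2)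
  have hPm : ENNReal.ofReal (1 / 4) ≤ (Measure.pi fun _ => ν) Am :=
    ENNReal.ofReal_le_of_le_toReal (measure_sq_selected_ge h hk hL4 hs hm0 v)
  refine (mul_le_mul_right hPm _).trans (le_lintegral_of_le_on hmAm fun x hxm => ?_)
  refine ENNReal.ofReal_le_ofReal ?_
  set y := x (sel x m)
  have hi0 := infoGain_nonneg hB y
  have hlow : (k ^ 2 * n / (16 * T ^ 2)) / (K * R) * (L / 4) ≤ (inner ℝ y v : ℝ) ^ 2 := by
    refine le_trans ?_ hxm
    gcongr
  have hup : (inner ℝ y v : ℝ) ^ 2 ≤ infoGain B y * (T ^ 2 * n) := by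
    have h1 := hB.sq_dotProduct_le y.ofLp v.ofLp
    rw [dotProduct_ofLp] at h1
    exact h1.trans (mul_le_mul_of_nonneg_left hv₀.le hi0)
  have hsqL : √L ^ 2 = L := Real.sq_sqrt (by linarith)
  have hsqL0 : 0 < √L := Real.sqrt_pos.2 (by linarith)
  have hfin : √L ≤ infoGain B y := by
    have h1 := hlow.trans hup
    have h2 : (k ^ 2 * n / (16 * T ^ 2)) / (K * R) * (L / 4)
        = (L / (256 * K * C / k ^ 2 * T ^ 7)) * (T ^ 2 * n) := by
      rw [hR]; field_simp; ring
    rw [h2] at h1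
    have h3 := le_of_mul_le_mul_right h1 (by positivity)
    refine le_trans ?_ h3
    rw [le_div_iff₀ (by positivity)]
    have h9 := mul_le_mul_of_nonneg_left hL hsqL0.le
    rwa [← sq, hsqL] at h9
  have h5 := Real.log_le_log hsqL0 (by linarith : √L ≤ 1 + infoGain B y)
  rw [Real.log_sqrt (by linarith)] at h5
  exact h5

/-- With very many arms, either the posterior is already concentrated, or the information gain of
the next observation is large. -/
theorem min_one_le_lintegral_of_many_arms (h : IsCenteredGaussian ν k K) (hk : 0 < k) (hK : 0 < K)
    (hd : d ≠ 0) (hs : IsArgmaxRule sel) (hB : B.PosDef) {κ T : ℝ} (hκ : 0 < κ)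
    (hB0 : ∀ v : Fin d → ℝ, κ⁻¹ * (v ⬝ᵥ v) ≤ v ⬝ᵥ B *ᵥ v) (hμ : ‖μ‖ ≤ κ)
    (hT : 1 ≤ T) (hdT : d ≤ T) (hL4 : 4 ≤ Real.log N)
    (hL : 256 * K * (2 + 2 * κ ^ 2 + κ) / k ^ 2 * T ^ 7 ≤ √(Real.log N)) :
    ENNReal.ofReal (min 1 (B⁻¹.trace + ‖m₀ - μ‖ ^ 2)) ≤
      ENNReal.ofReal (((m₀ - μ).ofLp ⬝ᵥ B *ᵥ (m₀ - μ).ofLp + d) / T ^ 2 + ‖m₀ - μ‖ ^ 2 / T ^ 3) +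
      ENNReal.ofReal (16 / Real.log (Real.log N)) *
        ∫⁻ m, ∫⁻ x : Fin N → EuclideanSpace ℝ (Fin d),
          ENNReal.ofReal (Real.log (1 + infoGain B (x (sel x m))))
          ∂(Measure.pi fun _ => ν) ∂(multivariateGaussian m₀ B⁻¹) := by
  have := h.gaussian
  set e := m₀ - μ with he
  set V := e.ofLp ⬝ᵥ B *ᵥ e.ofLp with hV
  set L := Real.log N with hLd
  have hT0 : 0 < T := one_pos.trans_le hT
  have hV0 : 0 ≤ V := hB.quad_nonneg _
  have hlogL : 0 < Real.log L := Real.log_pos (by linarith)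
  -- Three cases: every direction is well explored, so the spread is small; the error is huge, so
  -- ‖e‖²/T³ exceeds 1; or some direction is poorly explored while the error is moderate. Only the
  -- last one uses the number of arms.
  by_cases hgood : ∀ v : Fin d → ℝ, T ^ 2 * (v ⬝ᵥ v) ≤ v ⬝ᵥ B *ᵥ v
  · have h1 := hB.trace_inv_le (by positivity) hgood
    have h2 := hgood e.ofLp
    rw [dotProduct_ofLp, real_inner_self_eq_norm_sq] at h2
    have h3 : ‖e‖ ^ 2 ≤ V / T ^ 2 := by rw [le_div_iff₀ (by positivity)]; linarith
    have h4 : 0 ≤ ‖e‖ ^ 2 / T ^ 3 := by positivity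
    refine le_trans (ENNReal.ofReal_le_ofReal ((min_le_right _ _).trans ?_)) le_self_add
    rw [add_div]
    linarith
  by_cases hbig : T ^ 3 < ‖e‖ ^ 2
  · refine le_trans (ENNReal.ofReal_le_ofReal ((min_le_left _ _).trans ?_)) le_self_add
    have h1 : 1 ≤ ‖e‖ ^ 2 / T ^ 3 := by rw [le_div_iff₀ (by positivity)]; linarith
    have h2 : 0 ≤ (V + d) / T ^ 2 := by positivity
    linarith
  push Not at hgood hbig
  obtain ⟨v₀, hv₀⟩ := hgood
  have hv₀0 : v₀ ≠ 0 := by rintro rfl; simp at hv₀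
  set v : EuclideanSpace ℝ (Fin d) := WithLp.toLp 2 v₀ with hv
  have hvn : v₀ ⬝ᵥ v₀ = ‖v‖ ^ 2 := by rw [← real_inner_self_eq_norm_sq, ← dotProduct_ofLp]
  rw [hvn] at hv₀
  have hv0 : v ≠ 0 := fun h0 => hv₀0 (by simpa [hv] using congrArg WithLp.ofLp h0)
  have hmeas : MeasurableSet ({m | k ^ 2 * ‖v‖ ^ 2 / (16 * T ^ 2) ≤ covarianceBilin ν m v ^ 2} ∩
        {m | ‖m‖ ^ 2 ≤ 4 * (2 + 2 * κ ^ 2 + κ) * T ^ 3}) := by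
    refine (measurableSet_le measurable_const ?_).inter
      (measurableSet_le (by fun_prop) measurable_const)
    simp only [covarianceBilin_comm _ v]
    fun_prop
  have hPA : ENNReal.ofReal (1 / 2) ≤ multivariateGaussian m₀ B⁻¹
      ({m | k ^ 2 * ‖v‖ ^ 2 / (16 * T ^ 2) ≤ covarianceBilin ν m v ^ 2} ∩
        {m | ‖m‖ ^ 2 ≤ 4 * (2 + 2 * κ ^ 2 + κ) * T ^ 3}) := by
    refine ENNReal.ofReal_le_of_le_toReal ?_
    have h1 := sampled_direction (m₀ := m₀) h hk hB hT0 hv0 hv₀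
    have h2 := sampled_norm_sq hB hκ hB0 hμ hT hdT hbig
    have h3 := (measureReal_union_le (μ := multivariateGaussian m₀ B⁻¹) _ _).trans (add_le_add h1 h2)
    rw [← Set.compl_inter, probReal_compl_eq_one_sub] at h3
    · change 1 / 2 ≤ (multivariateGaussian m₀ B⁻¹).real _
      linarith
    · exact hmeas
  have hfinal := le_lintegral_of_le_on (P := multivariateGaussian m₀ B⁻¹) hmeas fun m hm =>
    infoGain_of_many_arms h hk hK hs hB (by positivity) hT0 hL4 hL hv0 hv₀ hm.1 hm.2
  refine le_trans ?_ le_add_self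
  refine le_trans ?_ (mul_le_mul_right ((mul_le_mul_right hPA _).trans hfinal) _)
  rw [← ENNReal.ofReal_mul (by positivity), ← ENNReal.ofReal_mul (by positivity),
    ← ENNReal.ofReal_mul (by positivity)]
  -- Here 16 compensates for the probabilities 1/2 and 1/4 and for the factor 1/2 in front of the
  -- iterated logarithm.
  refine ENNReal.ofReal_le_ofReal ((min_le_left _ _).trans (le_of_eq ?_))
  rw [← hLd]
  field_simp
  norm_num

end OneStep

/-! ### The drift of the weighted squared error. -/

section Error

variable {d N : ℕ} {ν : Measure (EuclideanSpace ℝ (Fin d))} {k K : ℝ}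
  {sel : (Fin N → EuclideanSpace ℝ (Fin d)) → EuclideanSpace ℝ (Fin d) → Fin N}
  {B : Matrix (Fin d) (Fin d) ℝ}

theorem lintegral_quadratic_gaussianReal (v : NNReal) {a b c : ℝ}
    (h : ∀ η, 0 ≤ a + 2 * η * b + η ^ 2 * c) :
    ∫⁻ η, ENNReal.ofReal (a + 2 * η * b + η ^ 2 * c) ∂(gaussianReal 0 v) =
      ENNReal.ofReal (a + v * c) := by
  have h1 : Integrable (fun η : ℝ => 2 * η * b) (gaussianReal 0 v) :=
    ((integrable_id_gaussianReal v).const_mul 2).mul_const b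
  have h2 : Integrable (fun η : ℝ => η ^ 2 * c) (gaussianReal 0 v) :=
    (integrable_sq_gaussianReal v).mul_const c
  have h3 : Integrable (fun η : ℝ => a + 2 * η * b) (gaussianReal 0 v) :=
    (integrable_const a).add h1
  refine (ofReal_integral_eq_lintegral_ofReal (h3.add h2) (ae_of_all _ h)).symm.trans ?_
  congr 1
  simp only [Pi.add_apply]
  rw [integral_add h3 h2, integral_add (integrable_const a) h1, integral_mul_const,
    integral_mul_const, integral_const_mul, integral_sq_gaussianReal]
  simp

theorem measurePreserving_selected_noise [IsProbabilityMeasure ν] (hs : IsArgmaxRule sel)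
    (v : NNReal) (m : EuclideanSpace ℝ (Fin d)) :
    MeasurePreserving (fun z : Fin N → EuclideanSpace ℝ (Fin d) × ℝ =>
        ((fun i => (z i).1), (z (sel (fun i => (z i).1) m)).2))
      (Measure.pi fun _ => ν.prod (gaussianReal 0 v))
      ((Measure.pi fun _ => ν).prod (gaussianReal 0 v)) :=
  (measurePreserving_select (Measure.pi fun _ : Fin N => ν) (gaussianReal 0 v)
    (hs.measurable_left m)).comp
    (measurePreserving_arrowProdEquivProdArrow (EuclideanSpace ℝ (Fin d)) ℝ (Fin N) (fun _ => ν)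
      (fun _ => gaussianReal 0 v))

/-- The weighted squared error after one more observation. -/
def nextError (B : Matrix (Fin d) (Fin d) ℝ) (e x : EuclideanSpace ℝ (Fin d)) (η : ℝ) : ℝ :=
  e.ofLp ⬝ᵥ B *ᵥ e.ofLp - (inner ℝ x e) ^ 2 / (1 + infoGain B x)
    + 2 * η * ((inner ℝ x e) / (1 + infoGain B x))
    + η ^ 2 * (infoGain B x / (1 + infoGain B x))

/-- The expression is the quadratic form of the updated precision matrix at the updated error
vector. -/
theorem nextError_nonneg (hB : B.PosDef) (e x : EuclideanSpace ℝ (Fin d)) (η : ℝ) :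
    0 ≤ nextError B e x η := by
  have hB' := hB.add_vecMulVec_self x.ofLp
  have h1 := hB.quad_rankOne_update x.ofLp e.ofLp
    ((B + vecMulVec x.ofLp x.ofLp)⁻¹ *ᵥ (B *ᵥ e.ofLp + η • x.ofLp)) η (hB'.mulVec_inv_mulVec _)
  rw [dotProduct_ofLp x e] at h1
  unfold nextError infoGain
  rw [← h1]
  exact hB'.quad_nonneg _

/-- Averaging over the residual kills the linear term and turns η² into its variance, because the
arm is selected from the estimates alone. The decrease is moved to the left side to avoid truncated
subtraction. -/
theorem lintegral_nextError_le [IsProbabilityMeasure ν] (hs : IsArgmaxRule sel) (hB : B.PosDef)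
    (v : NNReal) (e m : EuclideanSpace ℝ (Fin d)) :
    ∫⁻ z : Fin N → EuclideanSpace ℝ (Fin d) × ℝ,
        ENNReal.ofReal (nextError B e ((z (sel (fun i => (z i).1) m)).1)
          ((z (sel (fun i => (z i).1) m)).2)) ∂(Measure.pi fun _ => ν.prod (gaussianReal 0 v)) +
      ∫⁻ x : Fin N → EuclideanSpace ℝ (Fin d),
        ENNReal.ofReal ((inner ℝ (x (sel x m)) e) ^ 2 / (1 + infoGain B (x (sel x m))))
        ∂(Measure.pi fun _ => ν) ≤
      ENNReal.ofReal (e.ofLp ⬝ᵥ B *ᵥ e.ofLp) +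
      v * ∫⁻ x : Fin N → EuclideanSpace ℝ (Fin d),
        ENNReal.ofReal (infoGain B (x (sel x m)) / (1 + infoGain B (x (sel x m))))
        ∂(Measure.pi fun _ => ν) := by
  have hx := hs.measurable_selected_left m
  have hI : Measurable (infoGain B) := (continuous_infoGain B).measurable
  have hIx : Measurable fun x : Fin N → EuclideanSpace ℝ (Fin d) => infoGain B (x (sel x m)) :=
    hI.comp hx
  have hin : Measurable fun x : Fin N → EuclideanSpace ℝ (Fin d) =>
    (inner ℝ (x (sel x m)) e : ℝ) := hx.inner measurable_const
  set V := e.ofLp ⬝ᵥ B *ᵥ e.ofLp with hV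
  have hV0 : 0 ≤ V := hB.quad_nonneg _
  have hmp := measurePreserving_selected_noise (ν := ν) hs v m
  have hf : Measurable fun p : (Fin N → EuclideanSpace ℝ (Fin d)) × ℝ =>
      ENNReal.ofReal (nextError B e (p.1 (sel p.1 m)) p.2) := by
    refine ENNReal.measurable_ofReal.comp ?_
    unfold nextError
    have h1 : Measurable fun p : (Fin N → EuclideanSpace ℝ (Fin d)) × ℝ =>
      infoGain B (p.1 (sel p.1 m)) := hIx.comp measurable_fst
    have h2 : Measurable fun p : (Fin N → EuclideanSpace ℝ (Fin d)) × ℝ =>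
      (inner ℝ (p.1 (sel p.1 m)) e : ℝ) := hin.comp measurable_fst
    exact ((measurable_const.sub ((h2.pow_const 2).div (measurable_const.add h1))).add
      ((measurable_const.mul measurable_snd).mul (h2.div (measurable_const.add h1)))).add
      ((measurable_snd.pow_const 2).mul (h1.div (measurable_const.add h1)))
  have h1 := hmp.lintegral_comp hf
  simp only at h1
  rw [h1, lintegral_prod _ hf.aemeasurable]
  have h2 : ∀ x : Fin N → EuclideanSpace ℝ (Fin d),
      ∫⁻ η, ENNReal.ofReal (nextError B e (x (sel x m)) η) ∂(gaussianReal 0 v) =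
      ENNReal.ofReal (V - (inner ℝ (x (sel x m)) e) ^ 2 / (1 + infoGain B (x (sel x m)))
        + v * (infoGain B (x (sel x m)) / (1 + infoGain B (x (sel x m))))) := fun x =>
    lintegral_quadratic_gaussianReal v fun η => nextError_nonneg hB e (x (sel x m)) η
  simp only [h2]
  rw [← lintegral_add_right _ (by fun_prop), ← lintegral_const_mul _ (by fun_prop)]
  calc _ ≤ ∫⁻ x : Fin N → EuclideanSpace ℝ (Fin d), (ENNReal.ofReal V +
        v * ENNReal.ofReal (infoGain B (x (sel x m)) / (1 + infoGain B (x (sel x m)))))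
        ∂(Measure.pi fun _ => ν) := by
        refine lintegral_mono fun x => ?_
        set y := x (sel x m)
        have hi := infoGain_nonneg hB y
        have ha : 0 ≤ V - (inner ℝ y e) ^ 2 / (1 + infoGain B y) := by
          have := nextError_nonneg hB e y 0
          simp [nextError] at this
          linarith
        have hb : 0 ≤ (inner ℝ y e) ^ 2 / (1 + infoGain B y) := by positivity
        have hc : 0 ≤ infoGain B y / (1 + infoGain B y) := by positivity
        simp only
        rw [← ENNReal.ofReal_add (by positivity) hb, ← ENNReal.ofReal_coe_nnreal,
          ← ENNReal.ofReal_mul v.coe_nonneg, ← ENNReal.ofReal_add hV0 (by positivity)]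
        refine ENNReal.ofReal_le_ofReal (le_of_eq ?_)
        ring
    _ = _ := by
        rw [lintegral_add_left measurable_const]
        simp

end Error

/-! ### Reduction to a linear bandit with observed contexts and independent reward noise. -/

section Observation

theorem covariance_add_prod {X Y : Type*} [MeasurableSpace X] [MeasurableSpace Y] {α : Measure X}
    {β : Measure Y} [IsProbabilityMeasure α] [IsProbabilityMeasure β] {f₁ f₂ : X → ℝ}
    {g₁ g₂ : Y → ℝ} (hf₁ : MemLp f₁ 2 α) (hf₂ : MemLp f₂ 2 α) (hg₁ : MemLp g₁ 2 β)
    (hg₂ : MemLp g₂ 2 β) :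
    cov[fun p => f₁ p.1 + g₁ p.2, fun p => f₂ p.1 + g₂ p.2; α.prod β] =
      cov[f₁, f₂; α] + cov[g₁, g₂; β] := by
  have hF₁ : MemLp (fun p : X × Y => f₁ p.1) 2 (α.prod β) :=
    hf₁.comp_measurePreserving measurePreserving_fst
  have hF₂ : MemLp (fun p : X × Y => f₂ p.1) 2 (α.prod β) :=
    hf₂.comp_measurePreserving measurePreserving_fst
  have hG₁ : MemLp (fun p : X × Y => g₁ p.2) 2 (α.prod β) :=
    hg₁.comp_measurePreserving measurePreserving_snd
  have hG₂ : MemLp (fun p : X × Y => g₂ p.2) 2 (α.prod β) :=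
    hg₂.comp_measurePreserving measurePreserving_snd
  have e1 : cov[fun p : X × Y => f₁ p.1, fun p : X × Y => f₂ p.1; α.prod β] = cov[f₁, f₂; α] := by
    have h := (measurePreserving_fst (μ := α) (ν := β)).map_eq
    conv_rhs => rw [← h]
    rw [covariance_map (by rw [h]; exact hf₁.1) (by rw [h]; exact hf₂.1) (by fun_prop)]
    rfl
  have e2 : cov[fun p : X × Y => g₁ p.2, fun p : X × Y => g₂ p.2; α.prod β] = cov[g₁, g₂; β] := by
    have h := (measurePreserving_snd (μ := α) (ν := β)).map_eq
    conv_rhs => rw [← h]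
    rw [covariance_map (by rw [h]; exact hg₁.1) (by rw [h]; exact hg₂.1) (by fun_prop)]
    rfl
  have e3 := covariance_fst_snd_prod (μ := α) (ν := β) hf₁ hg₂
  have e4 := covariance_fst_snd_prod (μ := α) (ν := β) hf₂ hg₁
  rw [covariance_comm] at e4
  have e5 := covariance_add_left hF₁ hG₁ (hF₂.add hG₂)
  rw [covariance_add_right hF₁ hF₂ hG₂, covariance_add_right hG₁ hF₂ hG₂, e1, e2, e3, e4, add_zero,
    zero_add] at e5
  exact e5

variable {d : ℕ}

theorem covariance_prod_multivariateGaussian {S R : Matrix (Fin d) (Fin d) ℝ} (hS : S.PosSemidef)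
    (hR : R.PosSemidef) (s : NNReal) (a b a' b' : EuclideanSpace ℝ (Fin d)) (c c' : ℝ) :
    cov[fun z : EuclideanSpace ℝ (Fin d) × EuclideanSpace ℝ (Fin d) × ℝ =>
        inner ℝ a z.1 + (inner ℝ b z.2.1 + c * z.2.2),
      fun z => inner ℝ a' z.1 + (inner ℝ b' z.2.1 + c' * z.2.2);
      (multivariateGaussian 0 S).prod ((multivariateGaussian 0 R).prod (gaussianReal 0 s))] =
      a.ofLp ⬝ᵥ S *ᵥ a'.ofLp + (b.ofLp ⬝ᵥ R *ᵥ b'.ofLp + c * c' * s) := by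
  have hm : ∀ (S : Matrix (Fin d) (Fin d) ℝ) (a : EuclideanSpace ℝ (Fin d)),
      MemLp (fun x => (inner ℝ a x : ℝ)) 2 (multivariateGaussian 0 S) := fun S a =>
    (IsGaussian.memLp_two_fun_id (μ := multivariateGaussian 0 S)).const_inner a
  have hg : ∀ c : ℝ, MemLp (fun x => c * x) 2 (gaussianReal 0 s) := fun c =>
    (memLp_two_gaussianReal s).const_mul c
  have h1 : ∀ (b : EuclideanSpace ℝ (Fin d)) (c : ℝ),
      MemLp (fun z : EuclideanSpace ℝ (Fin d) × ℝ => inner ℝ b z.1 + c * z.2) 2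
        ((multivariateGaussian 0 R).prod (gaussianReal 0 s)) := fun b c =>
    ((hm R b).comp_measurePreserving measurePreserving_fst).add
      ((hg c).comp_measurePreserving measurePreserving_snd)
  rw [covariance_add_prod (hm S a) (hm S a') (h1 b c) (h1 b' c'),
    covariance_add_prod (hm R b) (hm R b') (hg c) (hg c'),
    ← covarianceBilin_apply_eq_cov IsGaussian.memLp_two_id,
    ← covarianceBilin_apply_eq_cov IsGaussian.memLp_two_id,
    covarianceBilin_multivariateGaussian hS, covarianceBilin_multivariateGaussian hR,
    covariance_const_mul_left, covariance_const_mul_right]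
  have : cov[fun x => x, fun x => x; gaussianReal 0 s] = s := by
    rw [covariance_self (by fun_prop)]
    exact variance_id_gaussianReal
  rw [this]
  ring

theorem isGaussian_prod_multivariateGaussian (S R : Matrix (Fin d) (Fin d) ℝ) (s : NNReal) :
    IsGaussian ((multivariateGaussian (0 : EuclideanSpace ℝ (Fin d)) S).prod
      ((multivariateGaussian (0 : EuclideanSpace ℝ (Fin d)) R).prod (gaussianReal 0 s))) :=
  inferInstance

theorem integral_prod_multivariateGaussian (S R : Matrix (Fin d) (Fin d) ℝ) (s : NNReal)
    (a b : EuclideanSpace ℝ (Fin d)) (c : ℝ) :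
    ∫ z, (inner ℝ a z.1 + (inner ℝ b z.2.1 + c * z.2.2))
      ∂((multivariateGaussian 0 S).prod ((multivariateGaussian 0 R).prod (gaussianReal 0 s))) =
      0 := by
  have hm : ∀ (S : Matrix (Fin d) (Fin d) ℝ) (a : EuclideanSpace ℝ (Fin d)),
      Integrable (fun x => (inner ℝ a x : ℝ)) (multivariateGaussian 0 S) := fun S a =>
    (IsGaussian.integrable_fun_id (μ := multivariateGaussian 0 S)).const_inner a
  have hz : ∀ (S : Matrix (Fin d) (Fin d) ℝ) (a : EuclideanSpace ℝ (Fin d)),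
      ∫ x, (inner ℝ a x : ℝ) ∂(multivariateGaussian 0 S) = 0 := fun S a => by
    rw [_root_.integral_inner (𝕜 := ℝ) IsGaussian.integrable_fun_id a,
      integral_id_multivariateGaussian, inner_zero_right]
  have hg : Integrable (fun x => c * x) (gaussianReal 0 s) :=
    (integrable_id_gaussianReal s).const_mul c
  have hs : Integrable (fun z : EuclideanSpace ℝ (Fin d) × ℝ => inner ℝ b z.1 + c * z.2)
      ((multivariateGaussian 0 R).prod (gaussianReal 0 s)) :=
    ((hm R b).comp_fst _).add (hg.comp_snd _)
  rw [integral_add ((hm S a).comp_fst _) (hs.comp_snd _), integral_fun_fst (fun x => (inner ℝ a x : ℝ)),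
    integral_fun_snd (fun z : EuclideanSpace ℝ (Fin d) × ℝ => inner ℝ b z.1 + c * z.2),
    integral_add ((hm R b).comp_fst _) (hg.comp_snd _),
    integral_fun_fst (fun x => (inner ℝ b x : ℝ)), integral_fun_snd (fun x => c * x), hz, hz,
    integral_const_mul]
  simp

namespace Params

variable {p : Params d} {κ : ℝ}

/-- The normal equation of linear regression: the second factor on the left is the covariance of the
output, and the right side is the cross-covariance of context and output. -/
theorem Admissible.D_mul (h : p.Admissible) :
    p.D * (p.A * p.Sx * p.Aᵀ + p.Sy) = p.Sx * p.Aᵀ := by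
  set M := p.Aᵀ * p.Sy⁻¹ * p.A + p.Sx⁻¹ with hM
  have hMp : M.PosDef := by
    have h1 : (p.Aᵀ * p.Sy⁻¹ * p.A).PosSemidef := by
      simpa using h.posDef_y.inv.posSemidef.conjTranspose_mul_mul_same p.A
    exact h.posDef_x.inv.posSemidef_add h1
  have hMu := hMp.isUnit_det'
  have hx := h.posDef_x.isUnit_det'
  have hy := h.posDef_y.isUnit_det'
  have h1 : M * (p.Sx * p.Aᵀ) = p.Aᵀ * p.Sy⁻¹ * (p.A * p.Sx * p.Aᵀ + p.Sy) := by
    rw [hM, add_mul, mul_add, nonsing_inv_mul_cancel_left _ _ hx,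
      nonsing_inv_mul_cancel_right _ _ hy]
    simp only [Matrix.mul_assoc]
  calc p.D * (p.A * p.Sx * p.Aᵀ + p.Sy)
      = M⁻¹ * (p.Aᵀ * p.Sy⁻¹ * (p.A * p.Sx * p.Aᵀ + p.Sy)) := by
        rw [D, ← hM]; simp only [Matrix.mul_assoc]
    _ = p.Sx * p.Aᵀ := by rw [← h1, nonsing_inv_mul_cancel_left _ _ hMu]

theorem inner_toEuclideanLin (S : Matrix (Fin d) (Fin d) ℝ) (v w : EuclideanSpace ℝ (Fin d)) :
    inner ℝ v (S.toEuclideanLin w) = v.ofLp ⬝ᵥ S *ᵥ w.ofLp := by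
  rw [← dotProduct_ofLp, Matrix.toLpLin_apply]

/-- The context estimate and its residual in the reward. -/
def armObs (p : Params d) (z : EuclideanSpace ℝ (Fin d) × EuclideanSpace ℝ (Fin d) × ℝ) :
    EuclideanSpace ℝ (Fin d) × ℝ :=
  (p.D.toEuclideanLin (p.A.toEuclideanLin z.1 + z.2.1),
    inner ℝ z.1 p.mu + z.2.2 -
      inner ℝ (p.D.toEuclideanLin (p.A.toEuclideanLin z.1 + z.2.1)) p.mu)

/-- This and `inner_residual` expose both observed quantities as linear functionals of the
independent primitive variables, so that all covariances can be read off. -/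
theorem inner_context (v : EuclideanSpace ℝ (Fin d))
    (z : EuclideanSpace ℝ (Fin d) × EuclideanSpace ℝ (Fin d) × ℝ) :
    inner ℝ v (p.armObs z).1 =
      inner ℝ (WithLp.toLp 2 (p.Aᵀ *ᵥ (p.Dᵀ *ᵥ v.ofLp))) z.1 +
        (inner ℝ (WithLp.toLp 2 (p.Dᵀ *ᵥ v.ofLp)) z.2.1 + 0 * z.2.2) := by
  simp only [armObs]
  rw [inner_toEuclideanLin, ← dotProduct_ofLp, ← dotProduct_ofLp, WithLp.ofLp_add,
    Matrix.toLpLin_apply, Matrix.mulVec_add, dotProduct_add]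
  simp only [Matrix.dotProduct_mulVec, Matrix.mulVec_transpose]
  ring

theorem inner_residual (z : EuclideanSpace ℝ (Fin d) × EuclideanSpace ℝ (Fin d) × ℝ) :
    (p.armObs z).2 =
      inner ℝ (p.mu - WithLp.toLp 2 (p.Aᵀ *ᵥ (p.Dᵀ *ᵥ p.mu.ofLp))) z.1 +
        (inner ℝ (-WithLp.toLp 2 (p.Dᵀ *ᵥ p.mu.ofLp)) z.2.1 + 1 * z.2.2) := by
  have h := inner_context (p := p) p.mu z
  have h2 : (p.armObs z).2 = inner ℝ p.mu z.1 + z.2.2 - inner ℝ p.mu (p.armObs z).1 := by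
    simp only [armObs, real_inner_comm]
  rw [h2, h, inner_sub_left, inner_neg_left]
  ring

/-- The transposed normal equation in weak form. With z in the range of Dᵀ it gives the
orthogonality of estimate and residual; with Aᵀz = v it gives the lower variance bound. -/
theorem Admissible.cross (h : p.Admissible) (z v : Fin d → ℝ) :
    (p.Aᵀ *ᵥ z) ⬝ᵥ p.Sx *ᵥ (p.Aᵀ *ᵥ (p.Dᵀ *ᵥ v)) + z ⬝ᵥ p.Sy *ᵥ (p.Dᵀ *ᵥ v) =
      (p.Aᵀ *ᵥ z) ⬝ᵥ p.Sx *ᵥ v := by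
  have hx : p.Sxᵀ = p.Sx := by simpa using h.posDef_x.isHermitian.eq
  have hy : p.Syᵀ = p.Sy := by simpa using h.posDef_y.isHermitian.eq
  have h1 := congrArg Matrix.transpose h.D_mul
  simp only [Matrix.transpose_mul, Matrix.transpose_add, Matrix.transpose_transpose, hx, hy] at h1
  have h2 := congrArg (fun M => z ⬝ᵥ M *ᵥ v) h1
  simp only [← Matrix.mulVec_mulVec, Matrix.add_mulVec, dotProduct_add] at h2
  have h3 : ∀ w, z ⬝ᵥ p.A *ᵥ w = (p.Aᵀ *ᵥ z) ⬝ᵥ w := fun w => by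
    rw [Matrix.dotProduct_mulVec, Matrix.mulVec_transpose]
  simp only [h3] at h2
  exact h2

theorem dotProduct_self_nonneg' (v : Fin d → ℝ) : 0 ≤ v ⬝ᵥ v :=
  Finset.sum_nonneg fun _ _ => mul_self_nonneg _

theorem quad_bounds {S : Matrix (Fin d) (Fin d) ℝ}
    (h : ∀ v, κ⁻¹ * ‖v‖ ^ 2 ≤ inner ℝ v (S.toEuclideanLin v) ∧
      inner ℝ v (S.toEuclideanLin v) ≤ κ * ‖v‖ ^ 2) (v : Fin d → ℝ) :
    κ⁻¹ * (v ⬝ᵥ v) ≤ v ⬝ᵥ S *ᵥ v ∧ v ⬝ᵥ S *ᵥ v ≤ κ * (v ⬝ᵥ v) := by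
  have := h (WithLp.toLp 2 v)
  rw [inner_toEuclideanLin, ← real_inner_self_eq_norm_sq, ← dotProduct_ofLp] at this
  exact this

/-- The singular value bound passes from A to its transpose by duality: for Aᵀz = v and Ay = z one
has z·z = v·y, and ‖y‖ ≤ κ‖z‖. -/
theorem Admissible.exists_transpose_preimage (h : p.Admissible) (hb : p.BoundedBy κ) (hκ : 0 < κ)
    (v : Fin d → ℝ) : ∃ z, p.Aᵀ *ᵥ z = v ∧ z ⬝ᵥ z ≤ κ ^ 2 * (v ⬝ᵥ v) := by
  have hA := h.isUnit_det
  have hAt : IsUnit p.Aᵀ.det := by rwa [Matrix.det_transpose]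
  refine ⟨p.Aᵀ⁻¹ *ᵥ v, ?_, ?_⟩
  · rw [Matrix.mulVec_mulVec, Matrix.mul_nonsing_inv _ hAt, Matrix.one_mulVec]
  set z := p.Aᵀ⁻¹ *ᵥ v with hz
  have hz1 : p.Aᵀ *ᵥ z = v := by
    rw [hz, Matrix.mulVec_mulVec, Matrix.mul_nonsing_inv _ hAt, Matrix.one_mulVec]
  set y := p.A⁻¹ *ᵥ z with hy
  have hy1 : p.A *ᵥ y = z := by
    rw [hy, Matrix.mulVec_mulVec, Matrix.mul_nonsing_inv _ hA, Matrix.one_mulVec]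
  have h1 : z ⬝ᵥ z = v ⬝ᵥ y := by
    conv_lhs => rw [← hy1]
    rw [hy1, ← hz1, ← hy1, Matrix.dotProduct_mulVec, Matrix.mulVec_transpose]
  have h2 : (v ⬝ᵥ y) ^ 2 ≤ (v ⬝ᵥ v) * (y ⬝ᵥ y) := by
    have := Finset.sum_mul_sq_le_sq_mul_sq Finset.univ v y
    simpa only [dotProduct, ← sq] using this
  have h3 := (hb.bound_A (WithLp.toLp 2 y)).1
  have h4 : κ⁻¹ ^ 2 * (y ⬝ᵥ y) ≤ z ⬝ᵥ z := by
    have e1 : y ⬝ᵥ y = ‖WithLp.toLp 2 y‖ ^ 2 := by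
      rw [← real_inner_self_eq_norm_sq, ← dotProduct_ofLp]
    have e2 : z ⬝ᵥ z = ‖p.A.toEuclideanLin (WithLp.toLp 2 y)‖ ^ 2 := by
      rw [← real_inner_self_eq_norm_sq, ← dotProduct_ofLp, Matrix.toLpLin_apply, hy1]
    rw [e1, e2, ← mul_pow]
    exact pow_le_pow_left₀ (by positivity) h3 2
  have h5 : y ⬝ᵥ y ≤ κ ^ 2 * (z ⬝ᵥ z) := by
    calc y ⬝ᵥ y = κ ^ 2 * (κ⁻¹ ^ 2 * (y ⬝ᵥ y)) := by field_simp
      _ ≤ _ := by gcongr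
  have hz0 : 0 ≤ z ⬝ᵥ z := dotProduct_self_nonneg' z
  have hv0 : 0 ≤ v ⬝ᵥ v := dotProduct_self_nonneg' v
  rcases hz0.eq_or_lt with h6 | h6
  · rw [← h6]; positivity
  · refine le_of_mul_le_mul_left ?_ h6
    calc (z ⬝ᵥ z) * (z ⬝ᵥ z) = (v ⬝ᵥ y) ^ 2 := by rw [h1]; ring
      _ ≤ (v ⬝ᵥ v) * (y ⬝ᵥ y) := h2
      _ ≤ (v ⬝ᵥ v) * (κ ^ 2 * (z ⬝ᵥ z)) := by gcongr
      _ = _ := by ring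

/-- The variance of the context estimate in a direction. -/
theorem Admissible.context_variance (h : p.Admissible) (hb : p.BoundedBy κ) (hκ : 0 < κ)
    (v : Fin d → ℝ) :
    (κ ^ 3 * (1 + κ ^ 2))⁻¹ * (v ⬝ᵥ v) ≤ (p.Aᵀ *ᵥ (p.Dᵀ *ᵥ v)) ⬝ᵥ p.Sx *ᵥ v ∧
    (p.Aᵀ *ᵥ (p.Dᵀ *ᵥ v)) ⬝ᵥ p.Sx *ᵥ v ≤ v ⬝ᵥ p.Sx *ᵥ v := by
  set w := p.Dᵀ *ᵥ v with hw
  set u := p.Aᵀ *ᵥ w with hu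
  have hq := h.cross w v
  rw [← hw, ← hu] at hq
  have hsx := h.posDef_x.dotProduct_mulVec_comm u v
  constructor
  · obtain ⟨z, hz, hz2⟩ := h.exists_transpose_preimage hb hκ v
    have hc := h.cross z v
    rw [← hw, ← hu, hz] at hc
    have hsy := h.posDef_y.dotProduct_mulVec_comm w z
    -- The variance is the energy of the pair (u, w), bounded below by testing against s·(v, z):
    -- energy ≥ 2s·pairing − s²·energy of (v, z). This s maximizes 2s/κ − s²κ(1 + κ²), the bound per
    -- unit of v·v.
    set s := (κ ^ 2 * (1 + κ ^ 2))⁻¹ with hs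
    have h1 := h.posDef_x.quad_nonneg (u - s • v)
    have h2 := h.posDef_y.quad_nonneg (w - s • z)
    simp only [Matrix.mulVec_sub, Matrix.mulVec_smul, dotProduct_sub, sub_dotProduct,
      dotProduct_smul, smul_dotProduct, smul_eq_mul] at h1 h2
    have h3 := quad_bounds hb.bound_x v
    have h4 := quad_bounds hb.bound_y z
    have hv0 : 0 ≤ v ⬝ᵥ v := dotProduct_self_nonneg' v
    have hs0 : 0 < s := by positivity
    have h5 : 2 * s * (v ⬝ᵥ p.Sx *ᵥ v) - s ^ 2 * (v ⬝ᵥ p.Sx *ᵥ v + z ⬝ᵥ p.Sy *ᵥ z) ≤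
        u ⬝ᵥ p.Sx *ᵥ v := by
      nlinarith
    refine le_trans ?_ h5
    have h6 : v ⬝ᵥ p.Sx *ᵥ v + z ⬝ᵥ p.Sy *ᵥ z ≤ κ * (1 + κ ^ 2) * (v ⬝ᵥ v) := by
      have := mul_le_mul_of_nonneg_left hz2 hκ.le
      nlinarith [h3.2, h4.2]
    have h7 : (κ ^ 3 * (1 + κ ^ 2))⁻¹ * (v ⬝ᵥ v) =
        2 * s * (κ⁻¹ * (v ⬝ᵥ v)) - s ^ 2 * (κ * (1 + κ ^ 2) * (v ⬝ᵥ v)) := by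
      rw [hs]; field_simp; ring
    rw [h7]
    have h8 := mul_le_mul_of_nonneg_left h6 (sq_nonneg s)
    have h9 := mul_le_mul_of_nonneg_left h3.1 (by positivity : 0 ≤ 2 * s)
    linarith
  · have h1 := h.posDef_x.quad_nonneg (v - u)
    have h2 := h.posDef_y.quad_nonneg w
    simp only [Matrix.mulVec_sub, dotProduct_sub, sub_dotProduct] at h1
    linarith

/-- The joint law of the context, the output noise and the reward noise of an arm. -/
def armLaw (p : Params d) :
    Measure (EuclideanSpace ℝ (Fin d) × EuclideanSpace ℝ (Fin d) × ℝ) :=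
  (multivariateGaussian 0 p.Sx).prod
    ((multivariateGaussian 0 p.Sy).prod (gaussianReal 0 ⟨p.sigma ^ 2, sq_nonneg _⟩))

/-- Estimate and residual are jointly Gaussian and uncorrelated, hence independent. From here on the
unobserved contexts play no role. -/
theorem Admissible.law_armObs (h : p.Admissible) (hb : p.BoundedBy κ) (hκ : 0 < κ) :
    ∃ (ν : Measure (EuclideanSpace ℝ (Fin d))) (v : NNReal),
      IsCenteredGaussian ν (κ ^ 3 * (1 + κ ^ 2))⁻¹ κ ∧ (v : ℝ) ≤ κ * ‖p.mu‖ ^ 2 + κ ∧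
      MeasurePreserving p.armObs p.armLaw (ν.prod (gaussianReal 0 v)) := by
  set Q := p.armLaw with hQ
  have hG : IsGaussian Q := isGaussian_prod_multivariateGaussian _ _ _
  have hxs := h.posDef_x.posSemidef
  have hys := h.posDef_y.posSemidef
  have hcov := covariance_prod_multivariateGaussian hxs hys ⟨p.sigma ^ 2, sq_nonneg _⟩
  change ∀ a b a' b' c c', cov[_, _; Q] = _ at hcov
  let L : (EuclideanSpace ℝ (Fin d) × EuclideanSpace ℝ (Fin d) × ℝ) →ₗ[ℝ]
      (EuclideanSpace ℝ (Fin d) × ℝ) :=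
    { toFun := p.armObs
      map_add' := fun z z' => by
        simp only [armObs, Prod.fst_add, Prod.snd_add, map_add, inner_add_left, Prod.mk_add_mk,
          Prod.mk.injEq]
        constructor
        · abel
        · ring
      map_smul' := fun c z => by
        simp only [armObs, Prod.smul_fst, Prod.smul_snd, map_add, map_smul, inner_add_left,
          inner_smul_left, Prod.smul_mk, Prod.mk.injEq, smul_add, smul_eq_mul, RingHom.id_apply,
          conj_trivial]
        refine ⟨trivial, by ring⟩ }
  have hL : (⇑(LinearMap.toContinuousLinearMap L) : _ → _) = p.armObs := rfl
  have hlaw : HasGaussianLaw p.armObs Q := by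
    rw [← hL]
    exact (IsGaussian.hasGaussianLaw_id (μ := Q)).map (LinearMap.toContinuousLinearMap L)
  have hmeas : Measurable p.armObs := by
    rw [← hL]; exact (LinearMap.toContinuousLinearMap L).continuous.measurable
  have hlaw' : HasGaussianLaw (fun z => ((p.armObs z).1, (p.armObs z).2)) Q := hlaw
  have hX := hlaw'.fst
  have hη := hlaw'.snd
  have hind : IndepFun (fun z => (p.armObs z).1) (fun z => (p.armObs z).2) Q := by
    refine hlaw'.indepFun_of_covariance_inner fun v r => ?_
    have e1 : (fun z => (inner ℝ r (p.armObs z).2 : ℝ)) = fun z => r * (p.armObs z).2 := by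
      ext z; simp [mul_comm]
    rw [e1, covariance_const_mul_right]
    simp_rw [inner_context, inner_residual]
    rw [hcov]
    have := h.cross (p.Dᵀ *ᵥ v.ofLp) p.mu.ofLp
    simp only [WithLp.ofLp_sub, WithLp.ofLp_neg, Matrix.mulVec_sub, Matrix.mulVec_neg,
      dotProduct_sub, dotProduct_neg]
    rw [← this]
    ring
  have hηvar : Var[fun z => (p.armObs z).2; Q] ≤ κ * ‖p.mu‖ ^ 2 + κ := by
    rw [← covariance_self hη.aemeasurable]
    simp_rw [inner_residual]
    rw [hcov]
    have h1 := h.cross (p.Dᵀ *ᵥ p.mu.ofLp) p.mu.ofLp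
    have h2 := h.context_variance hb hκ p.mu.ofLp
    have h3 := (hb.bound_x p.mu).2
    rw [inner_toEuclideanLin] at h3
    have h4 := h.posDef_x.dotProduct_mulVec_comm p.mu.ofLp (p.Aᵀ *ᵥ (p.Dᵀ *ᵥ p.mu.ofLp))
    have h5 : 0 ≤ (κ ^ 3 * (1 + κ ^ 2))⁻¹ * (p.mu.ofLp ⬝ᵥ p.mu.ofLp) :=
      mul_nonneg (by positivity) (dotProduct_self_nonneg' _)
    have h6 := hb.bound_sigma
    simp only [WithLp.ofLp_sub, WithLp.ofLp_neg, Matrix.mulVec_sub, Matrix.mulVec_neg,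
      dotProduct_sub, dotProduct_neg, sub_dotProduct, neg_dotProduct]
    change _ + (_ + 1 * 1 * p.sigma ^ 2) ≤ _
    linarith [h2.1]
  have hηmean : ∫ z, (p.armObs z).2 ∂Q = 0 := by
    simp_rw [inner_residual]
    exact integral_prod_multivariateGaussian _ _ _ _ _ _
  have hXmean : ∫ z, (p.armObs z).1 ∂Q = 0 := by
    refine ext_inner_left ℝ fun v => ?_
    rw [← _root_.integral_inner (𝕜 := ℝ) hX.integrable v, inner_zero_right]
    simp_rw [inner_context]
    exact integral_prod_multivariateGaussian _ _ _ _ _ _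
  have hηlaw : Q.map (fun z => (p.armObs z).2) =
      gaussianReal 0 (Var[fun z => (p.armObs z).2; Q]).toNNReal := by
    rw [hη.map_eq_gaussianReal, hηmean]
  refine ⟨Q.map (fun z => (p.armObs z).1), (Var[fun z => (p.armObs z).2; Q]).toNNReal, ?_, ?_, ?_⟩
  · have hg := hX.isGaussian_map
    have hc : ∀ v, covarianceBilin (Q.map fun z => (p.armObs z).1) v v =
        (p.Aᵀ *ᵥ (p.Dᵀ *ᵥ v.ofLp)) ⬝ᵥ p.Sx *ᵥ v.ofLp := fun v => by
      rw [covarianceBilin_apply_eq_cov IsGaussian.memLp_two_id, covariance_map (by fun_prop)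
        (by fun_prop) hX.aemeasurable]
      have : ((fun u => (inner ℝ v u : ℝ)) ∘ fun z => (p.armObs z).1) =
        fun z => inner ℝ v (p.armObs z).1 := rfl
      rw [this]
      simp_rw [inner_context]
      rw [hcov, ← h.cross (p.Dᵀ *ᵥ v.ofLp) v.ofLp]
      ring
    have hn : ∀ v : EuclideanSpace ℝ (Fin d), v.ofLp ⬝ᵥ v.ofLp = ‖v‖ ^ 2 := fun v => by
      rw [dotProduct_ofLp, real_inner_self_eq_norm_sq]
    refine ⟨hg, ?_, fun v => ?_, fun v => ?_⟩
    · rw [integral_map hX.aemeasurable (by fun_prop)]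
      exact hXmean
    · rw [hc, ← hn]
      exact (h.context_variance hb hκ v.ofLp).1
    · rw [hc, ← hn]
      exact (h.context_variance hb hκ v.ofLp).2.trans (quad_bounds hb.bound_x v.ofLp).2
  · rw [Real.coe_toNNReal _ (variance_nonneg _ _)]
    exact hηvar
  · refine ⟨hmeas, ?_⟩
    rw [← hηlaw]
    exact (indepFun_iff_map_prod_eq_prod_map_map hX.aemeasurable hη.aemeasurable).1 hind

end Params
end Observation

/-! ### The posterior as a Markov kernel. -/

section Posterior

variable {d : ℕ}

/-- The Borel σ-algebra of a space of matrices. -/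
abbrev matrixMeasurableSpace (d : ℕ) : MeasurableSpace (Matrix (Fin d) (Fin d) ℝ) :=
  inferInstanceAs (MeasurableSpace (Fin d → Fin d → ℝ))

attribute [local instance] matrixMeasurableSpace

theorem borelSpace_matrix : BorelSpace (Matrix (Fin d) (Fin d) ℝ) :=
  inferInstanceAs (BorelSpace (Fin d → Fin d → ℝ))

theorem polishSpace_matrix : PolishSpace (Matrix (Fin d) (Fin d) ℝ) :=
  inferInstanceAs (PolishSpace (Fin d → Fin d → ℝ))

attribute [local instance] borelSpace_matrix polishSpace_matrix

theorem measurable_matrix_of {X : Type*} [MeasurableSpace X] {f : X → Matrix (Fin d) (Fin d) ℝ}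
    (h : ∀ i j, Measurable fun x => f x i j) : Measurable f :=
  measurable_pi_lambda _ fun i => measurable_pi_lambda _ fun j => h i j

theorem measurable_matrix_entry (i j : Fin d) :
    Measurable fun M : Matrix (Fin d) (Fin d) ℝ => M i j :=
  (measurable_pi_apply j).comp (measurable_pi_apply i)

theorem measurable_matrix_inv : Measurable fun M : Matrix (Fin d) (Fin d) ℝ => M⁻¹ := by
  refine measurable_matrix_of fun i j => ?_
  have h : (fun M : Matrix (Fin d) (Fin d) ℝ => M⁻¹ i j) = fun M => M.det⁻¹ * M.adjugate i j := by
    ext M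
    rw [Matrix.inv_def, Matrix.smul_apply, Ring.inverse_eq_inv, smul_eq_mul]
  rw [h]
  have h1 : Measurable fun M : Matrix (Fin d) (Fin d) ℝ => M.det :=
    (continuous_id.matrix_det).measurable
  have h2 : Continuous fun M : Matrix (Fin d) (Fin d) ℝ => M.adjugate i j :=
    (continuous_id.matrix_adjugate).matrix_elem i j
  exact h1.inv.mul h2.measurable

-- On the cone of positive semidefinite matrices the square root inverts the continuous injective
-- squaring map, so preimages are images of Borel sets under it and are Borel by the Lusin–Souslin
-- theorem. Off the cone the square root is 0 by convention.
open scoped MatrixOrder in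
theorem measurable_matrix_sqrt :
    Measurable fun M : Matrix (Fin d) (Fin d) ℝ => CFC.sqrt M := by
  classical
  intro t ht
  set C : Set (Matrix (Fin d) (Fin d) ℝ) := {M | 0 ≤ M} with hC
  have hCm : MeasurableSet C := by
    have : C = {M | Mᵀ = M} ∩ ⋂ x : Fin d → ℝ, {M | 0 ≤ x ⬝ᵥ M *ᵥ x} := by
      ext M
      rw [hC, Set.mem_ofPred_eq, Matrix.nonneg_iff_posSemidef, Matrix.posSemidef_iff_dotProduct_mulVec]
      simp [Matrix.IsHermitian]
    rw [this]
    refine (IsClosed.inter (isClosed_eq continuous_id.matrix_transpose continuous_id)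
      (isClosed_iInter fun x => isClosed_le continuous_const ?_)).measurableSet
    exact continuous_const.dotProduct (continuous_id.matrix_mulVec continuous_const)
  have h1 : (fun M : Matrix (Fin d) (Fin d) ℝ => CFC.sqrt M) ⁻¹' t ∩ C =
      (fun M => M * M) '' (t ∩ C) := by
    ext M
    constructor
    · rintro ⟨hM, hM0⟩
      exact ⟨CFC.sqrt M, ⟨hM, CFC.sqrt_nonneg M⟩, CFC.sqrt_mul_sqrt_self M hM0⟩
    · rintro ⟨R, ⟨hR, hR0⟩, rfl⟩
      have hR0' : (0 : Matrix (Fin d) (Fin d) ℝ) ≤ R := hR0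
      refine ⟨?_, ?_⟩
      · rw [Set.mem_preimage]
        simp only
        rwa [CFC.sqrt_mul_self R hR0']
      · have := (IsSelfAdjoint.of_nonneg hR0').mul_self_nonneg
        exact this
  have h2 : MeasurableSet ((fun M : Matrix (Fin d) (Fin d) ℝ => CFC.sqrt M) ⁻¹' t ∩ C) := by
    rw [h1]
    refine (ht.inter hCm).image_of_continuousOn_injOn
      (continuous_id.matrix_mul continuous_id).continuousOn ?_
    rintro R ⟨-, hR⟩ R' ⟨-, hR'⟩ h
    have hR0 : (0 : Matrix (Fin d) (Fin d) ℝ) ≤ R := hR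
    have hR0' : (0 : Matrix (Fin d) (Fin d) ℝ) ≤ R' := hR'
    simp only at h
    rw [← CFC.sqrt_mul_self R hR0, h, CFC.sqrt_mul_self R' hR0']
  have h3 : (fun M : Matrix (Fin d) (Fin d) ℝ => CFC.sqrt M) ⁻¹' t ∩ Cᶜ =
      (if (0 : Matrix (Fin d) (Fin d) ℝ) ∈ t then Cᶜ else ∅) := by
    ext M
    by_cases hM : M ∈ Cᶜ
    · have : CFC.sqrt M = 0 := CFC.sqrt_of_not_nonneg hM
      split_ifs with h0 <;> simp_all
    · split_ifs with h0 <;> simp_all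
  have h4 : MeasurableSet ((fun M : Matrix (Fin d) (Fin d) ℝ => CFC.sqrt M) ⁻¹' t ∩ Cᶜ) := by
    rw [h3]
    split_ifs
    · exact hCm.compl
    · exact MeasurableSet.empty
  rw [← Set.inter_union_compl ((fun M : Matrix (Fin d) (Fin d) ℝ => CFC.sqrt M) ⁻¹' t) C]
  exact h2.union h4

theorem measurable_matrix_mulVec {X : Type*} [MeasurableSpace X]
    {f : X → Matrix (Fin d) (Fin d) ℝ} {g : X → EuclideanSpace ℝ (Fin d)} (hf : Measurable f)
    (hg : Measurable g) : Measurable fun x => WithLp.toLp 2 (f x *ᵥ (g x).ofLp) := by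
  refine (PiLp.continuous_toLp 2 _).measurable.comp (measurable_pi_lambda _ fun i => ?_)
  simp only [Matrix.mulVec, dotProduct]
  refine Finset.measurable_sum _ fun j _ => ?_
  exact ((measurable_matrix_entry i j).comp hf).mul
    (((measurable_pi_apply j).comp (PiLp.continuous_ofLp 2 _).measurable).comp hg)

open scoped MatrixOrder in
/-- The Gaussian posterior as a function of the precision matrix and the mean. -/
def posterior (d : ℕ) :
    Kernel (Matrix (Fin d) (Fin d) ℝ × EuclideanSpace ℝ (Fin d)) (EuclideanSpace ℝ (Fin d)) where
  toFun z := multivariateGaussian z.2 z.1⁻¹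
  measurable' := by
    refine Measure.measurable_of_measurable_coe _ fun s hs => ?_
    set F : (Matrix (Fin d) (Fin d) ℝ × EuclideanSpace ℝ (Fin d)) × EuclideanSpace ℝ (Fin d) →
      EuclideanSpace ℝ (Fin d) := fun q =>
        q.1.2 + WithLp.toLp 2 (CFC.sqrt (q.1.1⁻¹) *ᵥ q.2.ofLp) with hF
    have hFm : Measurable F :=
      (measurable_snd.comp measurable_fst).add (measurable_matrix_mulVec
        ((measurable_matrix_sqrt.comp measurable_matrix_inv).comp
          (measurable_fst.comp measurable_fst)) measurable_snd)
    have h : ∀ z : Matrix (Fin d) (Fin d) ℝ × EuclideanSpace ℝ (Fin d),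
        multivariateGaussian z.2 z.1⁻¹ s =
          stdGaussian (EuclideanSpace ℝ (Fin d)) (Prod.mk z ⁻¹' (F ⁻¹' s)) := fun z => by
      have h0 : (fun x => z.2 + Matrix.toEuclideanCLM (𝕜 := ℝ) (CFC.sqrt z.1⁻¹) x) =
        fun x => F (z, x) := rfl
      have h1 : Measurable fun x => F (z, x) := hFm.comp measurable_prodMk_left
      rw [multivariateGaussian, h0, Measure.map_apply h1 hs]
      rfl
    simp only [h]
    exact measurable_measure_prodMk_left (hFm hs)

instance (d : ℕ) : IsMarkovKernel (posterior d) :=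
  ⟨fun z => by change IsProbabilityMeasure (multivariateGaussian z.2 z.1⁻¹); infer_instance⟩

end Posterior

/-! ### From conditional laws to iterated integrals. -/

section Disintegration

/-- The defining property of conditional expectation gives equality on rectangles, which determine a
measure on the product. -/
theorem map_eq_compProd_of_condLaw {Ω X E : Type*} {m m₀ : MeasurableSpace Ω} [MeasurableSpace X]
    [MeasurableSpace E] {P : Measure Ω} [IsProbabilityMeasure P] (hm : m ≤ m₀) {Y : Ω → X}
    (hY : Measurable[m] Y) {U : Ω → E} (hU : Measurable U) {K : Kernel X E} [IsMarkovKernel K]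
    (h : ∀ s, MeasurableSet s → P⟦U ⁻¹' s | m⟧ =ᵐ[P] fun ω => (K (Y ω)).real s) :
    P.map (fun ω => (Y ω, U ω)) = (P.map Y) ⊗ₘ K := by
  have hY' : Measurable Y := hY.mono hm le_rfl
  have : IsProbabilityMeasure (P.map Y) := Measure.isProbabilityMeasure_map hY'.aemeasurable
  have : IsProbabilityMeasure (P.map fun ω => (Y ω, U ω)) :=
    Measure.isProbabilityMeasure_map (hY'.prodMk hU).aemeasurable
  refine Measure.ext_prod fun {s t} hs ht => ?_
  rw [Measure.map_apply (hY'.prodMk hU) (hs.prod ht), Measure.compProd_apply_prod hs ht,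
    setLIntegral_map hs (K.measurable_coe ht) hY']
  have hKm : Measurable fun ω => K (Y ω) t := (K.measurable_coe ht).comp hY'
  have h1 : ∫ ω in Y ⁻¹' s, (U ⁻¹' t).indicator (fun _ => (1 : ℝ)) ω ∂P =
      ∫ ω in Y ⁻¹' s, (K (Y ω)).real t ∂P := by
    rw [← setIntegral_condExp hm ((integrable_const (1 : ℝ)).indicator (hU ht)) (hY hs)]
    exact integral_congr_ae (ae_restrict_of_ae (h t ht))
  rw [integral_indicator_const _ (hU ht), smul_eq_mul, mul_one] at h1
  have h2 : ∫ ω in Y ⁻¹' s, (K (Y ω)).real t ∂P =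
      (∫⁻ ω in Y ⁻¹' s, K (Y ω) t ∂P).toReal :=
    integral_toReal hKm.aemeasurable (ae_of_all _ fun ω => measure_lt_top _ _)
  rw [h2, Measure.real, Measure.restrict_apply (hU ht)] at h1
  have h3 : ∫⁻ ω in Y ⁻¹' s, K (Y ω) t ∂P ≠ ⊤ := by
    refine ne_top_of_le_ne_top (b := 1) ENNReal.one_ne_top ?_
    calc ∫⁻ ω in Y ⁻¹' s, K (Y ω) t ∂P ≤ ∫⁻ ω, 1 ∂P :=
          (setLIntegral_le_lintegral _ _).trans (lintegral_mono fun ω => prob_le_one)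
      _ = 1 := by simp
  have h4 := (ENNReal.toReal_eq_toReal_iff' (measure_ne_top P _) h3).1 h1
  rw [← h4]
  congr 1
  ext ω
  simp [and_comm]

/-- Z is the state before a round, y the fresh data and U the sample. Since the conditional law of U
depends on Z only, U and y are independent given Z and their integrals may be taken in either order;
the data come innermost because the one-round estimates fix the sampled direction first. -/
theorem lintegral_of_condLaw {Ω X Y E : Type*} {mp me m₀ : MeasurableSpace Ω} [MeasurableSpace X]
    [MeasurableSpace Y] [MeasurableSpace E] {P : Measure Ω} [IsProbabilityMeasure P]
    (hmp : mp ≤ m₀) (hme : me ≤ m₀) (hind : Indep me mp P) {Z : Ω → X} (hZ : Measurable[mp] Z)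
    {y : Ω → Y} (hy : Measurable[me] y) {U : Ω → E} (hU : Measurable U) {K : Kernel X E}
    [IsMarkovKernel K]
    (h : ∀ s, MeasurableSet s → P⟦U ⁻¹' s | mp ⊔ me⟧ =ᵐ[P] fun ω => (K (Z ω)).real s)
    {f : X × Y × E → ENNReal} (hf : Measurable f) :
    ∫⁻ ω, f (Z ω, y ω, U ω) ∂P =
      ∫⁻ ω, ∫⁻ u, ∫⁻ v, f (Z ω, v, u) ∂(P.map y) ∂(K (Z ω)) ∂P := by
  have hZ' : Measurable Z := hZ.mono hmp le_rfl
  have hy' : Measurable y := hy.mono hme le_rfl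
  have : IsProbabilityMeasure (P.map y) := Measure.isProbabilityMeasure_map hy'.aemeasurable
  have : IsProbabilityMeasure (P.map Z) := Measure.isProbabilityMeasure_map hZ'.aemeasurable
  have hYm : Measurable[mp ⊔ me] fun ω => (Z ω, y ω) :=
    (hZ.mono le_sup_left le_rfl).prodMk (hy.mono le_sup_right le_rfl)
  have h1 := map_eq_compProd_of_condLaw (K := K.comap (Prod.fst : X × Y → X) measurable_fst)
    (sup_le hmp hme) hYm hU h
  have h2 : P.map (fun ω => (Z ω, y ω)) = (P.map Z).prod (P.map y) := by
    refine (indepFun_iff_map_prod_eq_prod_map_map hZ'.aemeasurable hy'.aemeasurable).1 ?_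
    rw [IndepFun_iff_Indep]
    exact (indep_of_indep_of_le_left (indep_of_indep_of_le_right hind hZ.comap_le) hy.comap_le).symm
  have hf' : Measurable fun q : (X × Y) × E => f (q.1.1, q.1.2, q.2) := by fun_prop
  calc ∫⁻ ω, f (Z ω, y ω, U ω) ∂P
      = ∫⁻ q, f (q.1.1, q.1.2, q.2) ∂(P.map fun ω => ((Z ω, y ω), U ω)) := by
        rw [lintegral_map hf' ((hZ'.prodMk hy').prodMk hU)]
    _ = ∫⁻ a, ∫⁻ b, ∫⁻ u, f (a, b, u) ∂(K a) ∂(P.map y) ∂(P.map Z) := by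
        rw [h1, Measure.lintegral_compProd hf', h2]
        rw [lintegral_prod _ (Measurable.aemeasurable ?_)]
        · rfl
        · exact Measurable.lintegral_kernel_prod_right' hf'
    _ = ∫⁻ a, ∫⁻ u, ∫⁻ b, f (a, b, u) ∂(P.map y) ∂(K a) ∂(P.map Z) := by
        refine lintegral_congr fun a => ?_
        rw [lintegral_lintegral_swap]
        exact Measurable.aemeasurable (by fun_prop)
    _ = _ := by
        rw [lintegral_map _ hZ']
        have : Measurable fun q : X × E => ∫⁻ b, f (q.1, b, q.2) ∂(P.map y) := by
          refine Measurable.lintegral_prod_right' (f := fun r : (X × E) × Y => f (r.1.1, r.2, r.1.2)) ?_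
          fun_prop
        exact Measurable.lintegral_kernel_prod_right' this

end Disintegration

/-! ### Recursions for the posterior and the law of one round. -/

section History

attribute [local instance] matrixMeasurableSpace borelSpace_matrix polishSpace_matrix

variable {d N : ℕ} {Ω : Type*} {p : Params d}
  {sel : (Fin N → EuclideanSpace ℝ (Fin d)) → EuclideanSpace ℝ (Fin d) → Fin N}

namespace Interaction

variable {I : Interaction d N Ω}

/-- The context estimates of a round and their residuals in the rewards. -/
def obs (I : Interaction d N Ω) (p : Params d) (t : ℕ) (ω : Ω) :
    Fin N → EuclideanSpace ℝ (Fin d) × ℝ :=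
  fun i => p.armObs (I.armEnv t i ω)

theorem fst_obs (t : ℕ) (ω : Ω) (i : Fin N) : (I.obs p t ω i).1 = I.xHat p t i ω := rfl

theorem reward_eq (t : ℕ) (ω : Ω) (i : Fin N) :
    I.reward p t i ω = inner ℝ (I.obs p t ω i).1 p.mu + (I.obs p t ω i).2 := by
  simp only [obs, reward, armEnv, Params.armObs]
  ring

variable (sel) in
/-- The observation belonging to the arm that a direction selects. -/
def select (z : Fin N → EuclideanSpace ℝ (Fin d) × ℝ) (m : EuclideanSpace ℝ (Fin d)) :
    EuclideanSpace ℝ (Fin d) × ℝ :=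
  z (sel (fun i => (z i).1) m)

theorem measurable_select (hs : IsArgmaxRule sel) : Measurable fun q : (Fin N →
    EuclideanSpace ℝ (Fin d) × ℝ) × EuclideanSpace ℝ (Fin d) => select sel q.1 q.2 := by
  have h1 : Measurable fun q : Fin N × (Fin N → EuclideanSpace ℝ (Fin d) × ℝ) => q.2 q.1 :=
    measurable_from_prod_countable_right fun i => measurable_pi_apply i
  have h2 : Measurable fun q : (Fin N → EuclideanSpace ℝ (Fin d) × ℝ) × EuclideanSpace ℝ (Fin d) =>
      ((fun i => (q.1 i).1), q.2) := by fun_prop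
  exact h1.comp ((hs.measurable.comp h2).prodMk measurable_fst)

theorem select_obs (t : ℕ) (ω : Ω) :
    select sel (I.obs p t ω) (I.muTilde t ω) = I.obs p t ω (I.arm sel p t ω) := rfl

theorem B_succ (t : ℕ) (ω : Ω) :
    I.B sel p (t + 1) ω = I.B sel p t ω +
      vecMulVec (select sel (I.obs p t ω) (I.muTilde t ω)).1.ofLp
        (select sel (I.obs p t ω) (I.muTilde t ω)).1.ofLp := by
  simp only [B, Finset.sum_range_succ, ← add_assoc]
  rfl

theorem posDef_B (h : p.Admissible) (t : ℕ) (ω : Ω) : (I.B sel p t ω).PosDef := by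
  induction t with
  | zero => simpa [B] using h.posDef_0.inv
  | succ t ih =>
    rw [B_succ]
    exact ih.add_vecMulVec_self _

/-- The error of the posterior mean. -/
def err (I : Interaction d N Ω)
    (sel : (Fin N → EuclideanSpace ℝ (Fin d)) → EuclideanSpace ℝ (Fin d) → Fin N) (p : Params d)
    (t : ℕ) (ω : Ω) : EuclideanSpace ℝ (Fin d) :=
  I.muHat sel p t ω - p.mu

theorem B_mulVec_muHat (h : p.Admissible) (t : ℕ) (ω : Ω) :
    I.B sel p t ω *ᵥ (I.muHat sel p t ω).ofLp =
      (∑ τ ∈ Finset.range t,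
        I.reward p τ (I.arm sel p τ ω) ω • I.xHat p τ (I.arm sel p τ ω) ω).ofLp := by
  rw [muHat, Matrix.toLpLin_apply]
  exact (posDef_B h t ω).mulVec_inv_mulVec _

/-- The part ⟨x, μ⟩x of the new observation equals (xxᵀ)μ and cancels against the update of the
precision matrix, so only the residual drives the error. -/
theorem B_mulVec_err_succ (h : p.Admissible) (t : ℕ) (ω : Ω) :
    I.B sel p (t + 1) ω *ᵥ (I.err sel p (t + 1) ω).ofLp =
      I.B sel p t ω *ᵥ (I.err sel p t ω).ofLp +
        (select sel (I.obs p t ω) (I.muTilde t ω)).2 •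
          (select sel (I.obs p t ω) (I.muTilde t ω)).1.ofLp := by
  simp only [err, WithLp.ofLp_sub, Matrix.mulVec_sub, B_mulVec_muHat h, Finset.sum_range_succ,
    WithLp.ofLp_add]
  rw [B_succ, Matrix.add_mulVec, Matrix.vecMulVec_mulVec, reward_eq, ← select_obs (sel := sel),
    WithLp.ofLp_smul, ← fst_obs, ← select_obs (sel := sel), dotProduct_ofLp, add_smul]
  simp only [op_smul_eq_smul]
  abel

theorem quad_err_succ (h : p.Admissible) (t : ℕ) (ω : Ω) :
    (I.err sel p (t + 1) ω).ofLp ⬝ᵥ I.B sel p (t + 1) ω *ᵥ (I.err sel p (t + 1) ω).ofLp =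
      nextError (I.B sel p t ω) (I.err sel p t ω)
        (select sel (I.obs p t ω) (I.muTilde t ω)).1
        (select sel (I.obs p t ω) (I.muTilde t ω)).2 := by
  have h1 := B_mulVec_err_succ (I := I) (sel := sel) h t ω
  rw [B_succ] at h1 ⊢
  rw [(posDef_B h t ω).quad_rankOne_update _ _ _ _ h1, nextError, infoGain,
    dotProduct_ofLp _ (I.err sel p t ω)]

theorem det_B_succ (h : p.Admissible) (t : ℕ) (ω : Ω) :
    Real.log (I.B sel p (t + 1) ω).det = Real.log (I.B sel p t ω).det +
      Real.log (1 + infoGain (I.B sel p t ω)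
        (select sel (I.obs p t ω) (I.muTilde t ω)).1) := by
  have hB := posDef_B (I := I) (sel := sel) h t ω
  have := infoGain_nonneg hB (select sel (I.obs p t ω) (I.muTilde t ω)).1
  rw [B_succ, hB.det_add_vecMulVec_self, Real.log_mul hB.det_pos.ne' (by
    change 1 + infoGain (I.B sel p t ω) _ ≠ 0
    positivity), infoGain]

theorem trace_B_succ (t : ℕ) (ω : Ω) :
    (I.B sel p (t + 1) ω).trace = (I.B sel p t ω).trace +
      ‖(select sel (I.obs p t ω) (I.muTilde t ω)).1‖ ^ 2 := by
  rw [B_succ, Matrix.trace_add, Matrix.trace_vecMulVec, dotProduct_ofLp, real_inner_self_eq_norm_sq]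

theorem measurable_armObs : Measurable p.armObs := by
  unfold Params.armObs
  have h : ∀ M : Matrix (Fin d) (Fin d) ℝ, Measurable fun v => M.toEuclideanLin v := fun M =>
    (LinearMap.continuous_of_finiteDimensional _).measurable
  have h1 : Measurable fun z : EuclideanSpace ℝ (Fin d) × EuclideanSpace ℝ (Fin d) × ℝ =>
      p.D.toEuclideanLin (p.A.toEuclideanLin z.1 + z.2.1) :=
    (h _).comp (((h _).comp measurable_fst).add (measurable_fst.comp measurable_snd))
  exact h1.prodMk (((measurable_fst.inner measurable_const).add
    (measurable_snd.comp measurable_snd)).sub (h1.inner measurable_const))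

section Measurability

variable {m : MeasurableSpace Ω}

theorem measurable_obs {t : ℕ} (h : Measurable (I.env t)) : Measurable (I.obs p t) :=
  measurable_pi_lambda _ fun i => measurable_armObs.comp ((measurable_pi_apply i).comp h)

theorem measurable_select_obs (hs : IsArgmaxRule sel) {t : ℕ} (h : Measurable (I.env t))
    (h' : Measurable (I.muTilde t)) :
    Measurable fun ω => select sel (I.obs p t ω) (I.muTilde t ω) :=
  (measurable_select hs).comp ((measurable_obs h).prodMk h')

theorem measurable_B (hs : IsArgmaxRule sel) {t : ℕ} (h : ∀ τ < t, Measurable (I.env τ))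
    (h' : ∀ τ < t, Measurable (I.muTilde τ)) : Measurable (I.B sel p t) := by
  induction t with
  | zero =>
    have : I.B sel p 0 = fun _ => p.S0⁻¹ := by ext; simp [B]
    rw [this]
    exact measurable_const
  | succ t ih =>
    have h1 := ih (fun τ hτ => h τ (hτ.trans t.lt_succ_self))
      (fun τ hτ => h' τ (hτ.trans t.lt_succ_self))
    have h2 := (measurable_select_obs (p := p) hs (h t t.lt_succ_self)
      (h' t t.lt_succ_self)).fst
    refine measurable_matrix_of fun i j => ?_
    simp only [B_succ, Matrix.add_apply, Matrix.vecMulVec_apply]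
    have h3 : ∀ i, Measurable fun ω =>
        (select sel (I.obs p t ω) (I.muTilde t ω)).1.ofLp i := fun i =>
      ((measurable_pi_apply i).comp (PiLp.continuous_ofLp 2 _).measurable).comp h2
    exact ((measurable_matrix_entry i j).comp h1).add ((h3 i).mul (h3 j))

theorem measurable_muHat (hs : IsArgmaxRule sel) {t : ℕ} (h : ∀ τ < t, Measurable (I.env τ))
    (h' : ∀ τ < t, Measurable (I.muTilde τ)) : Measurable (I.muHat sel p t) := by
  refine measurable_matrix_mulVec (measurable_matrix_inv.comp (measurable_B hs h h')) ?_
  refine Finset.measurable_sum _ fun τ hτ => ?_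
  have h1 := measurable_select_obs (p := p) hs (h τ (Finset.mem_range.1 hτ))
    (h' τ (Finset.mem_range.1 hτ))
  have h2 : (fun ω => I.reward p τ (I.arm sel p τ ω) ω • I.xHat p τ (I.arm sel p τ ω) ω) =
      fun ω => (inner ℝ (select sel (I.obs p τ ω) (I.muTilde τ ω)).1 p.mu +
        (select sel (I.obs p τ ω) (I.muTilde τ ω)).2) •
        (select sel (I.obs p τ ω) (I.muTilde τ ω)).1 := by
    ext1 ω
    rw [reward_eq]
    rfl
  rw [h2]
  exact ((h1.fst.inner measurable_const).add h1.snd).smul h1.fst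

end Measurability

namespace IsThompson

variable [mΩ : MeasurableSpace Ω] {P : Measure Ω}

theorem measurable_env (hI : I.IsThompson sel P p) (t : ℕ) : Measurable (I.env t) :=
  measurable_pi_lambda _ fun i =>
    (hI.measurable_x t i).prodMk ((hI.measurable_ey t i).prodMk (hI.measurable_er t i))

theorem past_le (hI : I.IsThompson sel P p) (t : ℕ) : I.past t ≤ mΩ :=
  iSup_le fun τ => sup_le (hI.measurable_env τ).comap_le (hI.measurable_muTilde τ).comap_le

theorem map_obs [IsProbabilityMeasure P] (hI : I.IsThompson sel P p)
    {ν : Measure (EuclideanSpace ℝ (Fin d))} {v : NNReal} [IsProbabilityMeasure ν]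
    (hν : MeasurePreserving p.armObs p.armLaw (ν.prod (gaussianReal 0 v))) (t : ℕ) :
    P.map (I.obs p t) = Measure.pi fun _ => ν.prod (gaussianReal 0 v) := by
  have h1 : iIndepFun (fun i ω => p.armObs (I.armEnv t i ω)) P :=
    (hI.indep_arms t).comp (fun _ => p.armObs) fun _ => measurable_armObs
  have hm : ∀ i, AEMeasurable (I.armEnv t i) P := fun i => (hI.law_armEnv t i).aemeasurable
  have h2 := (iIndepFun_iff_map_fun_eq_pi_map
    fun i => measurable_armObs.comp_aemeasurable (hm i)).1 h1
  change P.map (I.obs p t) = _ at h2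
  rw [h2]
  congr 1
  ext1 i
  rw [← hν.map_eq]
  have h3 : p.armLaw = P.map (I.armEnv t i) := (hI.law_armEnv t i).map_eq.symm
  rw [h3, AEMeasurable.map_map_of_aemeasurable measurable_armObs.aemeasurable (hm i)]

/-- Replaces a round by its model: given the past, a posterior sample and N independent pairs of
estimate and residual. -/
theorem lintegral_round [IsProbabilityMeasure P] (hs : IsArgmaxRule sel)
    (hI : I.IsThompson sel P p)
    {ν : Measure (EuclideanSpace ℝ (Fin d))} {v : NNReal} [IsProbabilityMeasure ν]
    (hν : MeasurePreserving p.armObs p.armLaw (ν.prod (gaussianReal 0 v))) (t : ℕ)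
    {f : (Matrix (Fin d) (Fin d) ℝ × EuclideanSpace ℝ (Fin d)) ×
      (Fin N → EuclideanSpace ℝ (Fin d) × ℝ) × EuclideanSpace ℝ (Fin d) → ENNReal}
    (hf : Measurable f) :
    ∫⁻ ω, f ((I.B sel p t ω, I.muHat sel p t ω), I.obs p t ω, I.muTilde t ω) ∂P =
      ∫⁻ ω, ∫⁻ m, ∫⁻ z, f ((I.B sel p t ω, I.muHat sel p t ω), z, m)
        ∂(Measure.pi fun _ => ν.prod (gaussianReal 0 v))
        ∂(multivariateGaussian (I.muHat sel p t ω) (I.B sel p t ω)⁻¹) ∂P := by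
  have h1 : ∀ τ < t, Measurable[I.past t] (I.env τ) := fun τ hτ =>
    (comap_measurable (I.env τ)).mono (le_sup_left.trans
      (le_iSup (fun τ : Fin t => MeasurableSpace.comap (I.env τ) inferInstance ⊔
        MeasurableSpace.comap (I.muTilde τ) inferInstance) ⟨τ, hτ⟩)) le_rfl
  have h2 : ∀ τ < t, Measurable[I.past t] (I.muTilde τ) := fun τ hτ =>
    (comap_measurable (I.muTilde τ)).mono (le_sup_right.trans
      (le_iSup (fun τ : Fin t => MeasurableSpace.comap (I.env τ) inferInstance ⊔
        MeasurableSpace.comap (I.muTilde τ) inferInstance) ⟨τ, hτ⟩)) le_rfl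
  have hZ : Measurable[I.past t] fun ω => (I.B sel p t ω, I.muHat sel p t ω) :=
    (measurable_B hs h1 h2).prodMk (measurable_muHat hs h1 h2)
  have hy : Measurable[MeasurableSpace.comap (I.env t) inferInstance] (I.obs p t) :=
    measurable_obs (comap_measurable (I.env t))
  have := lintegral_of_condLaw (K := posterior d) (hI.past_le t) (hI.measurable_env t).comap_le
    (hI.indep_past t) hZ hy (hI.measurable_muTilde t) (hI.sample t) hf
  rw [hI.map_obs hν] at this
  exact this

end IsThompson

end Interaction

end History

/-! ### Expected inequalities for a single round. -/

section Rounds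

attribute [local instance] matrixMeasurableSpace borelSpace_matrix polishSpace_matrix

variable {d N : ℕ} {Ω : Type*} {p : Params d} {κ k : ℝ}
  {sel : (Fin N → EuclideanSpace ℝ (Fin d)) → EuclideanSpace ℝ (Fin d) → Fin N}

theorem measurable_infoGain {X : Type*} [MeasurableSpace X] {f : X → Matrix (Fin d) (Fin d) ℝ}
    {g : X → EuclideanSpace ℝ (Fin d)} (hf : Measurable f) (hg : Measurable g) :
    Measurable fun x => infoGain (f x) (g x) := by
  have h : (fun x => infoGain (f x) (g x)) =
      fun x => (inner ℝ (g x) (WithLp.toLp 2 ((f x)⁻¹ *ᵥ (g x).ofLp)) : ℝ) := by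
    ext x
    rw [← dotProduct_ofLp, infoGain]
  rw [h]
  exact hg.inner (measurable_matrix_mulVec (measurable_matrix_inv.comp hf) hg)

namespace Params

theorem Admissible.quad_inv_ge (h : p.Admissible) (hb : p.BoundedBy κ) (hκ : 0 < κ)
    (v : Fin d → ℝ) : κ⁻¹ * (v ⬝ᵥ v) ≤ v ⬝ᵥ p.S0⁻¹ *ᵥ v := by
  have h1 := h.posDef_0.sq_dotProduct_le v v
  have h2 := (quad_bounds hb.bound_0 v).2
  have h3 := h.posDef_0.quad_inv_nonneg v
  rcases (dotProduct_self_nonneg' v).eq_or_lt with h4 | h4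
  · rw [← h4, mul_zero]; exact h3
  · refine le_of_mul_le_mul_left ?_ (mul_pos hκ h4)
    calc κ * (v ⬝ᵥ v) * (κ⁻¹ * (v ⬝ᵥ v)) = (v ⬝ᵥ v) ^ 2 := by field_simp
      _ ≤ _ := h1
      _ ≤ (v ⬝ᵥ p.S0⁻¹ *ᵥ v) * (κ * (v ⬝ᵥ v)) := by gcongr
      _ = _ := by ring

theorem Admissible.quad_inv_le (h : p.Admissible) (hb : p.BoundedBy κ) (hκ : 0 < κ)
    (v : Fin d → ℝ) : v ⬝ᵥ p.S0⁻¹ *ᵥ v ≤ κ * (v ⬝ᵥ v) := by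
  set w := p.S0⁻¹ *ᵥ v with hw
  have h1 : (v ⬝ᵥ w) ^ 2 ≤ (v ⬝ᵥ v) * (w ⬝ᵥ w) := by
    have := Finset.sum_mul_sq_le_sq_mul_sq Finset.univ v w
    simpa only [dotProduct, ← sq] using this
  have h2 := (quad_bounds hb.bound_0 w).1
  rw [hw, h.posDef_0.mulVec_inv_mulVec, ← hw, dotProduct_comm w v] at h2
  have h3 : 0 ≤ v ⬝ᵥ w := h.posDef_0.quad_inv_nonneg v
  have hv := dotProduct_self_nonneg' v
  rcases h3.eq_or_lt with h4 | h4
  · rw [← h4]; positivity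
  · refine le_of_mul_le_mul_left ?_ h4
    have h5 : w ⬝ᵥ w ≤ κ * (v ⬝ᵥ w) := by
      calc w ⬝ᵥ w = κ * (κ⁻¹ * (w ⬝ᵥ w)) := by field_simp
        _ ≤ _ := by gcongr
    calc (v ⬝ᵥ w) * (v ⬝ᵥ w) = (v ⬝ᵥ w) ^ 2 := by ring
      _ ≤ _ := h1
      _ ≤ (v ⬝ᵥ v) * (κ * (v ⬝ᵥ w)) := by gcongr
      _ = _ := by ring

end Params

namespace Interaction

variable {I : Interaction d N Ω}

theorem quad_B_ge (h : p.Admissible) (hb : p.BoundedBy κ) (hκ : 0 < κ) (t : ℕ) (ω : Ω)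
    (v : Fin d → ℝ) : κ⁻¹ * (v ⬝ᵥ v) ≤ v ⬝ᵥ I.B sel p t ω *ᵥ v := by
  induction t with
  | zero => simpa [B] using h.quad_inv_ge hb hκ v
  | succ t ih =>
    rw [B_succ, Matrix.add_mulVec, dotProduct_add, Matrix.vecMulVec_mulVec]
    refine ih.trans (le_add_of_nonneg_right ?_)
    rw [op_smul_eq_smul, dotProduct_smul, smul_eq_mul, dotProduct_comm]
    exact mul_self_nonneg _

/-- The context estimate of the arm selected in a round. -/
def chosen (I : Interaction d N Ω)
    (sel : (Fin N → EuclideanSpace ℝ (Fin d)) → EuclideanSpace ℝ (Fin d) → Fin N) (p : Params d)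
    (t : ℕ) (ω : Ω) : EuclideanSpace ℝ (Fin d) :=
  I.xHat p t (I.arm sel p t ω) ω

/-- The weighted squared error of the posterior mean. -/
def wErr (I : Interaction d N Ω)
    (sel : (Fin N → EuclideanSpace ℝ (Fin d)) → EuclideanSpace ℝ (Fin d) → Fin N) (p : Params d)
    (t : ℕ) (ω : Ω) : ℝ :=
  (I.err sel p t ω).ofLp ⬝ᵥ I.B sel p t ω *ᵥ (I.err sel p t ω).ofLp

/-- The truncated posterior spread. -/
def spread (I : Interaction d N Ω)
    (sel : (Fin N → EuclideanSpace ℝ (Fin d)) → EuclideanSpace ℝ (Fin d) → Fin N) (p : Params d)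
    (t : ℕ) (ω : Ω) : ℝ :=
  min 1 ((I.B sel p t ω)⁻¹.trace + ‖I.err sel p t ω‖ ^ 2)

/-- The log-determinants telescope. The tangent bound `Matrix.PosDef.log_det_le` is used at the free
level a for the last precision matrix and at κ for the initial covariance. -/
theorem sum_log_le (h : p.Admissible) (hb : p.BoundedBy κ) (hκ : 0 < κ) {a : ℝ} (ha : 0 < a)
    (T : ℕ) (ω : Ω) :
    ∑ t ∈ Finset.range T, Real.log (1 + infoGain (I.B sel p t ω) (I.chosen sel p t ω)) ≤
      d * Real.log a + d * Real.log κ +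
        (κ * d + ∑ t ∈ Finset.range T, ‖I.chosen sel p t ω‖ ^ 2) / a := by
  have h1 : Real.log (I.B sel p T ω).det = Real.log (p.S0⁻¹).det +
      ∑ t ∈ Finset.range T, Real.log (1 + infoGain (I.B sel p t ω) (I.chosen sel p t ω)) := by
    induction T with
    | zero => simp [B]
    | succ T ih =>
      rw [det_B_succ h, ih, Finset.sum_range_succ, add_assoc]
      rfl
  have h2 : (I.B sel p T ω).trace = (p.S0⁻¹).trace +
      ∑ t ∈ Finset.range T, ‖I.chosen sel p t ω‖ ^ 2 := by
    clear h1
    induction T with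
    | zero => simp [B]
    | succ T ih =>
      rw [trace_B_succ, ih, Finset.sum_range_succ, add_assoc]
      rfl
  have h3 := (posDef_B (I := I) (sel := sel) h T ω).log_det_le ha
  have h4 : Real.log (p.S0⁻¹).det = - Real.log p.S0.det := by
    rw [Matrix.det_nonsing_inv, Ring.inverse_eq_inv, Real.log_inv]
  have h5 := h.posDef_0.log_det_le hκ
  have hdiag : ∀ (S : Matrix (Fin d) (Fin d) ℝ),
      (∀ v : Fin d → ℝ, v ⬝ᵥ S *ᵥ v ≤ κ * (v ⬝ᵥ v)) → S.trace ≤ κ * d := fun S hS => by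
    have : ∀ i ∈ Finset.univ, S.diag i ≤ κ := fun i _ => by
      have := hS (Pi.single i 1)
      simpa using this
    calc S.trace ≤ ∑ _i : Fin d, κ := Finset.sum_le_sum this
      _ = κ * d := by simp [mul_comm]
  have h6 := hdiag p.S0 fun v => (Params.quad_bounds hb.bound_0 v).2
  have h7 := hdiag p.S0⁻¹ fun v => h.quad_inv_le hb hκ v
  have h8 : p.S0.trace / κ ≤ d := by
    rw [div_le_iff₀ hκ]; linarith
  have h9 : (I.B sel p T ω).trace / a ≤
      (κ * d + ∑ t ∈ Finset.range T, ‖I.chosen sel p t ω‖ ^ 2) / a := by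
    gcongr
    rw [h2]
    linarith
  have h10 : (0 : ℝ) ≤ d := Nat.cast_nonneg d
  linarith

theorem wErr_zero_le (h : p.Admissible) (hb : p.BoundedBy κ) (hκ : 0 < κ) (ω : Ω) :
    I.wErr sel p 0 ω ≤ κ * ‖p.mu‖ ^ 2 := by
  have h1 : I.err sel p 0 ω = -p.mu := by simp [err, muHat]
  have h2 : I.B sel p 0 ω = p.S0⁻¹ := by simp [B]
  rw [wErr, h1, h2, WithLp.ofLp_neg, Matrix.mulVec_neg, neg_dotProduct_neg,
    ← real_inner_self_eq_norm_sq, ← dotProduct_ofLp]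
  exact h.quad_inv_le hb hκ _

theorem norm_sq_err_le (h : p.Admissible) (hb : p.BoundedBy κ) (hκ : 0 < κ) (t : ℕ) (ω : Ω) :
    ‖I.err sel p t ω‖ ^ 2 ≤ κ * I.wErr sel p t ω := by
  have h1 := quad_B_ge (I := I) (sel := sel) h hb hκ t ω (I.err sel p t ω).ofLp
  rw [dotProduct_ofLp, real_inner_self_eq_norm_sq] at h1
  calc ‖I.err sel p t ω‖ ^ 2 = κ * (κ⁻¹ * ‖I.err sel p t ω‖ ^ 2) := by field_simp
    _ ≤ _ := by unfold wErr; gcongr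

namespace IsThompson

variable [mΩ : MeasurableSpace Ω] {P : Measure Ω}

theorem measurable_state (hs : IsArgmaxRule sel) (hI : I.IsThompson sel P p) (t : ℕ) :
    Measurable (I.B sel p t) ∧ Measurable (I.err sel p t) :=
  ⟨measurable_B hs (fun τ _ => hI.measurable_env τ) fun τ _ => hI.measurable_muTilde τ,
    (measurable_muHat hs (fun τ _ => hI.measurable_env τ)
      fun τ _ => hI.measurable_muTilde τ).sub measurable_const⟩

theorem measurable_chosen (hs : IsArgmaxRule sel) (hI : I.IsThompson sel P p) (t : ℕ) :
    Measurable (I.chosen sel p t) :=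
  (measurable_select_obs hs (hI.measurable_env t) (hI.measurable_muTilde t)).fst

theorem measurable_wErr (hs : IsArgmaxRule sel) (hI : I.IsThompson sel P p) (t : ℕ) :
    Measurable (I.wErr sel p t) := by
  obtain ⟨h1, h2⟩ := hI.measurable_state hs t
  have : I.wErr sel p t = fun ω =>
      (inner ℝ (I.err sel p t ω) (WithLp.toLp 2 (I.B sel p t ω *ᵥ (I.err sel p t ω).ofLp)) : ℝ) := by
    ext ω
    rw [← dotProduct_ofLp, wErr]
  rw [this]
  exact h2.inner (measurable_matrix_mulVec h1 h2)

variable [IsProbabilityMeasure P] {ν : Measure (EuclideanSpace ℝ (Fin d))} {v : NNReal}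
  [IsProbabilityMeasure ν]

theorem lintegral_round_context (hs : IsArgmaxRule sel) (hI : I.IsThompson sel P p)
    (hν : MeasurePreserving p.armObs p.armLaw (ν.prod (gaussianReal 0 v))) (t : ℕ)
    {f : (Matrix (Fin d) (Fin d) ℝ × EuclideanSpace ℝ (Fin d)) ×
      (Fin N → EuclideanSpace ℝ (Fin d)) × EuclideanSpace ℝ (Fin d) → ENNReal}
    (hf : Measurable f) :
    ∫⁻ ω, f ((I.B sel p t ω, I.muHat sel p t ω), fun i => I.xHat p t i ω, I.muTilde t ω) ∂P =
      ∫⁻ ω, ∫⁻ m, ∫⁻ x, f ((I.B sel p t ω, I.muHat sel p t ω), x, m) ∂(Measure.pi fun _ => ν)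
        ∂(multivariateGaussian (I.muHat sel p t ω) (I.B sel p t ω)⁻¹) ∂P := by
  have h1 := hI.lintegral_round hs hν t (f := fun q => f (q.1, fun i => (q.2.1 i).1, q.2.2))
    (hf.comp (by fun_prop))
  refine h1.trans ?_
  have h2 : MeasurePreserving (fun (z : Fin N → EuclideanSpace ℝ (Fin d) × ℝ) i => (z i).1)
      (Measure.pi fun _ => ν.prod (gaussianReal 0 v)) (Measure.pi fun _ => ν) :=
    measurePreserving_pi (fun _ => ν.prod (gaussianReal 0 v)) (fun _ => ν)
      (fun _ => measurePreserving_fst)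
  refine lintegral_congr fun ω => lintegral_congr fun m => ?_
  exact h2.lintegral_comp (f := fun x => f ((I.B sel p t ω, I.muHat sel p t ω), x, m))
    (hf.comp (by fun_prop))

/-- A quantity that depends on the state and on the context estimate of the selected arm. -/
theorem lintegral_round_chosen (hs : IsArgmaxRule sel) (hI : I.IsThompson sel P p)
    (hν : MeasurePreserving p.armObs p.armLaw (ν.prod (gaussianReal 0 v))) (t : ℕ)
    {f : (Matrix (Fin d) (Fin d) ℝ × EuclideanSpace ℝ (Fin d)) × EuclideanSpace ℝ (Fin d) →
      ENNReal} (hf : Measurable f) :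
    ∫⁻ ω, f ((I.B sel p t ω, I.err sel p t ω), I.chosen sel p t ω) ∂P =
      ∫⁻ ω, ∫⁻ m, ∫⁻ x : Fin N → EuclideanSpace ℝ (Fin d),
        f ((I.B sel p t ω, I.err sel p t ω), x (sel x m)) ∂(Measure.pi fun _ => ν)
        ∂(multivariateGaussian (I.muHat sel p t ω) (I.B sel p t ω)⁻¹) ∂P := by
  have h1 : Measurable fun q : (Matrix (Fin d) (Fin d) ℝ × EuclideanSpace ℝ (Fin d)) ×
      (Fin N → EuclideanSpace ℝ (Fin d)) × EuclideanSpace ℝ (Fin d) => q.2.1 (sel q.2.1 q.2.2) :=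
    hs.measurable_selected.comp measurable_snd
  exact hI.lintegral_round_context hs hν t
    (f := fun q => f ((q.1.1, q.1.2 - p.mu), q.2.1 (sel q.2.1 q.2.2)))
    (hf.comp (((measurable_fst.comp measurable_fst).prodMk
      ((measurable_snd.comp measurable_fst).sub measurable_const)).prodMk h1))

theorem spread_le_information (hs : IsArgmaxRule sel) (hp : p.Admissible)
    (hI : I.IsThompson sel P p) (hG : IsCenteredGaussian ν k κ) (hk : 0 < k) (hd : d ≠ 0)
    (hν : MeasurePreserving p.armObs p.armLaw (ν.prod (gaussianReal 0 v))) (t : ℕ) :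
    ENNReal.ofReal (gaussianTrunc / 8 * min 1 k) * ∫⁻ ω, ENNReal.ofReal (I.spread sel p t ω) ∂P ≤
      4 * ∫⁻ ω, ENNReal.ofReal
        (Real.log (1 + infoGain (I.B sel p t ω) (I.chosen sel p t ω))) ∂P +
      2 * ∫⁻ ω, ENNReal.ofReal ((inner ℝ (I.chosen sel p t ω) (I.err sel p t ω)) ^ 2 /
        (1 + infoGain (I.B sel p t ω) (I.chosen sel p t ω))) ∂P := by
  -- The existence of a selection rule already forces at least one arm.
  have hN : N ≠ 0 := fun h => (h ▸ sel 0 0 : Fin 0).elim0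
  obtain ⟨h1, h2⟩ := hI.measurable_state hs t
  have h3 := hI.measurable_chosen hs t
  have h4 := measurable_infoGain h1 h3
  have h5 : Measurable fun ω => ENNReal.ofReal
      (Real.log (1 + infoGain (I.B sel p t ω) (I.chosen sel p t ω))) :=
    ((measurable_const.add h4).log).ennreal_ofReal
  have h6 : Measurable fun ω => ENNReal.ofReal
      ((inner ℝ (I.chosen sel p t ω) (I.err sel p t ω)) ^ 2 /
        (1 + infoGain (I.B sel p t ω) (I.chosen sel p t ω))) :=
    (((h3.inner h2).pow_const 2).div (measurable_const.add h4)).ennreal_ofReal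
  rw [← lintegral_const_mul _ h5, ← lintegral_const_mul _ h6, ← lintegral_add_left
    (h5.const_mul _), ← lintegral_const_mul' _ _ ENNReal.ofReal_ne_top]
  set f : (Matrix (Fin d) (Fin d) ℝ × EuclideanSpace ℝ (Fin d)) × EuclideanSpace ℝ (Fin d) →
      ENNReal := fun q => ENNReal.ofReal (4 * Real.log (1 + infoGain q.1.1 q.2) +
        2 * ((inner ℝ q.2 q.1.2) ^ 2 / (1 + infoGain q.1.1 q.2))) with hf
  have hfm : Measurable f := by
    have e1 : Measurable fun q : (Matrix (Fin d) (Fin d) ℝ × EuclideanSpace ℝ (Fin d)) ×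
        EuclideanSpace ℝ (Fin d) => infoGain q.1.1 q.2 :=
      measurable_infoGain (measurable_fst.comp measurable_fst) measurable_snd
    have e2 : Measurable fun q : (Matrix (Fin d) (Fin d) ℝ × EuclideanSpace ℝ (Fin d)) ×
        EuclideanSpace ℝ (Fin d) => (inner ℝ q.2 q.1.2 : ℝ) :=
      measurable_snd.inner (measurable_snd.comp measurable_fst)
    exact ((((measurable_const.add e1).log).const_mul 4).add
      (((e2.pow_const 2).div (measurable_const.add e1)).const_mul 2)).ennreal_ofReal
  calc _ ≤ ∫⁻ ω, ∫⁻ m, ∫⁻ x : Fin N → EuclideanSpace ℝ (Fin d),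
        f ((I.B sel p t ω, I.err sel p t ω), x (sel x m)) ∂(Measure.pi fun _ => ν)
        ∂(multivariateGaussian (I.muHat sel p t ω) (I.B sel p t ω)⁻¹) ∂P :=
        lintegral_mono fun ω => min_one_le_lintegral hG hk hN hd hs (posDef_B hp t ω) _
    _ = ∫⁻ ω, f ((I.B sel p t ω, I.err sel p t ω), I.chosen sel p t ω) ∂P :=
        (hI.lintegral_round_chosen hs hν t hfm).symm
    _ ≤ _ := by
        refine lintegral_mono fun ω => ?_
        have hi := infoGain_nonneg (posDef_B (I := I) (sel := sel) hp t ω) (I.chosen sel p t ω)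
        have hl : 0 ≤ Real.log (1 + infoGain (I.B sel p t ω) (I.chosen sel p t ω)) :=
          Real.log_nonneg (by linarith)
        simp only [hf]
        rw [ENNReal.ofReal_add (by positivity) (by positivity), ENNReal.ofReal_mul (by norm_num),
          ENNReal.ofReal_mul (by norm_num), ENNReal.ofReal_ofNat, ENNReal.ofReal_ofNat]

theorem spread_le_of_many_arms (hs : IsArgmaxRule sel) (hp : p.Admissible) (hb : p.BoundedBy κ)
    (hκ : 0 < κ) (hI : I.IsThompson sel P p) (hG : IsCenteredGaussian ν k κ) (hk : 0 < k)
    (hd : d ≠ 0) (hν : MeasurePreserving p.armObs p.armLaw (ν.prod (gaussianReal 0 v)))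
    (hμ : ‖p.mu‖ ≤ κ) {T : ℝ} (hT : 1 ≤ T) (hdT : d ≤ T) (hL4 : 4 ≤ Real.log N)
    (hL : 256 * κ * (2 + 2 * κ ^ 2 + κ) / k ^ 2 * T ^ 7 ≤ √(Real.log N)) (t : ℕ) :
    ∫⁻ ω, ENNReal.ofReal (I.spread sel p t ω) ∂P ≤
      ENNReal.ofReal ((1 + κ) / T ^ 2) * ∫⁻ ω, ENNReal.ofReal (I.wErr sel p t ω) ∂P +
      ENNReal.ofReal (d / T ^ 2) +
      ENNReal.ofReal (16 / Real.log (Real.log N)) * ∫⁻ ω, ENNReal.ofReal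
        (Real.log (1 + infoGain (I.B sel p t ω) (I.chosen sel p t ω))) ∂P := by
  have hT0 : 0 < T := by linarith
  have h3 := hI.measurable_wErr hs t
  set f : (Matrix (Fin d) (Fin d) ℝ × EuclideanSpace ℝ (Fin d)) × EuclideanSpace ℝ (Fin d) →
      ENNReal := fun q => ENNReal.ofReal (Real.log (1 + infoGain q.1.1 q.2)) with hf
  have hfm : Measurable f := by
    have e1 : Measurable fun q : (Matrix (Fin d) (Fin d) ℝ × EuclideanSpace ℝ (Fin d)) ×
        EuclideanSpace ℝ (Fin d) => infoGain q.1.1 q.2 :=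
      measurable_infoGain (measurable_fst.comp measurable_fst) measurable_snd
    exact ((measurable_const.add e1).log).ennreal_ofReal
  have h4 := hI.lintegral_round_chosen hs hν t hfm
  simp only [hf] at h4
  rw [h4]
  have hW : Measurable fun ω => ENNReal.ofReal ((1 + κ) / T ^ 2) *
      ENNReal.ofReal (I.wErr sel p t ω) := (h3.ennreal_ofReal).const_mul _
  calc _ ≤ ∫⁻ ω, ((ENNReal.ofReal ((1 + κ) / T ^ 2) * ENNReal.ofReal (I.wErr sel p t ω) +
        ENNReal.ofReal (d / T ^ 2)) + ENNReal.ofReal (16 / Real.log (Real.log N)) *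
        ∫⁻ m, ∫⁻ x : Fin N → EuclideanSpace ℝ (Fin d),
          ENNReal.ofReal (Real.log (1 + infoGain (I.B sel p t ω) (x (sel x m))))
          ∂(Measure.pi fun _ => ν)
          ∂(multivariateGaussian (I.muHat sel p t ω) (I.B sel p t ω)⁻¹)) ∂P := by
        refine lintegral_mono fun ω => ?_
        refine (min_one_le_lintegral_of_many_arms hG hk hκ hd hs (posDef_B hp t ω) hκ
          (quad_B_ge hp hb hκ t ω) hμ hT hdT hL4 hL).trans ?_
        gcongr
        have hw : 0 ≤ I.wErr sel p t ω := (posDef_B hp t ω).quad_nonneg _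
        rw [← ENNReal.ofReal_mul (by positivity), ← ENNReal.ofReal_add (by positivity)
          (by positivity)]
        refine ENNReal.ofReal_le_ofReal ?_
        have h5 := norm_sq_err_le (I := I) (sel := sel) hp hb hκ t ω
        have h6 : ‖I.err sel p t ω‖ ^ 2 / T ^ 3 ≤ κ * I.wErr sel p t ω / T ^ 2 := by
          gcongr
          · norm_num
        change (I.wErr sel p t ω + d) / T ^ 2 + ‖I.err sel p t ω‖ ^ 2 / T ^ 3 ≤ _
        calc _ ≤ (I.wErr sel p t ω + d) / T ^ 2 + κ * I.wErr sel p t ω / T ^ 2 := by gcongr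
          _ = _ := by ring
    _ = _ := by
        have hW' : Measurable fun ω => ENNReal.ofReal ((1 + κ) / T ^ 2) *
            ENNReal.ofReal (I.wErr sel p t ω) + ENNReal.ofReal (d / T ^ 2) :=
          hW.add measurable_const
        rw [lintegral_add_left hW', lintegral_add_left hW,
          lintegral_const_mul' _ _ ENNReal.ofReal_ne_top,
          lintegral_const_mul' _ _ ENNReal.ofReal_ne_top]
        simp

theorem lintegral_norm_sq_chosen_le (hs : IsArgmaxRule sel) (hp : p.Admissible)
    (hI : I.IsThompson sel P p) (hG : IsCenteredGaussian ν k κ) (hk : 0 < k) (hd : d ≠ 0)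
    (hν : MeasurePreserving p.armObs p.armLaw (ν.prod (gaussianReal 0 v))) (t : ℕ) :
    ∫⁻ ω, ENNReal.ofReal (‖I.chosen sel p t ω‖ ^ 2) ∂P ≤
      ENNReal.ofReal (8 * κ * (Real.log N + 1) * d) := by
  have hN : N ≠ 0 := fun h => (h ▸ sel 0 0 : Fin 0).elim0
  have h1 := hI.lintegral_round_chosen hs hν t (f := fun q => ENNReal.ofReal (‖q.2‖ ^ 2))
    (by fun_prop)
  simp only at h1
  rw [h1]
  calc _ ≤ ∫⁻ _, ENNReal.ofReal (8 * κ * (Real.log N + 1) * d) ∂P :=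
        lintegral_mono fun ω => lintegral_norm_sq_selected_le hG hk hN hd hs (posDef_B hp t ω)
    _ = _ := by simp

theorem lintegral_gap_le (hs : IsArgmaxRule sel) (hp : p.Admissible)
    (hκ : 0 < κ) (hI : I.IsThompson sel P p) (hG : IsCenteredGaussian ν k κ) (hk : 0 < k)
    (hd : d ≠ 0) (hν : MeasurePreserving p.armObs p.armLaw (ν.prod (gaussianReal 0 v)))
    (hN : 2 ≤ N) (hμ1 : κ⁻¹ ≤ ‖p.mu‖) (hμ2 : ‖p.mu‖ ≤ κ) (t : ℕ) :
    ∫⁻ ω, ENNReal.ofReal (inner ℝ (I.xHat p t (I.optArm sel p t ω) ω) p.mu -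
        inner ℝ (I.chosen sel p t ω) p.mu) ∂P ≤
      ENNReal.ofReal (4 * (κ / (√k * κ⁻¹) + √κ * κ) * √(Real.log N)) *
        ∫⁻ ω, ENNReal.ofReal (I.spread sel p t ω) ∂P := by
  have h1 : Measurable fun q : (Matrix (Fin d) (Fin d) ℝ × EuclideanSpace ℝ (Fin d)) ×
      (Fin N → EuclideanSpace ℝ (Fin d)) × EuclideanSpace ℝ (Fin d) => q.2.1 (sel q.2.1 q.2.2) :=
    hs.measurable_selected.comp measurable_snd
  have h2 : Measurable fun q : (Matrix (Fin d) (Fin d) ℝ × EuclideanSpace ℝ (Fin d)) ×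
      (Fin N → EuclideanSpace ℝ (Fin d)) × EuclideanSpace ℝ (Fin d) => q.2.1 (sel q.2.1 p.mu) :=
    (hs.measurable_selected_left p.mu).comp (measurable_fst.comp measurable_snd)
  have h3 := hI.lintegral_round_context hs hν t
    (f := fun q => ENNReal.ofReal (inner ℝ (q.2.1 (sel q.2.1 p.mu)) p.mu -
      inner ℝ (q.2.1 (sel q.2.1 q.2.2)) p.mu))
    ((h2.inner measurable_const).sub (h1.inner measurable_const)).ennreal_ofReal
  refine h3.trans_le ?_
  rw [← lintegral_const_mul' _ _ ENNReal.ofReal_ne_top]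
  exact lintegral_mono fun ω => lintegral_regret_le hG hk hN hd hs hκ hμ1 hμ2 (posDef_B hp t ω)

theorem lintegral_wErr_succ_le (hs : IsArgmaxRule sel) (hp : p.Admissible)
    (hI : I.IsThompson sel P p)
    (hν : MeasurePreserving p.armObs p.armLaw (ν.prod (gaussianReal 0 v))) (t : ℕ) :
    ∫⁻ ω, ENNReal.ofReal (I.wErr sel p (t + 1) ω) ∂P +
      ∫⁻ ω, ENNReal.ofReal ((inner ℝ (I.chosen sel p t ω) (I.err sel p t ω)) ^ 2 /
        (1 + infoGain (I.B sel p t ω) (I.chosen sel p t ω))) ∂P ≤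
    ∫⁻ ω, ENNReal.ofReal (I.wErr sel p t ω) ∂P +
      v * ∫⁻ ω, ENNReal.ofReal (infoGain (I.B sel p t ω) (I.chosen sel p t ω) /
        (1 + infoGain (I.B sel p t ω) (I.chosen sel p t ω))) ∂P := by
  have e1 : Measurable fun q : (Matrix (Fin d) (Fin d) ℝ × EuclideanSpace ℝ (Fin d)) ×
      EuclideanSpace ℝ (Fin d) => infoGain q.1.1 q.2 :=
    measurable_infoGain (measurable_fst.comp measurable_fst) measurable_snd
  have e2 : Measurable fun q : (Matrix (Fin d) (Fin d) ℝ × EuclideanSpace ℝ (Fin d)) ×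
      EuclideanSpace ℝ (Fin d) => (inner ℝ q.2 q.1.2 : ℝ) :=
    measurable_snd.inner (measurable_snd.comp measurable_fst)
  have hw := hI.measurable_wErr hs t
  set f₁ : (Matrix (Fin d) (Fin d) ℝ × EuclideanSpace ℝ (Fin d)) × EuclideanSpace ℝ (Fin d) →
    ENNReal := fun q => ENNReal.ofReal ((inner ℝ q.2 q.1.2) ^ 2 / (1 + infoGain q.1.1 q.2)) with hf₁
  set f₂ : (Matrix (Fin d) (Fin d) ℝ × EuclideanSpace ℝ (Fin d)) × EuclideanSpace ℝ (Fin d) →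
    ENNReal := fun q => ENNReal.ofReal (infoGain q.1.1 q.2 / (1 + infoGain q.1.1 q.2)) with hf₂
  have hm₁ : Measurable f₁ := ((e2.pow_const 2).div (measurable_const.add e1)).ennreal_ofReal
  have hm₂ : Measurable f₂ := (e1.div (measurable_const.add e1)).ennreal_ofReal
  have h1 := hI.lintegral_round_chosen hs hν t hm₁
  have h2 := hI.lintegral_round_chosen hs hν t hm₂
  have hsm : Measurable fun q : (Matrix (Fin d) (Fin d) ℝ × EuclideanSpace ℝ (Fin d)) ×
      (Fin N → EuclideanSpace ℝ (Fin d) × ℝ) × EuclideanSpace ℝ (Fin d) =>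
      select sel q.2.1 q.2.2 := (measurable_select hs).comp measurable_snd
  have h3 := hI.lintegral_round hs hν t
    (f := fun q => ENNReal.ofReal (nextError q.1.1 (q.1.2 - p.mu)
      (select sel q.2.1 q.2.2).1 (select sel q.2.1 q.2.2).2)) (by
    refine Measurable.ennreal_ofReal ?_
    have g1 : Measurable fun q : (Matrix (Fin d) (Fin d) ℝ × EuclideanSpace ℝ (Fin d)) ×
        (Fin N → EuclideanSpace ℝ (Fin d) × ℝ) × EuclideanSpace ℝ (Fin d) => q.1.1 :=
      measurable_fst.comp measurable_fst
    have g2 : Measurable fun q : (Matrix (Fin d) (Fin d) ℝ × EuclideanSpace ℝ (Fin d)) ×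
        (Fin N → EuclideanSpace ℝ (Fin d) × ℝ) × EuclideanSpace ℝ (Fin d) => q.1.2 - p.mu :=
      (measurable_snd.comp measurable_fst).sub measurable_const
    have g3 := measurable_infoGain g1 hsm.fst
    have g4 := hsm.fst.inner (𝕜 := ℝ) g2
    have g5 := g2.inner (𝕜 := ℝ) (measurable_matrix_mulVec g1 g2)
    simp only [← dotProduct_ofLp] at g5
    unfold nextError
    exact ((g5.sub ((g4.pow_const 2).div (measurable_const.add g3))).add
      ((measurable_const.mul hsm.snd).mul (g4.div (measurable_const.add g3)))).add
      ((hsm.snd.pow_const 2).mul (g3.div (measurable_const.add g3))))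
  simp only [hf₁] at h1
  simp only [hf₂] at h2
  have h4 : ∫⁻ ω, ENNReal.ofReal (I.wErr sel p (t + 1) ω) ∂P =
      ∫⁻ ω, ∫⁻ m, ∫⁻ z, ENNReal.ofReal (nextError (I.B sel p t ω) (I.err sel p t ω)
        (select sel z m).1 (select sel z m).2) ∂(Measure.pi fun _ => ν.prod (gaussianReal 0 v))
        ∂(multivariateGaussian (I.muHat sel p t ω) (I.B sel p t ω)⁻¹) ∂P := by
    refine Eq.trans ?_ h3
    exact lintegral_congr fun ω => congrArg ENNReal.ofReal (quad_err_succ hp t ω)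
  rw [h4, h1, h2]
  refine (le_lintegral_add _ _).trans ?_
  rw [← lintegral_const_mul' _ _ ENNReal.coe_ne_top, ← lintegral_add_left hw.ennreal_ofReal]
  refine lintegral_mono fun ω => (le_lintegral_add _ _).trans ?_
  have h5 : ENNReal.ofReal (I.wErr sel p t ω) = ∫⁻ _, ENNReal.ofReal (I.wErr sel p t ω)
      ∂(multivariateGaussian (I.muHat sel p t ω) (I.B sel p t ω)⁻¹) := by simp
  rw [h5, ← lintegral_const_mul' _ _ ENNReal.coe_ne_top, ← lintegral_add_left measurable_const]
  exact lintegral_mono fun m => lintegral_nextError_le hs (posDef_B hp t ω) v _ m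

end IsThompson

end Interaction

end Rounds

/-! ### Summation over the rounds. -/

section Sums

theorem integrable_of_map_gaussianReal {Ω : Type*} [MeasurableSpace Ω] {P : Measure Ω} {v : NNReal} {f : Ω → ℝ} (hf : Measurable f)
    (h : P.map f = gaussianReal 0 v) : Integrable f P ∧ ∫ ω, f ω ∂P = 0 := by
  have h1 : MeasurePreserving f P (gaussianReal 0 v) := ⟨hf, h⟩
  refine ⟨h1.integrable_comp_of_integrable (integrable_id_gaussianReal v), ?_⟩
  have h2 := integral_map (μ := P) hf.aemeasurable (f := fun x => x) (by fun_prop)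
  rw [← h2, h]
  exact integral_id_gaussianReal

attribute [local instance] matrixMeasurableSpace borelSpace_matrix polishSpace_matrix

variable {d N : ℕ} {Ω : Type*} {p : Params d} {κ k : ℝ}
  {sel : (Fin N → EuclideanSpace ℝ (Fin d)) → EuclideanSpace ℝ (Fin d) → Fin N}

namespace Interaction.IsThompson

variable {I : Interaction d N Ω} [mΩ : MeasurableSpace Ω] {P : Measure Ω} [IsProbabilityMeasure P]
  {ν : Measure (EuclideanSpace ℝ (Fin d))} {v : NNReal} [IsProbabilityMeasure ν]

theorem lintegral_infoGain_div_le (hp : p.Admissible) (t : ℕ) :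
    ∫⁻ ω, ENNReal.ofReal (infoGain (I.B sel p t ω) (I.chosen sel p t ω) /
      (1 + infoGain (I.B sel p t ω) (I.chosen sel p t ω))) ∂P ≤
      ∫⁻ ω, ENNReal.ofReal
        (Real.log (1 + infoGain (I.B sel p t ω) (I.chosen sel p t ω))) ∂P ∧
    ∫⁻ ω, ENNReal.ofReal (infoGain (I.B sel p t ω) (I.chosen sel p t ω) /
      (1 + infoGain (I.B sel p t ω) (I.chosen sel p t ω))) ∂P ≤ 1 := by
  have h0 : ∀ ω, 0 ≤ infoGain (I.B sel p t ω) (I.chosen sel p t ω) := fun ω =>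
    infoGain_nonneg (posDef_B hp t ω) _
  constructor
  · refine lintegral_mono fun ω => ENNReal.ofReal_le_ofReal ?_
    set y := infoGain (I.B sel p t ω) (I.chosen sel p t ω)
    have hy : 0 ≤ y := h0 ω
    have h1 := Real.one_sub_inv_le_log_of_pos (by linarith : 0 < 1 + y)
    have h2 : 1 - (1 + y)⁻¹ = y / (1 + y) := by field_simp; ring
    rwa [h2] at h1
  · calc _ ≤ ∫⁻ _, 1 ∂P := by
          refine lintegral_mono fun ω => ENNReal.ofReal_le_one.2 ?_
          have := h0 ω
          exact (div_le_one (by linarith)).2 (by linarith)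
      _ = 1 := by simp

/-- A crude bound with at most one noise variance per round. Linear growth is enough where the
weighted error is divided by T². -/
theorem lintegral_wErr_le (hs : IsArgmaxRule sel) (hp : p.Admissible) (hb : p.BoundedBy κ)
    (hκ : 0 < κ) (hI : I.IsThompson sel P p)
    (hν : MeasurePreserving p.armObs p.armLaw (ν.prod (gaussianReal 0 v))) (t : ℕ) :
    ∫⁻ ω, ENNReal.ofReal (I.wErr sel p t ω) ∂P ≤ ENNReal.ofReal (κ * ‖p.mu‖ ^ 2 + t * v) := by
  induction t with
  | zero =>
    calc _ ≤ ∫⁻ _, ENNReal.ofReal (κ * ‖p.mu‖ ^ 2) ∂P :=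
          lintegral_mono fun ω => ENNReal.ofReal_le_ofReal (wErr_zero_le hp hb hκ ω)
      _ = _ := by simp
  | succ t ih =>
    refine (le_self_add.trans (hI.lintegral_wErr_succ_le hs hp hν t)).trans ?_
    calc _ ≤ ENNReal.ofReal (κ * ‖p.mu‖ ^ 2 + t * v) + v * 1 := by
          gcongr
          exact (lintegral_infoGain_div_le hp t).2
      _ = _ := by
          rw [mul_one, ← ENNReal.ofReal_coe_nnreal, ← ENNReal.ofReal_add (by positivity)
            v.coe_nonneg]
          congr 1
          push_cast
          ring

/-- The one-round drift inequality telescopes; the weighted error after the last round is carried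
through the induction and then dropped. The noise contributes h/(1 + h) ≤ log(1 + h) per round. -/
theorem sum_sq_residual_le (hs : IsArgmaxRule sel) (hp : p.Admissible) (hb : p.BoundedBy κ)
    (hκ : 0 < κ) (hI : I.IsThompson sel P p)
    (hν : MeasurePreserving p.armObs p.armLaw (ν.prod (gaussianReal 0 v))) (T : ℕ) :
    ∑ t ∈ Finset.range T, ∫⁻ ω, ENNReal.ofReal
      ((inner ℝ (I.chosen sel p t ω) (I.err sel p t ω)) ^ 2 /
        (1 + infoGain (I.B sel p t ω) (I.chosen sel p t ω))) ∂P ≤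
      ENNReal.ofReal (κ * ‖p.mu‖ ^ 2) + v * ∑ t ∈ Finset.range T, ∫⁻ ω, ENNReal.ofReal
        (Real.log (1 + infoGain (I.B sel p t ω) (I.chosen sel p t ω))) ∂P := by
  suffices h : ∫⁻ ω, ENNReal.ofReal (I.wErr sel p T ω) ∂P +
      ∑ t ∈ Finset.range T, ∫⁻ ω, ENNReal.ofReal
      ((inner ℝ (I.chosen sel p t ω) (I.err sel p t ω)) ^ 2 /
        (1 + infoGain (I.B sel p t ω) (I.chosen sel p t ω))) ∂P ≤
      ENNReal.ofReal (κ * ‖p.mu‖ ^ 2) + v * ∑ t ∈ Finset.range T, ∫⁻ ω, ENNReal.ofReal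
        (Real.log (1 + infoGain (I.B sel p t ω) (I.chosen sel p t ω))) ∂P from
    le_add_self.trans h
  induction T with
  | zero => simpa using hI.lintegral_wErr_le hs hp hb hκ hν 0
  | succ T ih =>
    rw [Finset.sum_range_succ, Finset.sum_range_succ, mul_add, ← add_assoc, add_right_comm]
    calc _ ≤ (∫⁻ ω, ENNReal.ofReal (I.wErr sel p T ω) ∂P +
          v * ∫⁻ ω, ENNReal.ofReal (infoGain (I.B sel p T ω) (I.chosen sel p T ω) /
          (1 + infoGain (I.B sel p T ω) (I.chosen sel p T ω))) ∂P) + _ :=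
          add_le_add_left (hI.lintegral_wErr_succ_le hs hp hν T) _
      _ ≤ _ := by
          rw [add_right_comm]
          refine (add_le_add ih (mul_le_mul_right (lintegral_infoGain_div_le hp T).1 _)).trans ?_
          rw [add_assoc]

theorem sum_information_le (hs : IsArgmaxRule sel) (hp : p.Admissible) (hb : p.BoundedBy κ)
    (hκ : 1 ≤ κ) (hI : I.IsThompson sel P p) (hG : IsCenteredGaussian ν k κ) (hk : 0 < k)
    (hd : d ≠ 0) (hν : MeasurePreserving p.armObs p.armLaw (ν.prod (gaussianReal 0 v))) (T : ℕ) :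
    ∑ t ∈ Finset.range T, ∫⁻ ω, ENNReal.ofReal
      (Real.log (1 + infoGain (I.B sel p t ω) (I.chosen sel p t ω))) ∂P ≤
      ENNReal.ofReal (d * (Real.log (1 + κ + 8 * κ * (T * (Real.log N + 1))) +
        Real.log κ + 1)) := by
  have hκ0 : 0 < κ := by linarith
  have hL : 0 ≤ Real.log N := Real.log_natCast_nonneg N
  -- With this level, a − 1 bounds the expected final trace divided by d, so the trace term of the
  -- log-determinant bound costs at most d.
  set a := 1 + κ + 8 * κ * (T * (Real.log N + 1)) with ha
  have ha1 : 1 ≤ a := by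
    have : 0 ≤ 8 * κ * (T * (Real.log N + 1)) := by positivity
    linarith
  have ha0 : 0 < a := by linarith
  have hla : 0 ≤ Real.log a := Real.log_nonneg ha1
  have hlk : 0 ≤ Real.log κ := Real.log_nonneg hκ
  have hm : ∀ t, Measurable fun ω => ENNReal.ofReal
      (Real.log (1 + infoGain (I.B sel p t ω) (I.chosen sel p t ω))) := fun t =>
    ((measurable_const.add (measurable_infoGain (hI.measurable_state hs t).1
      (hI.measurable_chosen hs t))).log).ennreal_ofReal
  have hc : ∀ t, Measurable fun ω => ENNReal.ofReal (‖I.chosen sel p t ω‖ ^ 2) := fun t =>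
    ((hI.measurable_chosen hs t).norm.pow_const 2).ennreal_ofReal
  have hl0 : ∀ t ω, 0 ≤ Real.log (1 + infoGain (I.B sel p t ω) (I.chosen sel p t ω)) :=
    fun t ω => Real.log_nonneg
      (by linarith [infoGain_nonneg (posDef_B (I := I) (sel := sel) hp t ω) (I.chosen sel p t ω)])
  rw [← lintegral_finsetSum _ fun t _ => hm t]
  calc _ ≤ ∫⁻ ω, (ENNReal.ofReal (d * Real.log a + d * Real.log κ + κ * d / a) +
        ENNReal.ofReal a⁻¹ * ∑ t ∈ Finset.range T, ENNReal.ofReal (‖I.chosen sel p t ω‖ ^ 2)) ∂P := by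
        refine lintegral_mono fun ω => ?_
        rw [← ENNReal.ofReal_sum_of_nonneg fun t _ => hl0 t ω,
          ← ENNReal.ofReal_sum_of_nonneg fun t _ => sq_nonneg _,
          ← ENNReal.ofReal_mul (by positivity), ← ENNReal.ofReal_add (by positivity)
            (mul_nonneg (by positivity) (Finset.sum_nonneg fun t _ => sq_nonneg _))]
        refine ENNReal.ofReal_le_ofReal ((sum_log_le hp hb hκ0 ha0 T ω).trans (le_of_eq ?_))
        ring
    _ = ENNReal.ofReal (d * Real.log a + d * Real.log κ + κ * d / a) +
        ENNReal.ofReal a⁻¹ * ∑ t ∈ Finset.range T,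
          ∫⁻ ω, ENNReal.ofReal (‖I.chosen sel p t ω‖ ^ 2) ∂P := by
        rw [lintegral_add_left measurable_const, lintegral_const_mul' _ _ ENNReal.ofReal_ne_top,
          lintegral_finsetSum _ fun t _ => hc t]
        simp
    _ ≤ ENNReal.ofReal (d * Real.log a + d * Real.log κ + κ * d / a) +
        ENNReal.ofReal a⁻¹ * ∑ _t ∈ Finset.range T,
          ENNReal.ofReal (8 * κ * (Real.log N + 1) * d) := by
        gcongr with t _
        exact hI.lintegral_norm_sq_chosen_le hs hp hG hk hd hν t
    _ = ENNReal.ofReal (d * Real.log a + d * Real.log κ + κ * d / a +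
        a⁻¹ * (T * (8 * κ * (Real.log N + 1) * d))) := by
        rw [Finset.sum_const, Finset.card_range, nsmul_eq_mul, ← ENNReal.ofReal_natCast T,
          ← ENNReal.ofReal_mul (by positivity), ← ENNReal.ofReal_mul (by positivity),
          ← ENNReal.ofReal_add (by positivity) (by positivity)]
    _ ≤ _ := by
        refine ENNReal.ofReal_le_ofReal ?_
        have h1 : κ * d / a + a⁻¹ * (T * (8 * κ * (Real.log N + 1) * d)) ≤ d := by
          have h2 : κ * d / a + a⁻¹ * (T * (8 * κ * (Real.log N + 1) * d)) = (a - 1) / a * d := by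
            rw [ha]; field_simp; ring
          rw [h2]
          refine mul_le_of_le_one_left (Nat.cast_nonneg d) ((div_le_one ha0).2 (by linarith))
        linarith

theorem sum_spread_le (hs : IsArgmaxRule sel) (hp : p.Admissible) (hb : p.BoundedBy κ)
    (hκ : 0 < κ) (hI : I.IsThompson sel P p) (hG : IsCenteredGaussian ν k κ) (hk : 0 < k)
    (hd : d ≠ 0) (hν : MeasurePreserving p.armObs p.armLaw (ν.prod (gaussianReal 0 v))) (T : ℕ)
    {g : ℝ} (hg0 : 0 ≤ g) (hg : ∑ t ∈ Finset.range T, ∫⁻ ω, ENNReal.ofReal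
      (Real.log (1 + infoGain (I.B sel p t ω) (I.chosen sel p t ω))) ∂P ≤ ENNReal.ofReal g) :
    ∑ t ∈ Finset.range T, ∫⁻ ω, ENNReal.ofReal (I.spread sel p t ω) ∂P ≤
      ENNReal.ofReal (((4 + 2 * v) * g + 2 * (κ * ‖p.mu‖ ^ 2)) / (gaussianTrunc / 8 * min 1 k)) := by
  set c := gaussianTrunc / 8 * min 1 k with hc
  have hc0 : 0 < c := mul_pos (div_pos gaussianTrunc_pos (by norm_num)) (lt_min one_pos hk)
  rw [ENNReal.ofReal_div_of_pos hc0, ENNReal.le_div_iff_mul_le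
    (Or.inl (by simpa using hc0)) (Or.inl ENNReal.ofReal_ne_top), mul_comm, Finset.mul_sum]
  calc _ ≤ ∑ t ∈ Finset.range T, (4 * ∫⁻ ω, ENNReal.ofReal
        (Real.log (1 + infoGain (I.B sel p t ω) (I.chosen sel p t ω))) ∂P +
      2 * ∫⁻ ω, ENNReal.ofReal ((inner ℝ (I.chosen sel p t ω) (I.err sel p t ω)) ^ 2 /
        (1 + infoGain (I.B sel p t ω) (I.chosen sel p t ω))) ∂P) :=
        Finset.sum_le_sum fun t _ => hI.spread_le_information hs hp hG hk hd hν t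
    _ ≤ 4 * ENNReal.ofReal g + 2 * (ENNReal.ofReal (κ * ‖p.mu‖ ^ 2) + v * ENNReal.ofReal g) := by
        rw [Finset.sum_add_distrib, ← Finset.mul_sum, ← Finset.mul_sum]
        gcongr
        refine (hI.sum_sq_residual_le hs hp hb hκ hν T).trans ?_
        gcongr
    _ = _ := by
        have h4 : ∀ x, 4 * ENNReal.ofReal x = ENNReal.ofReal (4 * x) := fun x => by
          rw [ENNReal.ofReal_mul (by norm_num), ENNReal.ofReal_ofNat]
        have h2 : ∀ x, 2 * ENNReal.ofReal x = ENNReal.ofReal (2 * x) := fun x => by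
          rw [ENNReal.ofReal_mul (by norm_num), ENNReal.ofReal_ofNat]
        rw [← ENNReal.ofReal_coe_nnreal, ← ENNReal.ofReal_mul (by positivity),
          ← ENNReal.ofReal_add (by positivity) (by positivity), h4, h2,
          ← ENNReal.ofReal_add (by positivity) (by positivity)]
        congr 1
        ring

/-- The expected weighted error is O(T), so over T rounds with weight 1/T² it contributes O(1), and
so does d/T² because d ≤ T. The information is discounted by the iterated logarithm of N. -/
theorem sum_spread_le_of_many_arms (hs : IsArgmaxRule sel) (hp : p.Admissible)
    (hb : p.BoundedBy κ) (hκ : 0 < κ) (hI : I.IsThompson sel P p)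
    (hG : IsCenteredGaussian ν k κ) (hk : 0 < k)
    (hd : d ≠ 0) (hν : MeasurePreserving p.armObs p.armLaw (ν.prod (gaussianReal 0 v)))
    (hμ : ‖p.mu‖ ≤ κ) {T : ℕ} (hT : 1 ≤ T) (hdT : d ≤ T) (hL4 : 4 ≤ Real.log N)
    (hL : 256 * κ * (2 + 2 * κ ^ 2 + κ) / k ^ 2 * (T : ℝ) ^ 7 ≤ √(Real.log N))
    {g : ℝ} (hg0 : 0 ≤ g) (hg : ∑ t ∈ Finset.range T, ∫⁻ ω, ENNReal.ofReal
      (Real.log (1 + infoGain (I.B sel p t ω) (I.chosen sel p t ω))) ∂P ≤ ENNReal.ofReal g) :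
    ∑ t ∈ Finset.range T, ∫⁻ ω, ENNReal.ofReal (I.spread sel p t ω) ∂P ≤
      ENNReal.ofReal ((1 + κ) * (κ * ‖p.mu‖ ^ 2 + v) + 1 + 16 / Real.log (Real.log N) * g) := by
  have hT' : (1 : ℝ) ≤ T := by exact_mod_cast hT
  have hT0 : (0 : ℝ) < T := by linarith
  have hdT' : (d : ℝ) ≤ T := by exact_mod_cast hdT
  have hll : 0 < Real.log (Real.log N) := Real.log_pos (by linarith)
  calc _ ≤ ∑ t ∈ Finset.range T, (ENNReal.ofReal (((1 + κ) * (κ * ‖p.mu‖ ^ 2 + v) + 1) / T) +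
      ENNReal.ofReal (16 / Real.log (Real.log N)) * ∫⁻ ω, ENNReal.ofReal
        (Real.log (1 + infoGain (I.B sel p t ω) (I.chosen sel p t ω))) ∂P) := by
        refine Finset.sum_le_sum fun t ht => ?_
        refine (hI.spread_le_of_many_arms hs hp hb hκ hG hk hd hν hμ hT' hdT' hL4 hL t).trans ?_
        gcongr
        have htT : (t : ℝ) ≤ T := by exact_mod_cast (Finset.mem_range.1 ht).le
        calc _ ≤ ENNReal.ofReal ((1 + κ) / T ^ 2) * ENNReal.ofReal (κ * ‖p.mu‖ ^ 2 + t * v) +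
              ENNReal.ofReal (d / T ^ 2) := by
              gcongr
              exact hI.lintegral_wErr_le hs hp hb hκ hν t
          _ = ENNReal.ofReal ((1 + κ) / T ^ 2 * (κ * ‖p.mu‖ ^ 2 + t * v) + d / T ^ 2) := by
              rw [← ENNReal.ofReal_mul (by positivity), ← ENNReal.ofReal_add (by positivity)
                (by positivity)]
          _ ≤ _ := by
              refine ENNReal.ofReal_le_ofReal ?_
              have h1 : κ * ‖p.mu‖ ^ 2 + t * v ≤ T * (κ * ‖p.mu‖ ^ 2 + v) := by
                have := mul_le_mul_of_nonneg_right hT' (by positivity : 0 ≤ κ * ‖p.mu‖ ^ 2)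
                have := mul_le_mul_of_nonneg_right htT v.coe_nonneg
                linarith
              calc _ ≤ (1 + κ) / T ^ 2 * (T * (κ * ‖p.mu‖ ^ 2 + v)) + T / T ^ 2 := by gcongr
                _ = _ := by field_simp
    _ ≤ ENNReal.ofReal ((1 + κ) * (κ * ‖p.mu‖ ^ 2 + v) + 1) +
        ENNReal.ofReal (16 / Real.log (Real.log N)) * ENNReal.ofReal g := by
        rw [Finset.sum_add_distrib, ← Finset.mul_sum, Finset.sum_const, Finset.card_range,
          nsmul_eq_mul, ← ENNReal.ofReal_natCast T, ← ENNReal.ofReal_mul (by positivity),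
          mul_div_cancel₀ _ hT0.ne']
        gcongr
    _ = _ := by
        rw [← ENNReal.ofReal_mul (by positivity), ← ENNReal.ofReal_add (by positivity)
          (by positivity)]

theorem sum_spread_le_card (T : ℕ) :
    ∑ t ∈ Finset.range T, ∫⁻ ω, ENNReal.ofReal (I.spread sel p t ω) ∂P ≤ ENNReal.ofReal T := by
  calc _ ≤ ∑ _t ∈ Finset.range T, (1 : ENNReal) := by
        refine Finset.sum_le_sum fun t _ => ?_
        calc _ ≤ ∫⁻ _, 1 ∂P :=
              lintegral_mono fun ω => ENNReal.ofReal_le_one.2 (min_le_left _ _)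
          _ = 1 := by simp
    _ = _ := by simp

/-- The reward residual of the arm selected by a rule that is independent of the residuals. -/
theorem map_residual_chosen (hs : IsArgmaxRule sel) (hI : I.IsThompson sel P p)
    (hν : MeasurePreserving p.armObs p.armLaw (ν.prod (gaussianReal 0 v))) (t : ℕ) :
    P.map (fun ω => (I.obs p t ω (I.arm sel p t ω)).2) = gaussianReal 0 v := by
  have hm : Measurable fun ω => (I.obs p t ω (I.arm sel p t ω)).2 :=
    (measurable_select_obs hs (hI.measurable_env t) (hI.measurable_muTilde t)).snd
  refine Measure.ext fun s hs' => ?_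
  have hsm : Measurable fun q : (Matrix (Fin d) (Fin d) ℝ × EuclideanSpace ℝ (Fin d)) ×
      (Fin N → EuclideanSpace ℝ (Fin d) × ℝ) × EuclideanSpace ℝ (Fin d) =>
      select sel q.2.1 q.2.2 := (measurable_select hs).comp measurable_snd
  have h1 := hI.lintegral_round hs hν t
    (f := fun q => s.indicator 1 (select sel q.2.1 q.2.2).2)
    ((measurable_one.indicator hs').comp hsm.snd)
  have h2 : ∀ m, ∫⁻ z, s.indicator 1 (select sel z m).2
      ∂(Measure.pi fun _ => ν.prod (gaussianReal 0 v)) = gaussianReal 0 v s := fun m => by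
    have := (measurePreserving_snd.comp (measurePreserving_selected_noise (ν := ν) hs v m))
    refine (this.lintegral_comp (f := s.indicator 1) (measurable_one.indicator hs')).trans ?_
    rw [lintegral_indicator_one hs']
  simp only [h2] at h1
  rw [Measure.map_apply hm hs', ← lintegral_indicator_one (hm hs')]
  refine Eq.trans (lintegral_congr fun ω => ?_) (h1.trans (by simp))
  rfl

/-- The optimal arm is a function of the estimates of the round, which are independent of the
residuals. -/
theorem map_residual_optArm (hs : IsArgmaxRule sel) (hI : I.IsThompson sel P p)
    (hν : MeasurePreserving p.armObs p.armLaw (ν.prod (gaussianReal 0 v))) (t : ℕ) :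
    P.map (fun ω => (I.obs p t ω (I.optArm sel p t ω)).2) = gaussianReal 0 v := by
  have h1 := measurePreserving_snd.comp (measurePreserving_selected_noise (ν := ν) hs v p.mu)
  have h2 : MeasurePreserving (I.obs p t) P (Measure.pi fun _ => ν.prod (gaussianReal 0 v)) :=
    ⟨measurable_obs (hI.measurable_env t), hI.map_obs hν t⟩
  exact (h1.comp h2).map_eq

end Interaction.IsThompson

end Sums

/-! ### Few arms against many arms, and the final constants. -/

section Regret

/-- If log N is at most of order T¹⁴, then T·log N is at most of order T¹⁵ and its logarithm is
still of order log T. -/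
theorem log_capacity_le_of_few_arms {κ b T L : ℝ} (hκ : 1 ≤ κ) (hT : 1 ≤ T)
    (hL0 : 0 ≤ L) (hL : L ≤ b ^ 2 * T ^ 14 + 4) :
    Real.log (1 + κ + 8 * κ * (T * (L + 1))) ≤
      Real.log (1 + κ + 8 * κ * (b ^ 2 + 5)) + 15 * Real.log T := by
  have hT0 : 0 < T := by linarith
  have h15 : (15 : ℝ) * Real.log T = Real.log (T ^ 15) := by rw [Real.log_pow]; norm_num
  rw [h15, ← Real.log_mul (by positivity) (by positivity)]
  refine Real.log_le_log (by positivity) ?_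
  have h1 : 1 ≤ T ^ 14 := one_le_pow₀ hT
  have h2 : 1 ≤ T ^ 15 := one_le_pow₀ hT
  have h4 : L + 1 ≤ b ^ 2 * T ^ 14 + 5 * T ^ 14 := by linarith
  have h3 : T * (L + 1) ≤ (b ^ 2 + 5) * T ^ 15 := by
    calc T * (L + 1) ≤ T * (b ^ 2 * T ^ 14 + 5 * T ^ 14) := by gcongr
      _ = _ := by ring
  calc 1 + κ + 8 * κ * (T * (L + 1)) ≤ (1 + κ) * T ^ 15 + 8 * κ * ((b ^ 2 + 5) * T ^ 15) := by
        gcongr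
        exact le_mul_of_one_le_right (by linarith) h2
    _ = _ := by ring

/-- Above the threshold T itself is at most of order log N, so the logarithm is of order log log N,
which the discount 1/log log N cancels. -/
theorem log_capacity_le_of_many_arms {κ b T L : ℝ} (hκ : 1 ≤ κ) (hb : 0 < b) (hT : 1 ≤ T)
    (hL4 : 4 ≤ L) (hL : b * T ^ 7 ≤ √L) :
    Real.log (1 + κ + 8 * κ * (T * (L + 1))) ≤
      Real.log (1 + κ + 16 * κ / b) + 2 * Real.log L := by
  have hL0 : 0 < L := by linarith
  have h2 : (2 : ℝ) * Real.log L = Real.log (L ^ 2) := by rw [Real.log_pow]; norm_num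
  rw [h2, ← Real.log_mul (by positivity) (by positivity)]
  refine Real.log_le_log (by positivity) ?_
  have h3 : T ≤ L / b := by
    rw [le_div_iff₀ hb]
    calc T * b ≤ T ^ 7 * b := by
          gcongr
          exact le_self_pow₀ hT (by norm_num)
      _ ≤ √L := by linarith
      _ ≤ L := Real.sqrt_le_self_iff.2 (Or.inr (by linarith))
  have h4 : 1 ≤ L ^ 2 := one_le_pow₀ (by linarith)
  calc 1 + κ + 8 * κ * (T * (L + 1)) ≤ (1 + κ) * L ^ 2 + 8 * κ * (L / b * (2 * L)) := by
        gcongr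
        · exact le_mul_of_one_le_right (by linarith) h4
        · linarith
    _ = _ := by ring

/-- A lower bound for the variance of a context estimate in a direction. -/
def varLower (κ : ℝ) : ℝ := (κ ^ 3 * (1 + κ ^ 2))⁻¹

/-- The factor in the condition under which a round has many arms. -/
def armThreshold (κ : ℝ) : ℝ := 256 * κ * (2 + 2 * κ ^ 2 + κ) / varLower κ ^ 2

/-- The constant in the bound for the sum of the posterior spreads. -/
def spreadConst (κ : ℝ) : ℝ :=
  ((4 + 2 * (κ ^ 3 + κ)) * ((Real.log (1 + κ + 8 * κ * (armThreshold κ ^ 2 + 5)) + Real.log κ + 1) /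
      Real.log 2 + 15) + 2 * κ ^ 3 / Real.log 2) / (gaussianTrunc / 8 * min 1 (varLower κ)) +
  1 / Real.log 2 +
  ((1 + κ) * (κ ^ 3 + (κ ^ 3 + κ)) + 1 +
    16 * (Real.log (1 + κ + 16 * κ / armThreshold κ) + Real.log κ + 3)) / Real.log 2

/-- The constant in the regret bound. -/
def regretConst (κ : ℝ) : ℝ :=
  4 * (κ / (√(varLower κ) * κ⁻¹) + √κ * κ) * |spreadConst κ|

theorem varLower_pos {κ : ℝ} (hκ : 0 < κ) : 0 < varLower κ := by unfold varLower; positivity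

theorem armThreshold_pos {κ : ℝ} (hκ : 0 < κ) : 0 < armThreshold κ := by
  have := varLower_pos hκ
  unfold armThreshold; positivity

variable {d N : ℕ} {Ω : Type*} {p : Params d} {κ : ℝ}
  {sel : (Fin N → EuclideanSpace ℝ (Fin d)) → EuclideanSpace ℝ (Fin d) → Fin N}

/-- In positive dimension a singular value lies in [κ⁻¹, κ], so this interval is nonempty. -/
theorem Params.BoundedBy.one_le (hb : p.BoundedBy κ) (hκ : 0 < κ) (hd : d ≠ 0) : 1 ≤ κ := by
  have : NeZero d := ⟨hd⟩
  have h := hb.bound_A (EuclideanSpace.single 0 1)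
  have h1 : κ⁻¹ ≤ κ := by simpa using h.1.trans h.2
  by_contra hcon
  push Not at hcon
  have := one_lt_inv_iff₀.2 ⟨hκ, hcon⟩
  linarith

namespace Interaction.IsThompson

variable {I : Interaction d N Ω} [mΩ : MeasurableSpace Ω] {P : Measure Ω} [IsProbabilityMeasure P]
  {ν : Measure (EuclideanSpace ℝ (Fin d))} {v : NNReal} [IsProbabilityMeasure ν]

theorem sum_spread_le_log (hs : IsArgmaxRule sel) (hp : p.Admissible) (hb : p.BoundedBy κ)
    (hκ : 0 < κ) (hI : I.IsThompson sel P p) (hG : IsCenteredGaussian ν (varLower κ) κ)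
    (hd : d ≠ 0) (hν : MeasurePreserving p.armObs p.armLaw (ν.prod (gaussianReal 0 v)))
    (hv : (v : ℝ) ≤ κ * ‖p.mu‖ ^ 2 + κ) (hμ : ‖p.mu‖ ≤ κ) {T : ℕ} (hT : 2 ≤ T) :
    ∑ t ∈ Finset.range T, ∫⁻ ω, ENNReal.ofReal (I.spread sel p t ω) ∂P ≤
      ENNReal.ofReal (spreadConst κ * (d * Real.log T)) := by
  have hκ1 := hb.one_le hκ hd
  have hk := varLower_pos hκ
  have hb0 := armThreshold_pos hκ
  set k := varLower κ with hkd
  set b := armThreshold κ with hbd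
  set L := Real.log N with hLd
  have hL0 : 0 ≤ L := Real.log_natCast_nonneg N
  have hT2 : (2 : ℝ) ≤ T := by exact_mod_cast hT
  have hT1 : (1 : ℝ) ≤ T := by linarith
  have hd1 : (1 : ℝ) ≤ d := by exact_mod_cast Nat.one_le_iff_ne_zero.2 hd
  have hl2 : 0 < Real.log 2 := Real.log_pos (by norm_num)
  have hlT : Real.log 2 ≤ Real.log T := Real.log_le_log (by norm_num) hT2
  have hlT0 : 0 ≤ Real.log T := by linarith
  have hq : 1 ≤ Real.log T / Real.log 2 := (one_le_div hl2).2 hlT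
  have hc0 : 0 < gaussianTrunc / 8 * min 1 k :=
    mul_pos (div_pos gaussianTrunc_pos (by norm_num)) (lt_min one_pos hk)
  have hlk : 0 ≤ Real.log κ := Real.log_nonneg hκ1
  have hC1 : 0 ≤ Real.log (1 + κ + 8 * κ * (b ^ 2 + 5)) := Real.log_nonneg (by
    have : 0 ≤ 8 * κ * (b ^ 2 + 5) := by positivity
    linarith)
  have hC2 : 0 ≤ Real.log (1 + κ + 16 * κ / b) := Real.log_nonneg (by
    have : 0 ≤ 16 * κ / b := by positivity
    linarith)
  have hla : 0 ≤ Real.log (1 + κ + 8 * κ * (T * (L + 1))) := Real.log_nonneg (by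
    have : 0 ≤ 8 * κ * (T * (L + 1)) := by positivity
    linarith)
  have hμ3 : κ * ‖p.mu‖ ^ 2 ≤ κ ^ 3 := by
    calc κ * ‖p.mu‖ ^ 2 ≤ κ * κ ^ 2 := by gcongr
      _ = κ ^ 3 := by ring
  have hv3 : (v : ℝ) ≤ κ ^ 3 + κ := by linarith
  have hg := hI.sum_information_le hs hp hb hκ1 hG hk hd hν T
  -- A₁ serves few arms, A₂ many arms with d > T, and A₃ many arms with d ≤ T. Divisions by log 2
  -- absorb additive constants into log T, using T ≥ 2.
  set A₁ := ((4 + 2 * (κ ^ 3 + κ)) * ((Real.log (1 + κ + 8 * κ * (b ^ 2 + 5)) + Real.log κ + 1) /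
      Real.log 2 + 15) + 2 * κ ^ 3 / Real.log 2) / (gaussianTrunc / 8 * min 1 k) with hA₁
  set A₂ := 1 / Real.log 2 with hA₂
  set A₃ := ((1 + κ) * (κ ^ 3 + (κ ^ 3 + κ)) + 1 +
    16 * (Real.log (1 + κ + 16 * κ / b) + Real.log κ + 3)) / Real.log 2 with hA₃
  have hA₁0 : 0 ≤ A₁ := by positivity
  have hA₂0 : 0 ≤ A₂ := by positivity
  have hA₃0 : 0 ≤ A₃ := by positivity
  have hA : spreadConst κ = A₁ + A₂ + A₃ := rfl
  have hdl : 0 ≤ d * Real.log T := by positivity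
  rw [hA]
  by_cases hmany : 4 ≤ L ∧ b * (T : ℝ) ^ 7 ≤ √L
  · obtain ⟨hL4, hLb⟩ := hmany
    by_cases hdT : d ≤ T
    · refine (hI.sum_spread_le_of_many_arms hs hp hb hκ hG hk hd hν hμ (by omega) hdT hL4 hLb
        (by positivity) hg).trans (ENNReal.ofReal_le_ofReal ?_)
      have hll : 1 ≤ Real.log L := by
        rw [Real.le_log_iff_exp_le (by linarith)]
        linarith [Real.exp_one_lt_d9]
      have hll0 : 0 < Real.log L := by linarith
      have h1 := log_capacity_le_of_many_arms hκ1 hb0 hT1 hL4 hLb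
      have h2 : 16 / Real.log L * (d * (Real.log (1 + κ + 8 * κ * (T * (L + 1))) +
          Real.log κ + 1)) ≤ d * (16 * (Real.log (1 + κ + 16 * κ / b) + Real.log κ + 3)) := by
        have h3 : Real.log (1 + κ + 8 * κ * (T * (L + 1))) + Real.log κ + 1 ≤
            (Real.log (1 + κ + 16 * κ / b) + Real.log κ + 3) * Real.log L := by
          have := mul_le_mul_of_nonneg_left hll hC2
          have := mul_le_mul_of_nonneg_left hll hlk
          linarith
        calc _ ≤ 16 / Real.log L * (d * ((Real.log (1 + κ + 16 * κ / b) + Real.log κ + 3) *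
              Real.log L)) := by gcongr
          _ = _ := by field_simp
      have h4 : (1 + κ) * (κ * ‖p.mu‖ ^ 2 + v) + 1 ≤
          d * ((1 + κ) * (κ ^ 3 + (κ ^ 3 + κ)) + 1) := by
        calc _ ≤ (1 + κ) * (κ ^ 3 + (κ ^ 3 + κ)) + 1 := by gcongr
          _ ≤ _ := le_mul_of_one_le_left (by positivity) hd1
      calc _ ≤ d * ((1 + κ) * (κ ^ 3 + (κ ^ 3 + κ)) + 1 +
            16 * (Real.log (1 + κ + 16 * κ / b) + Real.log κ + 3)) := by linarith
        _ ≤ d * ((1 + κ) * (κ ^ 3 + (κ ^ 3 + κ)) + 1 +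
            16 * (Real.log (1 + κ + 16 * κ / b) + Real.log κ + 3)) *
              (Real.log T / Real.log 2) := le_mul_of_one_le_right (by positivity) hq
        _ = A₃ * (d * Real.log T) := by rw [hA₃]; ring
        _ ≤ _ := by gcongr; linarith
    · refine (sum_spread_le_card T).trans (ENNReal.ofReal_le_ofReal ?_)
      have h1 : (T : ℝ) ≤ d := by exact_mod_cast (not_le.1 hdT).le
      calc (T : ℝ) ≤ d := h1
        _ ≤ d * (Real.log T / Real.log 2) := le_mul_of_one_le_right (by positivity) hq
        _ = A₂ * (d * Real.log T) := by rw [hA₂]; ring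
        _ ≤ _ := by gcongr; linarith
  · have hfew : L ≤ b ^ 2 * (T : ℝ) ^ 14 + 4 := by
      have hpos : 0 ≤ b ^ 2 * (T : ℝ) ^ 14 := by positivity
      by_cases hL4 : 4 ≤ L
      · have h1 : √L < b * (T : ℝ) ^ 7 := not_le.1 fun h => hmany ⟨hL4, h⟩
        have h2 := (Real.sqrt_lt' (by positivity)).1 h1
        have h3 : (b * (T : ℝ) ^ 7) ^ 2 = b ^ 2 * (T : ℝ) ^ 14 := by ring
        linarith
      · linarith
    refine (hI.sum_spread_le hs hp hb hκ hG hk hd hν T (by positivity) hg).trans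
      (ENNReal.ofReal_le_ofReal ?_)
    have h1 := log_capacity_le_of_few_arms hκ1 hT1 hL0 hfew
    have h2 : Real.log (1 + κ + 8 * κ * (T * (L + 1))) + Real.log κ + 1 ≤
        ((Real.log (1 + κ + 8 * κ * (b ^ 2 + 5)) + Real.log κ + 1) / Real.log 2 + 15) *
          Real.log T := by
      have h3 : Real.log (1 + κ + 8 * κ * (b ^ 2 + 5)) + Real.log κ + 1 ≤
          (Real.log (1 + κ + 8 * κ * (b ^ 2 + 5)) + Real.log κ + 1) *
            (Real.log T / Real.log 2) := le_mul_of_one_le_right (by positivity) hq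
      calc _ ≤ (Real.log (1 + κ + 8 * κ * (b ^ 2 + 5)) + Real.log κ + 1) *
            (Real.log T / Real.log 2) + 15 * Real.log T := by linarith
        _ = _ := by ring
    have h4 : 2 * (κ * ‖p.mu‖ ^ 2) ≤ 2 * κ ^ 3 / Real.log 2 * (d * Real.log T) := by
      calc 2 * (κ * ‖p.mu‖ ^ 2) ≤ 2 * κ ^ 3 * (1 * 1) := by linarith
        _ ≤ 2 * κ ^ 3 * (d * (Real.log T / Real.log 2)) := by gcongr
        _ = _ := by ring
    calc _ ≤ ((4 + 2 * (κ ^ 3 + κ)) * (d * (((Real.log (1 + κ + 8 * κ * (b ^ 2 + 5)) +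
          Real.log κ + 1) / Real.log 2 + 15) * Real.log T)) +
          2 * κ ^ 3 / Real.log 2 * (d * Real.log T)) / (gaussianTrunc / 8 * min 1 k) := by
          gcongr
      _ = A₁ * (d * Real.log T) := by rw [hA₁]; ring
      _ ≤ _ := by gcongr; linarith

theorem sum_gap_le (hs : IsArgmaxRule sel) (hp : p.Admissible) (hb : p.BoundedBy κ)
    (hκ : 0 < κ) (hI : I.IsThompson sel P p) (hG : IsCenteredGaussian ν (varLower κ) κ)
    (hν : MeasurePreserving p.armObs p.armLaw (ν.prod (gaussianReal 0 v)))
    (hv : (v : ℝ) ≤ κ * ‖p.mu‖ ^ 2 + κ) {T : ℕ} (hT : 2 ≤ T) :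
    ∑ t ∈ Finset.range T, ∫⁻ ω, ENNReal.ofReal (inner ℝ (I.xHat p t (I.optArm sel p t ω) ω) p.mu -
        inner ℝ (I.chosen sel p t ω) p.mu) ∂P ≤
      ENNReal.ofReal (regretConst κ * (d * √(Real.log N) * Real.log T)) := by
  -- In these cases the gap vanishes identically, as it must for one arm, where the bound is 0. They
  -- are also the cases in which the normalization of μ or the bound for the mean of the maximum is
  -- not available.
  by_cases h0 : d = 0 ∨ N < 2 ∨ p.mu = 0
  · have h1 : ∀ t ω, (inner ℝ (I.xHat p t (I.optArm sel p t ω) ω) p.mu -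
        inner ℝ (I.chosen sel p t ω) p.mu : ℝ) = 0 := by
      intro t ω
      rcases h0 with h | h | h
      · subst h
        rw [Subsingleton.elim p.mu 0, inner_zero_right, inner_zero_right, sub_zero]
      · have : Subsingleton (Fin N) := by
          rw [Fin.subsingleton_iff_le_one]; omega
        rw [chosen, Subsingleton.elim (I.optArm sel p t ω) (I.arm sel p t ω), sub_self]
      · rw [h, inner_zero_right, inner_zero_right, sub_zero]
    simp [h1]
  · push Not at h0
    obtain ⟨hd, hN, hμ0⟩ := h0
    obtain ⟨hμ1, hμ2⟩ := hb.bound_mu.resolve_left hμ0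
    calc _ ≤ ∑ t ∈ Finset.range T,
          ENNReal.ofReal (4 * (κ / (√(varLower κ) * κ⁻¹) + √κ * κ) * √(Real.log N)) *
            ∫⁻ ω, ENNReal.ofReal (I.spread sel p t ω) ∂P :=
          Finset.sum_le_sum fun t _ =>
            hI.lintegral_gap_le hs hp hκ hG (varLower_pos hκ) hd hν hN hμ1 hμ2 t
      _ ≤ ENNReal.ofReal (4 * (κ / (√(varLower κ) * κ⁻¹) + √κ * κ) * √(Real.log N)) *
            ENNReal.ofReal (spreadConst κ * (d * Real.log T)) := by
          rw [← Finset.mul_sum]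
          gcongr
          exact hI.sum_spread_le_log hs hp hb hκ hG hd hν hv hμ2 hT
      _ = ENNReal.ofReal (4 * (κ / (√(varLower κ) * κ⁻¹) + √κ * κ) * √(Real.log N) *
            (spreadConst κ * (d * Real.log T))) :=
          (ENNReal.ofReal_mul (by positivity)).symm
      _ ≤ _ := by
          refine ENNReal.ofReal_le_ofReal ?_
          have hlT : 0 ≤ Real.log T := Real.log_natCast_nonneg T
          calc _ ≤ 4 * (κ / (√(varLower κ) * κ⁻¹) + √κ * κ) * √(Real.log N) *
                (|spreadConst κ| * (d * Real.log T)) := by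
                gcongr
                exact le_abs_self _
            _ = _ := by rw [regretConst]; ring

end Interaction.IsThompson

end Regret

end

theorem theorem2 (κ : ℝ) (hκ : 0 < κ) :
    ∃ C : ℝ, ∀ (d N : ℕ) (p : Params d), p.Admissible → p.BoundedBy κ →
      ∀ sel : (Fin N → EuclideanSpace ℝ (Fin d)) → EuclideanSpace ℝ (Fin d) → Fin N,
      IsArgmaxRule sel →
      ∀ (Ω : Type*) [MeasurableSpace Ω] (P : Measure Ω) [IsProbabilityMeasure P]
        (I : Interaction d N Ω), I.IsThompson sel P p →
      ∀ T : ℕ, 2 ≤ T →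
        Integrable (I.rewardGap sel p T) P ∧
        |I.regret sel P p T| ≤ C * (d * Real.sqrt (Real.log N) * Real.log T) := by
  refine ⟨regretConst κ, fun d N p hp hb sel hs Ω _ P _ I hI T hT => ?_⟩
  obtain ⟨ν, v, hG, hv, hν⟩ := hp.law_armObs hb hκ
  have hGν := hG.gaussian
  have hsum := hI.sum_gap_le hs hp hb hκ hG hν hv hT
  set Δ : ℕ → Ω → ℝ := fun t ω => inner ℝ (I.xHat p t (I.optArm sel p t ω) ω) p.mu -
    inner ℝ (I.chosen sel p t ω) p.mu with hΔ
  have hΔ0 : ∀ t ω, 0 ≤ Δ t ω := fun t ω => 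
    sub_nonneg.2 (hs.le (fun i => I.xHat p t i ω) p.mu _)
  have hopt : ∀ t, Measurable fun ω => I.obs p t ω (I.optArm sel p t ω) := fun t =>
    (Interaction.measurable_select hs).comp
      ((Interaction.measurable_obs (hI.measurable_env t)).prodMk measurable_const)
  have harm : ∀ t, Measurable fun ω => I.obs p t ω (I.arm sel p t ω) := fun t =>
    Interaction.measurable_select_obs hs (hI.measurable_env t) (hI.measurable_muTilde t)
  have hΔm : ∀ t, Measurable (Δ t) := fun t =>
    ((hopt t).fst.inner measurable_const).sub ((harm t).fst.inner measurable_const)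
  have hΔi : ∀ t ∈ Finset.range T, Integrable (Δ t) P := fun t ht => by
    refine ⟨(hΔm t).aestronglyMeasurable, ?_⟩
    rw [hasFiniteIntegral_iff_ofReal (ae_of_all _ (hΔ0 t))]
    exact ((Finset.single_le_sum (f := fun t => ∫⁻ ω, ENNReal.ofReal (Δ t ω) ∂P)
      (fun _ _ => zero_le) ht).trans hsum).trans_lt ENNReal.ofReal_lt_top
  have hη₁ := fun t => integrable_of_map_gaussianReal (hopt t).snd (hI.map_residual_optArm hs hν t)
  have hη₂ := fun t => integrable_of_map_gaussianReal (harm t).snd (hI.map_residual_chosen hs hν t)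
  -- The gap of the true rewards is the nonnegative gap of the estimated rewards plus a difference
  -- of residuals. Each residual is centred normal, so the difference is integrable with mean zero,
  -- although the residuals of the two arms may be dependent.
  have hgap : I.rewardGap sel p T = fun ω => ∑ t ∈ Finset.range T, (Δ t ω +
      ((I.obs p t ω (I.optArm sel p t ω)).2 - (I.obs p t ω (I.arm sel p t ω)).2)) := by
    ext ω
    refine Finset.sum_congr rfl fun t _ => ?_
    rw [Interaction.reward_eq, Interaction.reward_eq]
    simp only [hΔ, Interaction.chosen, Interaction.fst_obs]
    ring
  have hint : ∀ t ∈ Finset.range T, Integrable (fun ω => Δ t ω +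
      ((I.obs p t ω (I.optArm sel p t ω)).2 - (I.obs p t ω (I.arm sel p t ω)).2)) P :=
    fun t ht => (hΔi t ht).add ((hη₁ t).1.sub (hη₂ t).1)
  refine ⟨by rw [hgap]; exact integrable_finsetSum _ hint, ?_⟩
  have hreg : I.regret sel P p T = ∑ t ∈ Finset.range T, ∫ ω, Δ t ω ∂P := by
    rw [Interaction.regret, hgap, integral_finsetSum _ hint]
    refine Finset.sum_congr rfl fun t ht => ?_
    have hsub : Integrable (fun ω => (I.obs p t ω (I.optArm sel p t ω)).2 -
        (I.obs p t ω (I.arm sel p t ω)).2) P := (hη₁ t).1.sub (hη₂ t).1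
    rw [integral_add (hΔi t ht) hsub, integral_sub (hη₁ t).1 (hη₂ t).1,
      (hη₁ t).2, (hη₂ t).2, sub_zero, add_zero]
  have hi0 : ∀ t, 0 ≤ ∫ ω, Δ t ω ∂P := fun t => integral_nonneg (hΔ0 t)
  rw [hreg, abs_of_nonneg (Finset.sum_nonneg fun t _ => hi0 t)]
  have hR : 0 ≤ regretConst κ * (d * √(Real.log N) * Real.log T) := by
    have := Real.log_natCast_nonneg T
    unfold regretConst
    positivity
  rw [← ENNReal.ofReal_le_ofReal_iff hR, ENNReal.ofReal_sum_of_nonneg fun t _ => hi0 t]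
  refine le_trans (le_of_eq (Finset.sum_congr rfl fun t ht => ?_)) hsum
  exact ofReal_integral_eq_lintegral_ofReal (hΔi t ht) (ae_of_all _ (hΔ0 t))
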